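/- Let $q$ be a prime power, write $\mathrm{GF}(q^2)=\mathrm{GF}(q)(\omega)$ with $\omega\in\mathrm{GF}(q^2)\setminus\mathrm{GF}(q)$, and put $\mathbb F=\mathrm{GF}(q^2)$. **Definitions.** An $\mathbb F$-represented matroid on a finite set $E$ is a pair $M=(U,E)$ with $U$ a subspace of $\mathbb F^E$; its rank function is $r_M(X)=\dim U[X]$, where $U[X]$ is the projection of $U$ to $\mathbb F^X$, and this determines the underlying abstract matroid $\tilde M$. For an $\mathbb F$-matrix $A$ with column set $E$, $M(A)=(\mathrm{rowspace}(A),E)$. Deletion is $M\setminus X=(U[E\setminus X],E\setminus X)$, the dual is $M^*=(U^\perp,E)$, contraction is $M/X=(M^*\setminus X)^*$, and minors and restrictions are obtained from these operations. $M$ has a $\mathrm{PG}(m,q)$-minor if it has a minor $N$ with $\tilde N\cong\mathrm{PG}(m,q)$. Two $\mathbb F$-represented matroids on the same ground set are projectively equivalent, written $\approx$, if the subspace of one is obtained from that of the other by scaling coordinates by nonzero elements of $\mathbb F$; ground sets may be relabelled by a bijection. $M$ is round if $E$ is not the union of two hyperplanes of $M$. The simplification $\mathrm{si}(M)$ is the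 restriction of $M$ to a set that contains exactly one element of each parallel class of nonloops. Let $\mathcal{PG}(n-1,q)$ be the set of $\mathrm{GF}(q)$-matrices $G$ with row set $\{1,\dots,n\}$ such that $\tilde M(G)\cong\mathrm{PG}(n-1,q)$. For $w\in\mathbb F^t$, let $L(w)=\mathrm{span}_{\mathrm{GF}(q)}\{u,v\}$, where $u,v\in\mathrm{GF}(q)^t$ are the unique vectors with $w=u+\omega v$. Let $\mathcal O(q)$ be the class of $\mathbb F$-represented matroids $M$ with $M\approx M(A\mid G_3)$, where $G_3\in\mathcal{PG}(2,q)$ and $A$ is a rank-$3$ matrix over $\mathbb F$ with row set $\{1,2,3\}$ and three columns $A_x$ such that the three subspaces $L(A_x)$ each have dimension $2$ and together have trivial intersection. Let $\widehat A(n-1,q)$ be the $\mathbb F$-matrix with $n$ rows whose columns are the first standard basis vector and the vectors $\binom{c}{a}$ for all $c\in\mathbb F$ and all columns $a$ of a fixed matrix in $\mathcal{PG}(n-2,q)$. Let $\overline A(n-1,q)$ be the $\mathbb F$-matrix with $n$ rows whose columns are the columns of a fixed matrix in $\mathcal{PG}(n-1,q)$, the vector $(1,\omega,0,\dots,0)^T$,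 and the vectors $(\alpha,\omega\alpha,1,0,\dots,0)^T$ for all nonzero $\alpha\in\mathbb F$. **Theorem.** If $M$ is a round rank-$r$ $\mathrm{GF}(q^2)$-represented matroid with a $\mathrm{PG}(12q^{12}+19,q)$-minor and no minor in $\mathcal O(q)$, then $\mathrm{si}(M)$ is projectively equivalent to a restriction of $M(\widehat A(r-1,q))$ or of $M(\overline A(r-1,q))$ (for every choice of $\omega$ and of the fixed matrices above). -/

import Mathlib

open scoped LinearAlgebra.Projectivization

noncomputable section

universe u v w

/-- An `F`-represented matroid on the ground set `E`: a subspace `U` of `F^E`. -/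
abbrev RepMatroid (F : Type v) [Field F] (E : Type u) := Submodule F (E → F)

namespace RepMatroid

variable {F : Type v} [Field F] {E : Type u} {E' : Type w}

/-- The represented matroid `M(A)`, given by the row space of the matrix `A`. -/
def ofMatrix {ρ : Type*} (A : Matrix ρ E F) : RepMatroid F E :=
  Submodule.span F (Set.range A.row)

/-- Pull a represented matroid back along a map `φ` of ground sets: the column of `e` is the column
of `φ e` in `M`. For injective `φ` this is the restriction of `M` to the range of `φ`, relabelled
by `φ`. -/
def pullback (M : RepMatroid F E) (φ : E' → E) : RepMatroid F E' :=
  Submodule.map (LinearMap.funLeft F F φ) M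

/-- The restriction `M | X`. -/
def restrict (M : RepMatroid F E) (X : Set E) : RepMatroid F X :=
  M.pullback (Subtype.val : X → E)

/-- The deletion `M \ X`. -/
def delete (M : RepMatroid F E) (X : Set E) : RepMatroid F (Xᶜ : Set E) :=
  M.restrict Xᶜ

/-- The rank function `r_M(X) = dim U[X]`, where `U[X]` is the projection of `U` to `F^X`. -/
def rk (M : RepMatroid F E) (X : Set E) : ℕ :=
  Module.finrank F (M.restrict X)

/-- The rank of `M`. -/
def rank (M : RepMatroid F E) : ℕ := M.rk Set.univ

/-- The dual `(U^⊥, E)` with respect to the standard bilinear form (all ground sets are finite). -/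
def dual [Finite E] (M : RepMatroid F E) : RepMatroid F E where
  carrier := {x | ∀ y ∈ M, ∑ᶠ e, x e * y e = 0}
  zero_mem' := by
    intro y _
    simp
  add_mem' := by
    intro a b ha hb y hy
    have h : ∑ᶠ e, (a + b) e * y e = ∑ᶠ e, a e * y e + ∑ᶠ e, b e * y e := by
      rw [← finsum_add_distrib (Set.toFinite _) (Set.toFinite _)]
      exact finsum_congr fun e => by simp [add_mul]
    rw [h, ha y hy, hb y hy, add_zero]
  smul_mem' := by
    intro c a ha y hy
    have h : ∑ᶠ e, (c • a) e * y e = c * ∑ᶠ e, a e * y e := by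
      rw [mul_finsum]
      exact finsum_congr fun e => by simp [mul_assoc]
    rw [h, ha y hy, mul_zero]

/-- The contraction `M / X = (M^* \ X)^*`. -/
def contract [Finite E] (M : RepMatroid F E) (X : Set E) : RepMatroid F (Xᶜ : Set E) :=
  (M.dual.delete X).dual

/-- A flat: adding any further element increases the rank. -/
def IsFlat (M : RepMatroid F E) (X : Set E) : Prop :=
  ∀ e, e ∉ X → M.rk X < M.rk (insert e X)

/-- A hyperplane: a flat whose rank is one less than the rank of `M`. -/
def IsHyperplane (M : RepMatroid F E) (H : Set E) : Prop :=
  M.IsFlat H ∧ M.rk H + 1 = M.rank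

/-- `M` is round: its ground set is not the union of two hyperplanes. -/
def IsRound (M : RepMatroid F E) : Prop :=
  ∀ H₁ H₂ : Set E, M.IsHyperplane H₁ → M.IsHyperplane H₂ → H₁ ∪ H₂ ≠ Set.univ

def IsNonloop (M : RepMatroid F E) (e : E) : Prop := M.rk {e} = 1

/-- Two nonloops are parallel if together they have rank one (each nonloop is parallel to itself). -/
def Parallel (M : RepMatroid F E) (e f : E) : Prop :=
  M.IsNonloop e ∧ M.IsNonloop f ∧ M.rk {e, f} = 1

/-- `S` consists of exactly one element of each parallel class of nonloops; the matroids
`M | S` for such `S` are the realizations of the simplification `si(M)`. -/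
def IsSimplificationSet (M : RepMatroid F E) (S : Set E) : Prop :=
  (∀ e ∈ S, M.IsNonloop e) ∧
  (∀ e ∈ S, ∀ f ∈ S, M.Parallel e f → e = f) ∧
  (∀ e, M.IsNonloop e → ∃ f ∈ S, M.Parallel e f)

/-- Projective equivalence: the two row spaces agree after scaling the columns by nonzero
scalars. -/
def ProjEquiv (M N : RepMatroid F E) : Prop :=
  ∃ d : E → Fˣ, ∀ x : E → F, x ∈ M ↔ (fun e => (d e : F) * x e) ∈ N

/-- `M` is, up to the names of its elements, projectively equivalent to a restriction of `N`. -/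
def ProjEquivToRestriction (M : RepMatroid F E) (N : RepMatroid F E') : Prop :=
  ∃ φ : E ↪ E', M.ProjEquiv (N.pullback φ)

end RepMatroid

/-- The rank function of the projective geometry on the points of the projective space of `V`. -/
def pgRk (K : Type v) [Field K] {V : Type w} [AddCommGroup V] [Module K V] (X : Set (ℙ K V)) : ℕ :=
  Module.finrank K (⨆ p ∈ X, p.submodule : Submodule K V)

/-- The abstract matroid of `M` is isomorphic to the rank-`n` projective geometry `PG(n-1, K)`. -/
def RepMatroid.IsPG {F : Type v} [Field F] {E : Type u} (K : Type w) [Field K] (n : ℕ)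
    (M : RepMatroid F E) : Prop :=
  ∃ φ : E ≃ ℙ K (Fin n → K), ∀ X : Set E, M.rk X = pgRk K (φ '' X)

/-- The `K`-matrices with `n` rows that represent `PG(n-1, K)`. -/
def IsPGMatrix {K : Type v} [Field K] {n : ℕ} {κ : Type u} (G : Matrix (Fin n) κ K) : Prop :=
  (RepMatroid.ofMatrix G).IsPG K n

/-- `M` has a minor isomorphic, as an abstract matroid, to `PG(n-1, K)`. -/
def RepMatroid.HasPGMinor {F : Type v} [Field F] {E : Type u} [Finite E] (K : Type w) [Field K]
    (n : ℕ) (M : RepMatroid F E) : Prop :=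
  ∃ (C : Set E) (D : Set (Cᶜ : Set E)), ((M.contract C).delete D).IsPG K n

section Extension

variable {K : Type w} [Field K] {F : Type v} [Field F] [Algebra K F]

/-- `L(x)`: the `K`-span of `{a, b}`, where `x = a + ω b` with `a`, `b` vectors over `K` (these are
unique when `1, ω` is a `K`-basis of `F`). -/
def lineSpan (ω : F) {t : ℕ} (x : Fin t → F) : Submodule K (Fin t → K) :=
  Submodule.span K {c | ∃ a b : Fin t → K,
    (∀ i, x i = algebraMap K F (a i) + ω * algebraMap K F (b i)) ∧ (c = a ∨ c = b)}

/-- The obstruction class: `M ≈ M(A | G)` where `G` is a `K`-matrix representing `PG(2, K)` and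
`A` is a rank-3 matrix over `F` with three columns, whose associated `K`-subspaces `L` all have
dimension two and have trivial common intersection. -/
def RepMatroid.IsObstruction (K : Type w) [Field K] [Algebra K F] (ω : F) {E : Type u}
    (M : RepMatroid F E) : Prop :=
  ∃ (κ : Type u) (φ : Fin 3 ⊕ κ ≃ E) (A : Matrix (Fin 3) (Fin 3) F) (G : Matrix (Fin 3) κ K),
    IsPGMatrix G ∧ A.rank = 3 ∧
    (∀ j, Module.finrank K (lineSpan (K := K) ω (A.col j)) = 2) ∧
    (⨅ j, lineSpan (K := K) ω (A.col j)) = ⊥ ∧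
    (M.pullback φ).ProjEquiv
      (RepMatroid.ofMatrix (Matrix.fromCols A (G.map (algebraMap K F))))

/-- `M` has a minor in the obstruction class. -/
def RepMatroid.HasObstructionMinor (K : Type w) [Field K] [Algebra K F] (ω : F) {E : Type u}
    [Finite E] (M : RepMatroid F E) : Prop :=
  ∃ (C : Set E) (D : Set (Cᶜ : Set E)), ((M.contract C).delete D).IsObstruction K ω

/-- The matrix `Â` built from a matrix `A` over `K`: a column `(c, A_k)` for every `c` in `F`
and every column `A_k` of `A`, together with the first standard basis vector. -/
def hatMatrix (F : Type v) [Field F] [Algebra K F] {m : ℕ} {κ : Type u} (A : Matrix (Fin m) κ K) :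
    Matrix (Fin (m + 1)) (Option (F × κ)) F :=
  Matrix.of fun i j => match j with
    | none => (Fin.cons 1 0 : Fin (m + 1) → F) i
    | some (c, k) => (Fin.cons c (fun l => algebraMap K F (A l k)) : Fin (m + 1) → F) i

/-- The matrix `Ā` built from a matrix `A` over `K`: the columns of `A`, the column
`(1, ω, 0, 0, …, 0)`, and the columns `(α, ω α, 1, 0, …, 0)` for all nonzero `α` in `F`. -/
def barMatrix (ω : F) {n : ℕ} {κ : Type u} (A : Matrix (Fin n) κ K) :
    Matrix (Fin n) (Option {α : F // α ≠ 0} ⊕ κ) F :=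
  Matrix.of fun i j => match j with
    | Sum.inl none => if i.val = 0 then 1 else if i.val = 1 then ω else 0
    | Sum.inl (some α) =>
        if i.val = 0 then α.1 else if i.val = 1 then ω * α.1 else if i.val = 2 then 1 else 0
    | Sum.inr k => algebraMap K F (A i k)

end Extension

end

set_option linter.unusedSectionVars false

/-! Write `M` as a spanning family of vectors `v e` in an `F`-space `V`, with `K` = GF(q) and `F` =
GF(q²); contraction is passage to a quotient. A form is a `K`-subspace `Γ` with `Γ + ωΓ = V`, and an
element is called special if no nonzero multiple of it lies in `Γ`.

Suppose first that `Γ` is a genuine `K`-form (`K`-independent vectors are `F`-independent) and that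
all its points occur in `M`. A special element `a + ωb` determines the `K`-line ⟨a, b⟩ of `Γ`, and
contracting it puts the whole `F`-line of `b` into the form. Two independent `F`-lines in a form
give an obstruction (`hasObs_of_two_dimensional`), so any two special lines meet. If all of them
share a point, `M` is of type `Â`. Otherwise three of them are the sides of a triangle; three
independent special vectors on these sides would be an obstruction, so the vectors span an `F`-line,
and this line must contain every special element: type `Ā` (`isHat_or_isBar`).

In general the minor only gives a subspace `W`, spanned by elements, such that all points of a
`K`-form occur modulo `W`; this form comes from the fundamental theorem of projective geometry
(`PreservesRank.exists_kform`). The proof is by induction on dim `V` (`isHat_or_isBar_of_isCore`).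
Contract a nonzero element of `W`; the structure of the quotient lifts to a form `Γ` that contains
multiples of all elements outside a subspace of dimension at most 4. Enlarge `W` by a few vectors to
a subspace `Y` containing it. If the form elements outside a small extension of `Y` all lie in a
proper subspace of `Γ`, replace `Γ` by that subspace. Roundness ensures that it still spans, and
dim_K `Γ` ≤ dim `V` + 2 allows only two replacements. Afterwards the form elements are abundant.

Abundance replaces the missing points of `Γ ∩ Y` (`IsAbundant.exists_fill`). If lifting directions
modulo `Γ ∩ Y` to available elements were additive, the available elements could not span. So the
failures of additivity span `Γ ∩ Y`, and by contracting boundedly many elements outside `Y` every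
vector of `Γ ∩ Y` becomes an available point. The obstructions of the special case can then be built
inside a suitable quotient of `Y`. The sets to be filled have at most q⁵ vectors, which is the
source of the numerical bound. -/

namespace RepMatroid

/-! ### Represented matroids as vector configurations: minors, duality, roundness -/

section VecRep

variable {F : Type*} [Field F] {E : Type*} {E' : Type*}
  {V : Type*} [AddCommGroup V] [Module F V] {V' : Type*} [AddCommGroup V'] [Module F V']

/-- The represented matroid of a family of vectors. -/
def vecRep (F : Type*) [Field F] {V : Type*} [AddCommGroup V] [Module F V] {E : Type*}
    (v : E → V) : RepMatroid F E :=
  LinearMap.range (LinearMap.pi fun e => Module.Dual.eval F V (v e))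

theorem mem_vecRep {v : E → V} {x : E → F} :
    x ∈ vecRep F v ↔ ∃ f : Module.Dual F V, ∀ e, f (v e) = x e := by
  simp only [vecRep, LinearMap.mem_range]
  constructor
  · rintro ⟨f, rfl⟩
    exact ⟨f, fun e => rfl⟩
  · rintro ⟨f, hf⟩
    exact ⟨f, funext hf⟩

/-- The vectors are the coordinate functionals on the row space. Reflexivity gives all functionals
on the dual as evaluations, and the vectors span because a member of the row space with all
coordinates zero is zero. -/
theorem exists_vecRep [Finite E] (M : RepMatroid F E) :
    ∃ v : E → Module.Dual F M, M = vecRep F v ∧ Submodule.span F (Set.range v) = ⊤ := by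
  refine ⟨fun e => (LinearMap.proj e).comp M.subtype, ?_, ?_⟩
  · ext x
    rw [mem_vecRep]
    constructor
    · intro hx
      exact ⟨Module.Dual.eval F M ⟨x, hx⟩, fun e => rfl⟩
    · rintro ⟨f, hf⟩
      obtain ⟨m, rfl⟩ := (Module.evalEquiv F M).surjective f
      have : x = m.1 := funext fun e => (hf e).symm
      rw [this]
      exact m.2
  · by_contra h
    obtain ⟨f, hf, hle⟩ := Submodule.exists_le_ker_of_lt_top _ (lt_top_iff_ne_top.2 h)
    obtain ⟨m, rfl⟩ := (Module.evalEquiv F M).surjective f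
    apply hf
    have : m = 0 := by
      ext e
      exact hle (Submodule.subset_span ⟨e, rfl⟩)
    rw [this, map_zero]

theorem vecRep_pullback (v : E → V) (φ : E' → E) :
    (vecRep F v).pullback φ = vecRep F (v ∘ φ) := by
  ext x
  simp only [pullback, Submodule.mem_map, mem_vecRep]
  constructor
  · rintro ⟨y, ⟨f, hf⟩, rfl⟩
    exact ⟨f, fun e => hf (φ e)⟩
  · rintro ⟨f, hf⟩
    exact ⟨fun e => f (v e), ⟨f, fun e => rfl⟩, funext hf⟩

/-- The functionals that vanish on all the vectors form the annihilator of their span, so this is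
rank–nullity. -/
theorem finrank_vecRep [FiniteDimensional F V] (v : E → V) :
    Module.finrank F (vecRep F v) = Module.finrank F (Submodule.span F (Set.range v)) := by
  have h1 := LinearMap.finrank_range_add_finrank_ker
    (LinearMap.pi fun e => Module.Dual.eval F V (v e) : Module.Dual F V →ₗ[F] E → F)
  have h2 : LinearMap.ker
      (LinearMap.pi fun e => Module.Dual.eval F V (v e) : Module.Dual F V →ₗ[F] E → F) =
      (Submodule.span F (Set.range v)).dualAnnihilator := by
    ext f
    rw [LinearMap.mem_ker, Submodule.mem_dualAnnihilator]
    constructor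
    · intro h w hw
      induction hw using Submodule.span_induction with
      | mem x hx =>
        obtain ⟨e, rfl⟩ := hx
        exact congrFun h e
      | zero => simp
      | add x y _ _ hx hy => rw [map_add, hx, hy, add_zero]
      | smul a x _ hx => rw [map_smul, hx, smul_zero]
    · intro h
      ext e
      exact h _ (Submodule.subset_span ⟨e, rfl⟩)
  have h3 := Subspace.finrank_add_finrank_dualAnnihilator_eq (Submodule.span F (Set.range v))
  rw [h2, Subspace.dual_finrank_eq] at h1
  unfold vecRep
  omega

theorem rk_vecRep [FiniteDimensional F V] (v : E → V) (X : Set E) :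
    (vecRep F v).rk X = Module.finrank F (Submodule.span F (v '' X)) := by
  rw [rk, restrict, vecRep_pullback, finrank_vecRep, Set.range_comp, Subtype.range_coe]

theorem mem_dual_iff [Fintype E] {M : RepMatroid F E} {x : E → F} :
    x ∈ M.dual ↔ ∀ y ∈ M, x ⬝ᵥ y = 0 := by
  have : x ∈ M.dual ↔ ∀ y ∈ M, ∑ᶠ e, x e * y e = 0 := Iff.rfl
  rw [this]
  simp only [finsum_eq_sum_of_fintype, dotProduct]

theorem dual_dual [Finite E] (M : RepMatroid F E) : M.dual.dual = M := by
  classical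
  cases nonempty_fintype E
  apply le_antisymm
  · intro x hx
    by_contra hxM
    obtain ⟨f, hfx, hf⟩ := Submodule.exists_dual_map_eq_bot_of_notMem hxM inferInstance
    have hrep : ∀ y : E → F, f y = (fun e => f (Pi.single e 1)) ⬝ᵥ y := by
      intro y
      conv_lhs => rw [← Finset.univ_sum_single y, map_sum]
      refine Finset.sum_congr rfl fun e _ => ?_
      rw [show Pi.single e (y e) = y e • (Pi.single e 1 : E → F) by
        rw [← Pi.single_smul, smul_eq_mul, mul_one], map_smul, smul_eq_mul, mul_comm]
    apply hfx
    rw [hrep, dotProduct_comm]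
    refine mem_dual_iff.1 hx _ (mem_dual_iff.2 fun y hy => ?_)
    rw [← hrep]
    have : f y ∈ Submodule.map f M := ⟨y, hy, rfl⟩
    rw [hf] at this
    exact this
  · intro x hx
    refine mem_dual_iff.2 fun y hy => ?_
    rw [dotProduct_comm]
    exact mem_dual_iff.1 hy x hx

/-- A vector is orthogonal to the restrictions of all members of `M.dual` exactly when its extension
by zero is orthogonal to `M.dual`, that is, lies in the double dual. -/
theorem mem_contract_iff [Finite E] {M : RepMatroid F E} {C : Set E} {x : (Cᶜ : Set E) → F} :
    x ∈ M.contract C ↔ ∃ y ∈ M, (∀ e ∈ C, y e = 0) ∧ ∀ e : (Cᶜ : Set E), y e = x e := by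
  classical
  cases nonempty_fintype E
  have key : ∀ (y z : E → F), (∀ e ∈ C, y e = 0) →
      z ⬝ᵥ y = (fun e : (Cᶜ : Set E) => z e) ⬝ᵥ (fun e : (Cᶜ : Set E) => y e) := by
    intro y z hy
    have h := Finset.sum_subtype_of_mem (p := (· ∈ Cᶜ)) (f := fun e => z e * y e)
      (s := Finset.univ.filter (· ∈ Cᶜ)) (by simp)
    simp only [dotProduct]
    rw [← Finset.sum_filter_add_sum_filter_not (Finset.univ : Finset E) (· ∈ Cᶜ)]
    rw [Finset.sum_eq_zero (s := Finset.univ.filter (¬ · ∈ Cᶜ)), add_zero]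
    · refine Finset.sum_subtype _ (by simp) _
    · intro e he
      simp at he
      simp [hy e he]
  constructor
  · intro hx
    let y : E → F := fun e => if h : e ∈ Cᶜ then x ⟨e, h⟩ else 0
    have hyC : ∀ e ∈ C, y e = 0 := fun e he => by simp [y, he]
    have hyx : ∀ e : (Cᶜ : Set E), y e = x e := fun e => by
      have := e.2
      simp only [y, this, dif_pos]
    refine ⟨y, ?_, hyC, hyx⟩
    rw [← dual_dual M]
    refine mem_dual_iff.2 fun z hz => ?_
    have hz' : (fun e : (Cᶜ : Set E) => z e) ∈ M.dual.delete C := ⟨z, hz, rfl⟩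
    rw [dotProduct_comm, key y z hyC, dotProduct_comm]
    have := mem_dual_iff.1 hx _ hz'
    rw [show (fun e : (Cᶜ : Set E) => y e) = x from funext hyx]
    exact this
  · rintro ⟨y, hyM, hyC, hyx⟩
    refine mem_dual_iff.2 ?_
    rintro _ ⟨z, hz, rfl⟩
    have := mem_dual_iff.1 hz y hyM
    rw [key y z hyC, dotProduct_comm] at this
    rw [show (fun e : (Cᶜ : Set E) => y e) = x from funext hyx] at this
    exact this

/-- A functional that vanishes on the vectors of `C` is a functional on the quotient by their span.
-/
theorem vecRep_contract [Finite E] (v : E → V) (C : Set E) :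
    (vecRep F v).contract C =
      vecRep F (fun e : (Cᶜ : Set E) => (Submodule.span F (v '' C)).mkQ (v e)) := by
  ext x
  rw [mem_contract_iff, mem_vecRep]
  constructor
  · rintro ⟨y, hy, hyC, hyx⟩
    obtain ⟨f, hf⟩ := mem_vecRep.1 hy
    have hle : Submodule.span F (v '' C) ≤ LinearMap.ker f := by
      rw [Submodule.span_le]
      rintro _ ⟨e, he, rfl⟩
      exact (hf e).trans (hyC e he)
    refine ⟨(Submodule.span F (v '' C)).liftQ f hle, fun e => ?_⟩
    rw [← hyx e, ← hf e]
    rfl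
  · rintro ⟨f, hf⟩
    refine ⟨fun e => f ((Submodule.span F (v '' C)).mkQ (v e)),
      mem_vecRep.2 ⟨f.comp (Submodule.mkQ _), fun e => rfl⟩, fun e he => ?_, hf⟩
    have : (Submodule.span F (v '' C)).mkQ (v e) = 0 := by
      rw [Submodule.mkQ_apply, Submodule.Quotient.mk_eq_zero]
      exact Submodule.subset_span ⟨e, he, rfl⟩
    simp only [this, map_zero]

theorem ofMatrix_eq_vecRep {ρ : Type*} [Fintype ρ] (A : Matrix ρ E F) :
    ofMatrix A = vecRep F A.col := by
  classical
  ext x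
  rw [ofMatrix, mem_vecRep]
  constructor
  · intro hx
    induction hx using Submodule.span_induction with
    | mem y hy =>
      obtain ⟨i, rfl⟩ := hy
      exact ⟨LinearMap.proj i, fun e => rfl⟩
    | zero => exact ⟨0, fun e => rfl⟩
    | add y z _ _ hy hz =>
      obtain ⟨f, hf⟩ := hy
      obtain ⟨g, hg⟩ := hz
      exact ⟨f + g, fun e => by simp [hf, hg]⟩
    | smul c y _ hy =>
      obtain ⟨f, hf⟩ := hy
      exact ⟨c • f, fun e => by simp [hf]⟩
  · rintro ⟨f, hf⟩
    have : x = ∑ i, f (Pi.single i 1) • A.row i := by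
      ext e
      rw [← hf e]
      conv_lhs => rw [← Finset.univ_sum_single (A.col e), map_sum]
      rw [Finset.sum_apply]
      refine Finset.sum_congr rfl fun i _ => ?_
      rw [show Pi.single i (A.col e i) = A.col e i • (Pi.single i 1 : ρ → F) by
        rw [← Pi.single_smul, smul_eq_mul, mul_one], map_smul]
      simp [mul_comm]
    rw [this]
    exact Submodule.sum_mem _ fun i _ => Submodule.smul_mem _ _ (Submodule.subset_span ⟨i, rfl⟩)

theorem projEquiv_vecRep (L : V ≃ₗ[F] V') (v : E → V) (w : E → V') (d : E → Fˣ)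
    (h : ∀ e, w e = (d e : F) • L (v e)) : (vecRep F v).ProjEquiv (vecRep F w) := by
  refine ⟨d, fun x => ?_⟩
  rw [mem_vecRep, mem_vecRep]
  constructor
  · rintro ⟨f, hf⟩
    refine ⟨f.comp L.symm.toLinearMap, fun e => ?_⟩
    simp [h, hf]
  · rintro ⟨f, hf⟩
    refine ⟨f.comp L.toLinearMap, fun e => ?_⟩
    have := hf e
    rw [h, map_smul, smul_eq_mul] at this
    exact mul_left_cancel₀ (d e).ne_zero this

/-- The vectors are not covered by two proper subspaces. -/
def RoundVec (F : Type*) [Field F] {V : Type*} [AddCommGroup V] [Module F V] {E : Type*}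
    (v : E → V) : Prop :=
  ∀ H₁ H₂ : Submodule F V, H₁ ≠ ⊤ → H₂ ≠ ⊤ → ∃ e, v e ∉ H₁ ∧ v e ∉ H₂

/-- A matroid hyperplane must be spanned by elements, which an arbitrary `H` need not be. Start from
the span of the elements in `H` and take a maximal proper subspace `Q` spanned by its own elements;
one further element then generates everything. -/
theorem exists_isHyperplane_of_ne_top [FiniteDimensional F V] {v : E → V}
    (hv : Submodule.span F (Set.range v) = ⊤) {H : Submodule F V} (hH : H ≠ ⊤) :
    ∃ X, (vecRep F v).IsHyperplane X ∧ v ⁻¹' H ⊆ X := by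
  have hwf : WellFounded ((· > ·) : Submodule F V → Submodule F V → Prop) := wellFounded_gt
  let T : Set (Submodule F V) := {Q | Q ≠ ⊤ ∧ v ⁻¹' H ⊆ v ⁻¹' Q ∧
    Q = Submodule.span F (v '' (v ⁻¹' Q))}
  have hT : Submodule.span F (v '' (v ⁻¹' H)) ∈ T := by
    have hle : Submodule.span F (v '' (v ⁻¹' H)) ≤ H := by
      rw [Submodule.span_le]; rintro _ ⟨e, he, rfl⟩; exact he
    have hsub : v ⁻¹' H ⊆ v ⁻¹' (Submodule.span F (v '' (v ⁻¹' H)) : Submodule F V) :=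
      fun e he => Submodule.subset_span ⟨e, he, rfl⟩
    refine ⟨fun h => hH (top_le_iff.1 (h ▸ hle)), hsub, ?_⟩
    apply le_antisymm
    · exact Submodule.span_mono (Set.image_mono hsub)
    · rw [Submodule.span_le]; rintro _ ⟨e, he, rfl⟩; exact he
  obtain ⟨Q, ⟨hQt, hHQ, hQ⟩, hQmax⟩ := hwf.has_min T ⟨_, hT⟩
  have hgen : ∀ e, v e ∉ Q → Q ⊔ Submodule.span F {v e} = ⊤ := by
    intro e he
    by_contra hne
    refine hQmax (Q ⊔ Submodule.span F {v e}) ⟨hne, ?_, ?_⟩ ?_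
    · exact hHQ.trans fun x hx => Submodule.mem_sup_left hx
    · apply le_antisymm
      · refine sup_le ?_ ?_
        · exact hQ.le.trans (Submodule.span_mono (Set.image_mono fun x hx =>
            Submodule.mem_sup_left hx))
        · rw [Submodule.span_singleton_le_iff_mem]
          exact Submodule.subset_span
            ⟨e, Submodule.mem_sup_right (Submodule.mem_span_singleton_self _), rfl⟩
      · rw [Submodule.span_le]; rintro _ ⟨x, hx, rfl⟩; exact hx
    · refine lt_of_le_of_ne le_sup_left fun heq => he ?_
      rw [heq]
      exact Submodule.mem_sup_right (Submodule.mem_span_singleton_self _)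
  have hrank : (vecRep F v).rank = Module.finrank F V := by
    rw [rank, rk_vecRep, Set.image_univ, hv, finrank_top]
  have hrk : (vecRep F v).rk (v ⁻¹' Q) = Module.finrank F Q := by
    rw [rk_vecRep, ← hQ]
  have hlt : Module.finrank F Q < Module.finrank F V := Submodule.finrank_lt hQt
  refine ⟨v ⁻¹' Q, ⟨fun e he => ?_, ?_⟩, hHQ⟩
  · have : (vecRep F v).rk (insert e (v ⁻¹' Q)) = Module.finrank F V := by
      rw [rk_vecRep, Set.image_insert_eq, Submodule.span_insert, ← hQ, sup_comm, hgen e he,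
        finrank_top]
    rw [hrk, this]
    exact hlt
  · rw [hrk, hrank]
    obtain ⟨e, he⟩ : ∃ e, v e ∉ Q := by
      by_contra! hall
      apply hQt
      rw [← top_le_iff, ← hv, Submodule.span_le]
      rintro _ ⟨e, rfl⟩
      exact hall e
    have h1 := Submodule.finrank_add_le_finrank_add_finrank Q (Submodule.span F {v e})
    rw [hgen e he, finrank_top] at h1
    have h2 := finrank_span_le_card (R := F) ({v e} : Set V)
    simp at h2
    omega

theorem roundVec_of_isRound [FiniteDimensional F V] {v : E → V}
    (hv : Submodule.span F (Set.range v) = ⊤) (h : (vecRep F v).IsRound) : RoundVec F v := by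
  intro H₁ H₂ h₁ h₂
  by_contra! hcon
  obtain ⟨X₁, hX₁, hs₁⟩ := exists_isHyperplane_of_ne_top hv h₁
  obtain ⟨X₂, hX₂, hs₂⟩ := exists_isHyperplane_of_ne_top hv h₂
  refine h X₁ X₂ hX₁ hX₂ (Set.eq_univ_of_forall fun e => ?_)
  by_cases he : v e ∈ H₁
  · exact Or.inl (hs₁ he)
  · exact Or.inr (hs₂ (hcon e he))

/-- Proper subspaces of a quotient pull back to proper subspaces. Hence roundness survives
contraction, which the induction needs. -/
theorem RoundVec.mkQ {v : E → V} (h : RoundVec F v) (Z : Submodule F V) :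
    RoundVec F (Z.mkQ ∘ v) := by
  intro H₁ H₂ h₁ h₂
  have hc : ∀ H : Submodule F (V ⧸ Z), H ≠ ⊤ → H.comap Z.mkQ ≠ ⊤ := by
    intro H hH hc
    apply hH
    rw [← Submodule.map_comap_eq_of_surjective Z.mkQ_surjective H, hc, Submodule.map_top,
      Submodule.range_mkQ]
  exact h _ _ (hc _ h₁) (hc _ h₂)

end VecRep

end RepMatroid

/-! ### `K`-forms in vector spaces over a quadratic extension -/

section QuadraticForms

variable {K : Type*} [Field K] {F : Type*} [Field F] [Algebra K F]
  {V : Type*} [AddCommGroup V] [Module K V] [Module F V] [IsScalarTower K F V]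

/-- `1, ω` is a `K`-basis of `F`. -/
def IsQuadGen (K : Type*) [Field K] {F : Type*} [Field F] [Algebra K F] (ω : F) : Prop :=
  ω ∉ Set.range (algebraMap K F) ∧
    ∀ f : F, ∃ s t : K, f = algebraMap K F s + ω * algebraMap K F t

theorem IsQuadGen.eq_zero {ω : F} (h : IsQuadGen K ω) {s t : K}
    (hst : algebraMap K F s + ω * algebraMap K F t = 0) : s = 0 ∧ t = 0 := by
  have ht : t = 0 := by
    by_contra ht
    have ht' : algebraMap K F t ≠ 0 := by simpa using ht
    refine h.1 ⟨-s / t, ?_⟩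
    rw [map_div₀, map_neg, div_eq_iff ht']
    linear_combination -hst
  subst ht
  simpa using hst

theorem isQuadGen_of_card {q : ℕ} (hq : IsPrimePow q) (hK : Nat.card K = q)
    (hF : Nat.card F = q ^ 2) {ω : F} (hω : ω ∉ Set.range (algebraMap K F)) : IsQuadGen K ω := by
  have hq0 := hq.pos
  have : Finite K := Nat.finite_of_card_ne_zero (by omega)
  have : Finite F := Nat.finite_of_card_ne_zero (by rw [hF]; positivity)
  cases nonempty_fintype K
  cases nonempty_fintype F
  have hfr : Module.finrank K F = 2 := by
    have h := Module.card_eq_pow_finrank (K := K) (V := F)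
    rw [← Nat.card_eq_fintype_card, ← Nat.card_eq_fintype_card, hK, hF] at h
    exact (Nat.pow_right_injective hq.one_lt h).symm
  have hli : LinearIndependent K ![(1 : F), ω] := by
    rw [LinearIndependent.pair_iff' one_ne_zero]
    intro a ha
    exact hω ⟨a, by rw [← ha, Algebra.smul_def, mul_one]⟩
  have hsp := hli.span_eq_top_of_card_eq_finrank (by simp [hfr])
  refine ⟨hω, fun f => ?_⟩
  have hf : f ∈ Submodule.span K (Set.range ![(1 : F), ω]) := hsp ▸ Submodule.mem_top
  rw [Matrix.range_cons, Matrix.range_cons, Matrix.range_empty, Set.union_empty,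
    Set.singleton_union, Submodule.mem_span_pair] at hf
  obtain ⟨s, t, rfl⟩ := hf
  exact ⟨s, t, by rw [Algebra.smul_def, Algebra.smul_def, mul_one, mul_comm ω]⟩

theorem IsQuadGen.exists_smul_eq {ω : F} (h : IsQuadGen K ω) (V : Type*) [AddCommGroup V]
    [Module K V] [Module F V] [IsScalarTower K F V] (f : F) :
    ∃ s t : K, (∀ x : V, f • x = s • x + ω • t • x) ∧
      f = algebraMap K F s + ω * algebraMap K F t := by
  obtain ⟨s, t, hf⟩ := h.2 f
  refine ⟨s, t, fun x => ?_, hf⟩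
  rw [hf, add_smul, mul_smul, algebraMap_smul, algebraMap_smul]

theorem smul_comm_tower (f : F) (s : K) (x : V) : f • s • x = s • f • x := by
  rw [← algebraMap_smul F s x, ← algebraMap_smul F s (f • x), smul_smul, smul_smul, mul_comm]

theorem IsQuadGen.exists_of_mem_span {ω : F} (h : IsQuadGen K ω) {S : Set V} {x : V}
    (hx : x ∈ Submodule.span F S) :
    ∃ a ∈ Submodule.span K S, ∃ b ∈ Submodule.span K S, x = a + ω • b := by
  induction hx using Submodule.span_induction with
  | mem x hx => exact ⟨x, Submodule.subset_span hx, 0, zero_mem _, by simp⟩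
  | zero => exact ⟨0, zero_mem _, 0, zero_mem _, by simp⟩
  | add x y _ _ hx hy =>
    obtain ⟨a, ha, b, hb, rfl⟩ := hx
    obtain ⟨a', ha', b', hb', rfl⟩ := hy
    exact ⟨a + a', add_mem ha ha', b + b', add_mem hb hb', by rw [smul_add]; abel⟩
  | smul f x _ hx =>
    obtain ⟨a, ha, b, hb, rfl⟩ := hx
    obtain ⟨s, t, hst, -⟩ := h.exists_smul_eq V f
    obtain ⟨s', t', hst', -⟩ := h.exists_smul_eq V (f * ω)
    refine ⟨s • a + s' • b, add_mem (Submodule.smul_mem _ _ ha) (Submodule.smul_mem _ _ hb),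
      t • a + t' • b, add_mem (Submodule.smul_mem _ _ ha) (Submodule.smul_mem _ _ hb), ?_⟩
    rw [smul_add, hst, smul_smul, hst', smul_add]
    abel

/-- Every vector is `a + ω b` with `a`, `b` in `Γ`. -/
def Spans (ω : F) (Γ : Submodule K V) : Prop := ∀ x : V, ∃ a ∈ Γ, ∃ b ∈ Γ, x = a + ω • b

/-- The image of `Γ` modulo `Y` has `K`-independent vectors that are `F`-independent. -/
def KForm (ω : F) (Γ : Submodule K V) (Y : Submodule F V) : Prop :=
  ∀ a ∈ Γ, ∀ b ∈ Γ, a + ω • b ∈ Y → a ∈ Y ∧ b ∈ Y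

/-- `x` is an `F`-multiple of a vector of `Γ`. -/
def InForm (F : Type*) [Field F] {K : Type*} [Field K] {V : Type*} [AddCommGroup V] [Module K V]
    [Module F V] (Γ : Submodule K V) (x : V) : Prop :=
  ∃ f : F, f ≠ 0 ∧ f • x ∈ Γ

theorem spans_of_span_eq_top {ω : F} (h : IsQuadGen K ω) {Γ : Submodule K V}
    (hs : Submodule.span F (Γ : Set V) = ⊤) : Spans ω Γ := by
  intro x
  have hx : x ∈ Submodule.span F (Γ : Set V) := hs ▸ Submodule.mem_top
  simpa using h.exists_of_mem_span hx

theorem Spans.span_eq_top {ω : F} {Γ : Submodule K V} (hs : Spans ω Γ) :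
    Submodule.span F (Γ : Set V) = ⊤ := by
  rw [eq_top_iff]
  intro x _
  obtain ⟨a, ha, b, hb, rfl⟩ := hs x
  exact add_mem (Submodule.subset_span ha) (Submodule.smul_mem _ _ (Submodule.subset_span hb))

theorem Spans.mono {ω : F} {Γ Γ' : Submodule K V} (hs : Spans ω Γ) (hle : Γ ≤ Γ') :
    Spans ω Γ' := fun x =>
  let ⟨a, ha, b, hb, h⟩ := hs x
  ⟨a, hle ha, b, hle hb, h⟩

theorem KForm.mono {ω : F} {Γ Γ' : Submodule K V} {Y : Submodule F V} (h : KForm ω Γ Y)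
    (hle : Γ' ≤ Γ) : KForm ω Γ' Y := fun a ha b hb => h a (hle ha) b (hle hb)

/-- The part in `span F S` is itself `a' + ω b'` with `a'`, `b'` in `Γ`; subtract it and use the
hypothesis on the differences. -/
theorem KForm.sup_span {ω : F} (hω : IsQuadGen K ω) {Γ : Submodule K V} {P : Submodule F V}
    (h : KForm ω Γ P) {S : Set V} (hS : S ⊆ Γ) : KForm ω Γ (P ⊔ Submodule.span F S) := by
  intro a ha b hb hab
  obtain ⟨p, hp, x, hx, hpx⟩ := Submodule.mem_sup.1 hab
  obtain ⟨a', ha', b', hb', rfl⟩ := hω.exists_of_mem_span hx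
  have hle : Submodule.span K S ≤ Γ := Submodule.span_le.2 hS
  have hF : ∀ y, y ∈ Submodule.span K S → y ∈ Submodule.span F S := fun y hy =>
    Submodule.span_le_restrictScalars K F S hy
  have hk := h (a - a') (sub_mem ha (hle ha')) (b - b') (sub_mem hb (hle hb')) (by
    have : a - a' + ω • (b - b') = p := by
      rw [smul_sub, ← sub_eq_zero]
      rw [← sub_eq_zero] at hpx
      rw [← neg_eq_zero, ← hpx]
      abel
    rwa [this])
  refine ⟨?_, ?_⟩
  · rw [← sub_add_cancel a a']
    exact Submodule.add_mem_sup hk.1 (hF _ ha')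
  · rw [← sub_add_cancel b b']
    exact Submodule.add_mem_sup hk.2 (hF _ hb')

/-- Write `f = s + ωt`. The ω-component of `f • x - y` is `t • x`, which lies in `Y` only if `t =
0`. -/
theorem KForm.exists_algebraMap_eq {ω : F} (hω : IsQuadGen K ω) {Γ : Submodule K V}
    {Y : Submodule F V} (h : KForm ω Γ Y) {x y : V} (hx : x ∈ Γ) (hxY : x ∉ Y) (hy : y ∈ Γ) {f : F}
    (hf : f • x - y ∈ Y) : ∃ s : K, f = algebraMap K F s := by
  obtain ⟨s, t, hst, hfst⟩ := hω.exists_smul_eq V f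
  have := h (s • x - y) (sub_mem (Γ.smul_mem _ hx) hy) (t • x) (Γ.smul_mem _ hx) (by
    rw [hst] at hf
    convert hf using 1
    abel)
  have ht : t = 0 := by
    by_contra ht
    apply hxY
    have h2 := Y.smul_mem (algebraMap K F t⁻¹) this.2
    rwa [algebraMap_smul, inv_smul_smul₀ ht] at h2
  exact ⟨s, by rw [hfst, ht]; simp⟩

theorem Spans.map_mkQ {ω : F} {Γ : Submodule K V} (h : Spans ω Γ) (Z : Submodule F V) :
    Spans ω (Γ.map (Z.mkQ.restrictScalars K)) := by
  intro x
  obtain ⟨x, rfl⟩ := Z.mkQ_surjective x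
  obtain ⟨a, ha, b, hb, rfl⟩ := h x
  exact ⟨_, ⟨a, ha, rfl⟩, _, ⟨b, hb, rfl⟩, by simp⟩

theorem mkQ_mem_map_iff {Z Y : Submodule F V} (hZ : Z ≤ Y) {x : V} :
    Z.mkQ x ∈ Y.map Z.mkQ ↔ x ∈ Y := by
  rw [← Submodule.mem_comap, Submodule.comap_map_mkQ, sup_eq_right.2 hZ]

theorem KForm.map_mkQ {ω : F} {Γ : Submodule K V} {Y Z : Submodule F V} (h : KForm ω Γ Y)
    (hZ : Z ≤ Y) : KForm ω (Γ.map (Z.mkQ.restrictScalars K)) (Y.map Z.mkQ) := by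
  rintro _ ⟨a, ha, rfl⟩ _ ⟨b, hb, rfl⟩ hab
  have : a + ω • b ∈ Y := (mkQ_mem_map_iff hZ).1 (by simpa using hab)
  obtain ⟨h1, h2⟩ := h a ha b hb this
  exact ⟨⟨a, h1, rfl⟩, ⟨b, h2, rfl⟩⟩

/-- An `F`-relation splits into two `K`-relations, one for each component of the coefficients. -/
theorem KForm.linearIndependent {ω : F} (hω : IsQuadGen K ω) {Γ : Submodule K V}
    (h : KForm ω Γ ⊥) {ι : Type*} {b : ι → V} (hb : ∀ i, b i ∈ Γ) (hli : LinearIndependent K b) :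
    LinearIndependent F b := by
  rw [linearIndependent_iff'] at hli ⊢
  intro s g hg
  choose c d hcd hgcd using fun i => hω.exists_smul_eq V (g i)
  have hsum : ∑ i ∈ s, c i • b i + ω • ∑ i ∈ s, d i • b i = 0 := by
    rw [Finset.smul_sum, ← Finset.sum_add_distrib, ← hg]
    exact Finset.sum_congr rfl fun i _ => (hcd i (b i)).symm
  have := h _ (Γ.sum_mem fun i _ => Γ.smul_mem (c i) (hb i)) _
    (Γ.sum_mem fun i _ => Γ.smul_mem (d i) (hb i)) (by rw [hsum]; exact zero_mem _)
  intro i hi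
  rw [hgcd i, hli s c this.1 i hi, hli s d this.2 i hi]
  simp

theorem Spans.span_range_eq_top {ω : F} {Γ : Submodule K V} (h : Spans ω Γ) {ι : Type*}
    {b : ι → V} (hb : Γ ≤ Submodule.span K (Set.range b)) :
    Submodule.span F (Set.range b) = ⊤ := by
  rw [eq_top_iff, ← h.span_eq_top, Submodule.span_le]
  exact fun x hx => Submodule.span_le_restrictScalars K F _ (hb hx)

theorem span_range_basis_coe {ι : Type*} {Γ : Submodule K V} (b : Module.Basis ι K Γ) :
    Submodule.span K (Set.range fun i => (b i : V)) = Γ := by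
  have : (Set.range fun i => (b i : V)) = Γ.subtype '' Set.range b := by
    rw [← Set.range_comp]; rfl
  rw [this, Submodule.span_image, b.span_eq, Submodule.map_top, Submodule.range_subtype]

/-- A `K`-basis of a `K`-form is an `F`-basis. -/
noncomputable def formBasis {ω : F} (hω : IsQuadGen K ω) {Γ : Submodule K V} (hs : Spans ω Γ)
    (hf : KForm ω Γ ⊥) {ι : Type*} (b : Module.Basis ι K Γ) : Module.Basis ι F V :=
  Module.Basis.mk (v := fun i => (b i : V))
    (hf.linearIndependent hω (fun i => (b i).2)
      (b.linearIndependent.map' Γ.subtype (Submodule.ker_subtype _)))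
    (hs.span_range_eq_top (span_range_basis_coe b).ge).ge

@[simp]
theorem formBasis_apply {ω : F} (hω : IsQuadGen K ω) {Γ : Submodule K V} (hs : Spans ω Γ)
    (hf : KForm ω Γ ⊥) {ι : Type*} (b : Module.Basis ι K Γ) (i : ι) :
    formBasis hω hs hf b i = b i := by simp [formBasis]

theorem Spans.finrank_le [Finite V] {ω : F} {Γ : Submodule K V} (h : Spans ω Γ) :
    Module.finrank F V ≤ Module.finrank K Γ := by
  have : Module.Finite K V := inferInstance
  let b := Module.finBasis K Γ
  have := finrank_range_le_card (R := F) (fun i => (b i : V))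
  rw [Set.finrank, h.span_range_eq_top (span_range_basis_coe b).ge, finrank_top] at this
  simpa using this

theorem IsQuadGen.finrank_eq {ω : F} (hω : IsQuadGen K ω) : Module.finrank K F = 2 := by
  have hli : LinearIndependent K ![(1 : F), ω] := by
    rw [LinearIndependent.pair_iff' one_ne_zero]
    intro a ha
    exact hω.1 ⟨a, by rw [← ha, Algebra.smul_def, mul_one]⟩
  have hsp : ⊤ ≤ Submodule.span K (Set.range ![(1 : F), ω]) := by
    intro f _
    obtain ⟨s, t, rfl⟩ := hω.2 f
    rw [Matrix.range_cons, Matrix.range_cons, Matrix.range_empty, Set.union_empty,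
      Set.singleton_union, Submodule.mem_span_pair]
    exact ⟨s, t, by rw [Algebra.smul_def, Algebra.smul_def, mul_one, mul_comm ω]⟩
  simpa using Module.finrank_eq_card_basis (Module.Basis.mk hli hsp)

/-- The image of `Γ` modulo `P` has `K`-dimension at most that of the quotient over `F`, and the
kernel lies in `P`, whose `K`-dimension is twice its `F`-dimension. The excess over dim `V` bounds
how often a form can be shrunk. -/
theorem KForm.finrank_le [Finite V] {ω : F} (hω : IsQuadGen K ω) {Γ : Submodule K V}
    {P : Submodule F V} (h : KForm ω Γ P) :
    Module.finrank K Γ ≤ Module.finrank F V + Module.finrank F P := by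
  let g : Γ →ₗ[K] V ⧸ P := (P.mkQ.restrictScalars K).comp Γ.subtype
  have h1 := LinearMap.finrank_range_add_finrank_ker g
  have hr : LinearMap.range g = Γ.map (P.mkQ.restrictScalars K) := by
    rw [LinearMap.range_comp, Submodule.range_subtype]
  have h2 : Module.finrank K (LinearMap.range g) ≤ Module.finrank F (V ⧸ P) := by
    rw [hr]
    have hk := h.map_mkQ le_rfl
    rw [Submodule.mkQ_map_self] at hk
    let b := Module.finBasis K (Γ.map (P.mkQ.restrictScalars K))
    have hli := hk.linearIndependent hω (b := fun i => (b i : V ⧸ P)) (fun i => (b i).2)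
      (b.linearIndependent.map' (Submodule.subtype _) (Submodule.ker_subtype _))
    simpa using hli.fintype_card_le_finrank
  have h3 : Module.finrank K (LinearMap.ker g) ≤ Module.finrank K P := by
    let j : LinearMap.ker g →ₗ[K] (P.restrictScalars K) :=
      LinearMap.codRestrict _ (Γ.subtype.comp (LinearMap.ker g).subtype) (by
        intro x
        have hx : P.mkQ x.1.1 = 0 := x.2
        rwa [Submodule.mkQ_apply, Submodule.Quotient.mk_eq_zero] at hx)
    have hj : Function.Injective j := by
      intro x y hxy
      have hv : (j x : V) = j y := by rw [hxy]
      exact Subtype.ext (Subtype.ext hv)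
    exact LinearMap.finrank_le_finrank_of_injective hj
  have h4 : Module.finrank K P = 2 * Module.finrank F P := by
    rw [← Module.finrank_mul_finrank K F P, hω.finrank_eq]
  have h5 := P.finrank_quotient_add_finrank
  omega

end QuadraticForms

/-! ### Extending maps that are additive on independent pairs -/

section AdditiveExtension

variable {K : Type*} [Field K] {A : Type*} [AddCommGroup A] [Module K A]
  {A' : Type*} [AddCommGroup A']

/-- `a` and `b` are independent modulo `y`. -/
def Ind2 (y : Submodule K A) (a b : A) : Prop := ∀ s t : K, s • a + t • b ∈ y → s = 0 ∧ t = 0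

theorem Ind2.symm {y : Submodule K A} {a b : A} (h : Ind2 y a b) : Ind2 y b a := fun s t hst =>
  (h t s (by rwa [add_comm])).symm

theorem Ind2.left_notMem {y : Submodule K A} {a b : A} (h : Ind2 y a b) : a ∉ y := fun ha =>
  one_ne_zero (h 1 0 (by simpa using ha)).1

theorem Ind2.add_notMem {y : Submodule K A} {a b : A} (h : Ind2 y a b) : a + b ∉ y := fun ha =>
  one_ne_zero (h 1 1 (by simpa using ha)).1

theorem Ind2.congr {y : Submodule K A} {a b a' b' : A} (h : Ind2 y a b) (ha : a' - a ∈ y)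
    (hb : b' - b ∈ y) : Ind2 y a' b' := by
  intro s t hst
  refine h s t ?_
  have := sub_mem hst (add_mem (y.smul_mem s ha) (y.smul_mem t hb))
  convert this using 1
  rw [smul_sub, smul_sub]
  abel

theorem Ind2.smul {y : Submodule K A} {a b : A} (h : Ind2 y a b) {c : K} (hc : c ≠ 0) :
    Ind2 y (c • a) (c • b) := by
  intro s t hst
  rw [smul_smul, smul_smul] at hst
  obtain ⟨h1, h2⟩ := h _ _ hst
  exact ⟨(mul_eq_zero.1 h1).resolve_right hc, (mul_eq_zero.1 h2).resolve_right hc⟩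

theorem ind2_of_notMem {y : Submodule K A} {a b : A} (ha : a ∉ y)
    (hb : b ∉ y ⊔ Submodule.span K {a}) : Ind2 y a b := by
  intro s t hst
  have ht : t = 0 := by
    by_contra ht
    apply hb
    have h1 : b = t⁻¹ • (s • a + t • b) + (-(t⁻¹ * s)) • a := by
      rw [smul_add, smul_smul, inv_smul_smul₀ ht, neg_smul]
      abel
    rw [h1]
    exact Submodule.add_mem_sup (y.smul_mem _ hst)
      (Submodule.smul_mem _ _ (Submodule.mem_span_singleton_self a))
  refine ⟨?_, ht⟩
  by_contra hs
  apply ha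
  rw [ht, zero_smul, add_zero] at hst
  simpa [smul_smul, hs] using y.smul_mem s⁻¹ hst

theorem Ind2.add_left {y : Submodule K A} {a b c : A} (h : Ind2 y a c) (hab : ¬ Ind2 y a b)
    (hb : b ∉ y) : Ind2 y (a + c) b := by
  intro s t hst
  obtain ⟨s', t', hst', hne⟩ : ∃ s' t' : K, s' • a + t' • b ∈ y ∧ ¬ (s' = 0 ∧ t' = 0) := by
    unfold Ind2 at hab
    push Not at hab
    obtain ⟨s', t', h1, h2⟩ := hab
    exact ⟨s', t', h1, fun h3 => h2 h3.1 h3.2⟩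
  have ht' : t' ≠ 0 := by
    rintro rfl
    have hs' : s' ≠ 0 := fun h0 => hne ⟨h0, rfl⟩
    refine h.left_notMem ?_
    rw [zero_smul, add_zero] at hst'
    simpa [smul_smul, hs'] using y.smul_mem s'⁻¹ hst'
  have h3 := h (s * t' - t * s') (s * t') (by
    have := sub_mem (y.smul_mem t' hst) (y.smul_mem t hst')
    convert this using 1
    module)
  have hs : s = 0 := by
    rcases mul_eq_zero.1 h3.2 with h4 | h4
    · exact h4
    · exact absurd h4 ht'
  refine ⟨hs, ?_⟩
  by_contra ht
  apply hb
  rw [hs, zero_smul, zero_add] at hst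
  simpa [smul_smul, ht] using y.smul_mem t⁻¹ hst

/-- A map that is additive on pairs that are independent modulo `y` agrees outside `y` with an
additive map. -/
theorem exists_addMonoidHom_eq_of_additive_off (y : Submodule K A)
    (hy : ∀ a, a ∉ y → ∃ b, Ind2 y a b) (f : A → A')
    (hf : ∀ a b, Ind2 y a b → f (a + b) = f a + f b) :
    ∃ g : A →+ A', ∀ a, a ∉ y → g a = f a := by
  classical
  by_cases hne : ∃ c, c ∉ y
  swap
  · push Not at hne
    exact ⟨0, fun a ha => absurd (hne a) ha⟩
  obtain ⟨c, hc⟩ := hne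
  -- The increment along `v` does not depend on the base point: expand `f (b + b' + v)` in two ways.
  have key1 : ∀ b b' v, Ind2 y b b' → v ∈ y → f (b + v) - f b = f (b' + v) - f b' := by
    intro b b' v hbb hv
    have h1 : Ind2 y (b + v) b' := hbb.congr (by simpa using hv) (by simp)
    have h2 : Ind2 y b (b' + v) := hbb.congr (by simp) (by simpa using hv)
    have e1 := hf _ _ h1
    have e2 := hf _ _ h2
    rw [show b + (b' + v) = b + v + b' by abel, e1] at e2
    rw [sub_eq_sub_iff_add_eq_add, e2, add_comm]
  have key : ∀ b b' v, b ∉ y → b' ∉ y → v ∈ y → f (b + v) - f b = f (b' + v) - f b' := by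
    intro b b' v hb hb' hv
    by_cases hbb : Ind2 y b b'
    · exact key1 b b' v hbb hv
    -- For dependent `b` and `b'`, pass through `b + d`, which is independent of both.
    · obtain ⟨d, hd⟩ := hy b hb
      have h3 : Ind2 y (b + d) b' := hd.add_left hbb hb'
      have h4 : Ind2 y (b + d) b := by
        intro s t hst
        have := hd (s + t) s (by convert hst using 1; module)
        refine ⟨this.2, ?_⟩
        simpa [this.2] using this.1
      rw [← key1 _ _ v h4 hv, key1 _ _ v h3 hv]
  -- On `y` the values of `f` are arbitrary and are replaced by increments at a fixed base point
  -- outside `y`.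
  let g : A → A' := fun a => if a ∈ y then f (c + a) - f c else f a
  have hg1 : ∀ a, a ∉ y → g a = f a := fun a ha => if_neg ha
  have hg2 : ∀ a ∈ y, ∀ b, b ∉ y → g a = f (b + a) - f b := fun a ha b hb => by
    rw [show g a = f (c + a) - f c from if_pos ha]
    exact key _ _ _ hc hb ha
  have hyn : ∀ a ∈ y, ∀ b, b ∉ y → b + a ∉ y := fun a ha b hb h =>
    hb (by simpa using sub_mem h ha)
  have hadd : ∀ a b, g (a + b) = g a + g b := by
    intro a b
    by_cases ha : a ∈ y
    · by_cases hb : b ∈ y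
      · rw [hg2 (a + b) (add_mem ha hb) c hc, hg2 a ha (c + b) (hyn b hb c hc), hg2 b hb c hc,
          show c + b + a = c + (a + b) by abel]
        abel
      · have hab : a + b ∉ y := by rw [add_comm]; exact hyn a ha b hb
        rw [hg1 _ hab, hg2 a ha b hb, hg1 b hb, add_comm a b]
        abel
    · by_cases hb : b ∈ y
      · rw [hg1 _ (hyn b hb a ha), hg2 b hb a ha, hg1 a ha]
        abel
      · rw [hg1 a ha, hg1 b hb]
        by_cases hab : Ind2 y a b
        · rw [hg1 _ hab.add_notMem, hf _ _ hab]
        -- For dependent `a` and `b`, bring in `d` independent of `a` and compare two expansions of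
        -- `f (a + b + d)`.
        · obtain ⟨d, hd⟩ := hy a ha
          have h3 := hf _ _ (hd.add_left hab hb)
          rw [hf _ _ hd] at h3
          by_cases habm : a + b ∈ y
          · rw [hg2 _ habm d hd.symm.left_notMem, show d + (a + b) = a + d + b by abel, h3]
            abel
          · rw [hg1 _ habm]
            have h4 : Ind2 y (a + b) d := by
              intro s t hst
              have hexp : ∃ r : K, a + b - r • a ∈ y := by
                unfold Ind2 at hab
                push Not at hab
                obtain ⟨s', t', h8, h9⟩ := hab
                have ht' : t' ≠ 0 := by
                  rintro rfl
                  by_cases hs' : s' = 0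
                  · exact h9 hs' rfl
                  · apply ha
                    rw [zero_smul, add_zero] at h8
                    simpa [smul_smul, hs'] using y.smul_mem s'⁻¹ h8
                refine ⟨1 - t'⁻¹ * s', ?_⟩
                have := y.smul_mem t'⁻¹ h8
                rw [smul_add, inv_smul_smul₀ ht', smul_smul] at this
                convert this using 1
                module
              obtain ⟨r, hr⟩ := hexp
              have h10 := hd (s * r) t (by
                have := sub_mem hst (y.smul_mem s hr)
                convert this using 1
                module)
              refine ⟨?_, h10.2⟩
              rcases mul_eq_zero.1 h10.1 with h11 | h11
              · exact h11
              · rw [h11, zero_smul, sub_zero] at hr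
                exact absurd hr habm
            have h5 := hf _ _ h4
            rw [show a + b + d = a + d + b by abel, h3] at h5
            have h6 : f (a + b) = f a + f d + f b - f d := by rw [h5]; abel
            rw [h6]; abel
  exact ⟨AddMonoidHom.mk' g hadd, hg1⟩

end AdditiveExtension

/-! ### Filling a small subspace by contracting abundant vectors -/

section Fill

variable {K : Type*} [Field K] {A : Type*} [AddCommGroup A] [Module K A]

/-- A set of vectors that covers all directions modulo `T`, and that still spans after the removal
of any `k`-dimensional extension of `T`. -/
structure IsAbundant (T : Submodule K A) (N : Set A) (k : ℕ) : Prop where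
  smul_mem : ∀ x ∈ N, ∀ c : K, c ≠ 0 → c • x ∈ N
  full : ∀ a, a ∉ T → ∃ x ∈ N, x - a ∈ T
  span_eq : ∀ B : Finset A, B.card ≤ k →
    Submodule.span K {x | x ∈ N ∧ x ∉ T ⊔ Submodule.span K (B : Set A)} = ⊤
  large : ∀ B : Finset A, B.card ≤ k + 1 → ∃ a, a ∉ T ⊔ Submodule.span K (B : Set A)

/-- Failures of additivity in planes that are independent of `y`. -/
def gadgets (T : Submodule K A) (N : Set A) (y : Submodule K A) : Set A :=
  {g | g ∈ T ∧ ∃ d₁ ∈ N, ∃ d₂ ∈ N, ∃ d₃ ∈ N, Ind2 y d₁ d₂ ∧ g = d₁ + d₂ - d₃}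

variable {T : Submodule K A} {N : Set A} {k : ℕ}

theorem IsAbundant.smul_gadget (h : IsAbundant T N k) {y : Submodule K A} {g : A}
    (hg : g ∈ gadgets T N y) {c : K} (hc : c ≠ 0) : c • g ∈ gadgets T N y := by
  obtain ⟨hgT, d₁, h₁, d₂, h₂, d₃, h₃, hind, rfl⟩ := hg
  exact ⟨T.smul_mem c hgT, c • d₁, h.smul_mem _ h₁ c hc, c • d₂, h.smul_mem _ h₂ c hc, c • d₃,
    h.smul_mem _ h₃ c hc, hind.smul hc, by rw [smul_sub, smul_add]⟩

/-- Let `n a` be a vector of `N` congruent to `a` modulo `T`. Modulo the span `G` of the gadgets,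
`n` is additive off `y`, so it extends to an additive map `g`. This map is the quotient map on the
vectors of `N` off `y`, hence everywhere, as these span. But `n` is constant on cosets of `T` modulo
`G`, so `g` kills `T`, and therefore `T ≤ G`. -/
theorem IsAbundant.le_span_gadgets (h : IsAbundant T N k) {B : Finset A} (hB : B.card ≤ k) :
    T ≤ Submodule.span K (gadgets T N (T ⊔ Submodule.span K (B : Set A))) := by
  classical
  set y := T ⊔ Submodule.span K (B : Set A) with hy
  set G := Submodule.span K (gadgets T N y) with hG
  have hTy : T ≤ y := le_sup_left
  have hex : ∀ a, a ∉ y → ∃ b, Ind2 y a b := by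
    intro a ha
    obtain ⟨b, hb⟩ := h.large (insert a B) ((Finset.card_insert_le _ _).trans (by omega))
    refine ⟨b, ind2_of_notMem ha ?_⟩
    rwa [Finset.coe_insert, Submodule.span_insert, sup_comm (Submodule.span K {a}), ← sup_assoc]
      at hb
  choose! n hnN hnT using h.full
  have hlift : ∀ a, a ∉ y → n a ∈ N ∧ n a - a ∈ T := fun a ha =>
    ⟨hnN a fun h' => ha (hTy h'), hnT a fun h' => ha (hTy h')⟩
  have hgad : ∀ d₁ ∈ N, ∀ d₂ ∈ N, ∀ d₃ ∈ N, Ind2 y d₁ d₂ → d₁ + d₂ - d₃ ∈ T →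
      d₁ + d₂ - d₃ ∈ G := fun d₁ h₁ d₂ h₂ d₃ h₃ hi ht =>
    Submodule.subset_span ⟨ht, d₁, h₁, d₂, h₂, d₃, h₃, hi, rfl⟩
  -- The lift is unique modulo `G`: two gadgets that share `n b` and `n (a + b)` differ by `n a -
  -- x`.
  have huniq : ∀ x ∈ N, ∀ a, a ∉ y → x - a ∈ T → n a - x ∈ G := by
    intro x hxN a ha hxa
    obtain ⟨b, hb⟩ := hex a ha
    obtain ⟨h1, h2⟩ := hlift a ha
    obtain ⟨h3, h4⟩ := hlift b hb.symm.left_notMem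
    obtain ⟨h5, h6⟩ := hlift (a + b) hb.add_notMem
    have e1 := hgad x hxN (n b) h3 (n (a + b)) h5 (hb.congr (hTy hxa) (hTy h4)) (by
      have := sub_mem (add_mem hxa h4) h6
      convert this using 1
      abel)
    have e2 := hgad (n a) h1 (n b) h3 (n (a + b)) h5 (hb.congr (hTy h2) (hTy h4)) (by
      have := sub_mem (add_mem h2 h4) h6
      convert this using 1
      abel)
    have := sub_mem e2 e1
    convert this using 1
    abel
  obtain ⟨g, hg⟩ := exists_addMonoidHom_eq_of_additive_off y hex (fun a => G.mkQ (n a)) (by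
    intro a b hab
    obtain ⟨h1, h2⟩ := hlift a hab.left_notMem
    obtain ⟨h3, h4⟩ := hlift b hab.symm.left_notMem
    obtain ⟨h5, h6⟩ := hlift (a + b) hab.add_notMem
    have e1 := hgad _ h1 _ h3 _ h5 (hab.congr (hTy h2) (hTy h4)) (by
      have := sub_mem (add_mem h2 h4) h6
      convert this using 1
      abel)
    rw [← map_add, eq_comm, ← sub_eq_zero, ← map_sub, Submodule.mkQ_apply,
      Submodule.Quotient.mk_eq_zero]
    exact e1)
  -- `g` is only additive, so the scalar is carried through the span induction.
  have hgN : ∀ x : A, ∀ c : K, g (c • x) = G.mkQ (c • x) := by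
    intro x
    have hx : x ∈ Submodule.span K {x | x ∈ N ∧ x ∉ y} := by
      rw [h.span_eq B hB]; exact Submodule.mem_top
    induction hx using Submodule.span_induction with
    | mem x hx =>
      intro c
      by_cases hc : c = 0
      · simp [hc]
      · have hcy : c • x ∉ y := fun h' => hx.2 (by
          simpa [smul_smul, hc] using y.smul_mem c⁻¹ h')
        rw [hg _ hcy, ← sub_eq_zero, ← map_sub, Submodule.mkQ_apply,
          Submodule.Quotient.mk_eq_zero]
        exact huniq _ (h.smul_mem x hx.1 c hc) _ hcy (by simp)
    | zero => simp
    | add x x' _ _ hx hx' =>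
      intro c
      rw [smul_add, map_add, hx, hx', map_add]
    | smul a x _ hx =>
      intro c
      rw [smul_smul, hx]
  intro τ hτ
  obtain ⟨a, ha⟩ := h.large B (by omega)
  have haτ : a + τ ∉ y := fun h' => ha (by simpa using sub_mem h' (hTy hτ))
  obtain ⟨x, hxN, hxa⟩ := h.full a fun h' => ha (hTy h')
  have h1 := hgN τ 1
  rw [one_smul, ← add_sub_cancel_left a τ, map_sub, hg _ haτ, hg _ ha] at h1
  have e1 := huniq x hxN a ha hxa
  have e2 := huniq x hxN (a + τ) haτ (by
    have := sub_mem hxa hτ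
    convert this using 1
    abel)
  rw [add_sub_cancel_left, ← map_sub, eq_comm, ← sub_eq_zero, ← map_sub, Submodule.mkQ_apply,
    Submodule.Quotient.mk_eq_zero] at h1
  have := add_mem h1 (sub_mem e2 e1)
  convert this using 1
  abel

/-- If `S` were stable under adding gadgets, it would be stable under adding their span, because
nonzero multiples of gadgets are gadgets. That span contains `T`, so `a ∈ S` would force `b ∈ S`. -/
theorem IsAbundant.exists_gadget_add_notMem (h : IsAbundant T N k) {B : Finset A} (hB : B.card ≤ k)
    {S : Set A} {a b : A} (ha : a ∈ S) (haT : a ∈ T) (hb : b ∉ S) (hbT : b ∈ T) :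
    ∃ g ∈ gadgets T N (T ⊔ Submodule.span K (B : Set A)), ∃ c ∈ S, c + g ∉ S := by
  by_contra! hcon
  have hall : ∀ t ∈ Submodule.span K (gadgets T N (T ⊔ Submodule.span K (B : Set A))),
      ∀ r : K, ∀ c ∈ S, c + r • t ∈ S := by
    intro t ht
    induction ht using Submodule.span_induction with
    | mem x hx =>
      intro r c hc
      by_cases hr : r = 0
      · simpa [hr] using hc
      · exact hcon _ (h.smul_gadget hx hr) c hc
    | zero => intro r c hc; simpa using hc
    | add x y _ _ hx hy =>
      intro r c hc
      rw [smul_add, ← add_assoc]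
      exact hy r _ (hx r c hc)
    | smul s x _ hx =>
      intro r c hc
      rw [smul_smul]
      exact hx _ c hc
  apply hb
  have := hall (b - a) (h.le_span_gadgets hB (sub_mem hbT haT)) 1 a ha
  simpa using this

theorem disjoint_span_union {P Q : Submodule K A} {D D' : Set A}
    (h : Disjoint (Submodule.span K D) P) (hPQ : P ≤ Q) (hD : Submodule.span K D ≤ Q)
    (h' : Disjoint (Submodule.span K D') Q) : Disjoint (Submodule.span K (D ∪ D')) P := by
  rw [Submodule.disjoint_def] at h h' ⊢
  intro x hx hxP
  rw [Submodule.span_union] at hx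
  obtain ⟨a, ha, b, hb, rfl⟩ := Submodule.mem_sup.1 hx
  have hb0 : b = 0 := h' b hb (by
    have := sub_mem (hPQ hxP) (hD ha)
    rwa [add_sub_cancel_left] at this)
  subst hb0
  rw [add_zero] at hxP ⊢
  exact h a ha hxP

theorem Ind2.disjoint_span_pair {y : Submodule K A} {a b : A} (h : Ind2 y a b) :
    Disjoint (Submodule.span K {a, b}) y := by
  rw [Submodule.disjoint_def]
  intro x hx hxy
  obtain ⟨s, t, rfl⟩ := Submodule.mem_span_pair.1 hx
  obtain ⟨rfl, rfl⟩ := h s t hxy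
  simp

theorem disjoint_span_singleton_of_notMem {y : Submodule K A} {a : A} (h : a ∉ y) :
    Disjoint (Submodule.span K {a}) y := by
  rw [Submodule.disjoint_def]
  intro x hx hxy
  obtain ⟨s, rfl⟩ := Submodule.mem_span_singleton.1 hx
  by_cases hs : s = 0
  · simp [hs]
  · exact absurd (by simpa [smul_smul, hs] using y.smul_mem s⁻¹ hxy) h

/-- `S` collects the errors `a ∈ T` for which `s + a` is spanned by available vectors that are
independent of `T` and `B₀`; `m` bounds the number of missing errors. Take a gadget `g = d₁ + d₂ -
d₃` that moves `S` outside itself and replace `s` by `s + d₃`. Adjoining `d₃` to `D` retains the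
error `a`, and adjoining `d₁`, `d₂` instead produces `a + g`. So `S` grows at the price of three
vectors. -/
theorem IsAbundant.exists_reach [Finite A] (h : IsAbundant T N k) (B₀ : Finset A) (m : ℕ) :
    ∀ (S B : Finset A) (s : A), (∀ a ∈ S, a ∈ T) → S.Nonempty → Nat.card T ≤ S.card + m →
    B₀ ⊆ B → B.card + 3 * m ≤ k → s ∉ T → s ∈ T ⊔ Submodule.span K (B : Set A) →
    (∀ a ∈ S, ∃ D ⊆ B, (D : Set A) ⊆ N ∧
      Disjoint (Submodule.span K (D : Set A)) (T ⊔ Submodule.span K (B₀ : Set A)) ∧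
      s + a ∈ Submodule.span K (D : Set A)) →
    ∃ (B' : Finset A) (s' : A), B ⊆ B' ∧ B'.card ≤ B.card + 3 * m ∧ s' ∉ T ∧
      ∀ a ∈ T, ∃ D ⊆ B', (D : Set A) ⊆ N ∧
        Disjoint (Submodule.span K (D : Set A)) (T ⊔ Submodule.span K (B₀ : Set A)) ∧
        s' + a ∈ Submodule.span K (D : Set A) := by
  classical
  induction m with
  | zero =>
    intro S B s hS _ hcard hB _ hs _ hD
    have hST : (T : Set A) ⊆ S := by
      have hsub : (S : Set A) ⊆ T := hS
      have h1 : (T : Set A).ncard ≤ (S : Set A).ncard := by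
        rw [Set.ncard_coe_finset]; exact hcard
      exact (Set.eq_of_subset_of_ncard_le hsub h1 (Set.toFinite _)).ge
    exact ⟨B, s, subset_rfl, by simp, hs, fun a ha => hD a (hST ha)⟩
  | succ m ih =>
    intro S B s hS hne hcard hB hk hs hsB hD
    by_cases hall : ∀ a ∈ T, a ∈ S
    · exact ⟨B, s, subset_rfl, by omega, hs, fun a ha => hD a (hall a ha)⟩
    push Not at hall
    obtain ⟨b, hbT, hbS⟩ := hall
    obtain ⟨a, ha⟩ := hne
    obtain ⟨g, ⟨hgT, d₁, h₁, d₂, h₂, d₃, h₃, hind, hg⟩, c, hc, hcg⟩ :=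
      h.exists_gadget_add_notMem (B := B) (by omega) (S := (S : Set A)) ha (hS a ha) hbS hbT
    have hc' : c + g ∉ S := hcg
    set y := T ⊔ Submodule.span K (B : Set A) with hy
    have hTy : T ≤ y := le_sup_left
    have hd3 : d₃ = d₁ + d₂ - g := by rw [hg]; abel
    have hd3y : d₃ ∉ y := fun h' => hind.add_notMem (by
      have := add_mem h' (hTy hgT)
      rwa [hd3, sub_add_cancel] at this)
    have hBy : ∀ D : Finset A, D ⊆ B → Submodule.span K (D : Set A) ≤ y := fun D hDB =>
      (Submodule.span_mono (Finset.coe_subset.2 hDB)).trans le_sup_right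
    have hB0 : T ⊔ Submodule.span K (B₀ : Set A) ≤ y :=
      sup_le_sup_left (Submodule.span_mono (Finset.coe_subset.2 hB)) _
    have hcardB : (insert d₁ (insert d₂ (insert d₃ B))).card ≤ B.card + 3 := by
      have e1 := Finset.card_insert_le d₁ (insert d₂ (insert d₃ B))
      have e2 := Finset.card_insert_le d₂ (insert d₃ B)
      have e3 := Finset.card_insert_le d₃ B
      omega
    have hBB : B ⊆ insert d₁ (insert d₂ (insert d₃ B)) := fun x hx => by simp [hx]
    obtain ⟨B', s', hB', hcard', hs', hD'⟩ := ih (S ∪ S.image (· + g))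
      (insert d₁ (insert d₂ (insert d₃ B))) (s + d₃) (by
        intro x hx
        rcases Finset.mem_union.1 hx with hx | hx
        · exact hS x hx
        · obtain ⟨z, hz, rfl⟩ := Finset.mem_image.1 hx
          exact add_mem (hS z hz) hgT) ⟨a, Finset.mem_union_left _ ha⟩ (by
        have : S ⊂ S ∪ S.image (· + g) := by
          refine ⟨Finset.subset_union_left, fun hsub => hc' (hsub ?_)⟩
          exact Finset.mem_union_right _ (Finset.mem_image_of_mem _ hc)
        have := Finset.card_lt_card this
        omega) (hB.trans hBB) (by omega) (fun h' => hd3y (by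
        have := sub_mem (hTy h') hsB
        rwa [add_sub_cancel_left] at this)) (by
        refine add_mem ?_ ?_
        · have hle := sup_le_sup_left (Submodule.span_mono (R := K) (Finset.coe_subset.2 hBB)) T
          exact hle hsB
        · exact Submodule.mem_sup_right (Submodule.subset_span (by simp))) (by
        intro x hx
        rcases Finset.mem_union.1 hx with hx | hx
        · obtain ⟨D, hDB, hDN, hdis, hmem⟩ := hD x hx
          refine ⟨insert d₃ D, ?_, ?_, ?_, ?_⟩
          · intro z hz
            rcases Finset.mem_insert.1 hz with rfl | hz
            · simp
            · exact hBB (hDB hz)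
          · rw [Finset.coe_insert]
            exact Set.insert_subset h₃ hDN
          · rw [Finset.coe_insert, ← Set.union_singleton]
            exact disjoint_span_union hdis hB0 (hBy D hDB)
              (disjoint_span_singleton_of_notMem hd3y)
          · rw [Finset.coe_insert, add_right_comm, add_comm _ d₃]
            exact add_mem (Submodule.subset_span (Set.mem_insert _ _))
              (Submodule.span_mono (Set.subset_insert _ _) hmem)
        · obtain ⟨z, hz, rfl⟩ := Finset.mem_image.1 hx
          obtain ⟨D, hDB, hDN, hdis, hmem⟩ := hD z hz
          refine ⟨D ∪ {d₁, d₂}, ?_, ?_, ?_, ?_⟩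
          · intro w hw
            simp only [Finset.mem_union, Finset.mem_insert, Finset.mem_singleton] at hw
            rcases hw with hw | rfl | rfl
            · exact hBB (hDB hw)
            · simp
            · simp
          · intro w hw
            simp only [Finset.coe_union, Finset.coe_insert, Finset.coe_singleton, Set.mem_union,
              Set.mem_insert_iff, Set.mem_singleton_iff] at hw
            rcases hw with hw | rfl | rfl
            · exact hDN hw
            · exact h₁
            · exact h₂
          · rw [Finset.coe_union, Finset.coe_insert, Finset.coe_singleton]
            exact disjoint_span_union hdis hB0 (hBy D hDB) hind.disjoint_span_pair
          · have : s + d₃ + (z + g) = (s + z) + (d₁ + d₂) := by rw [hd3]; abel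
            simp only [this]
            rw [Finset.coe_union, Finset.coe_insert, Finset.coe_singleton]
            refine add_mem (Submodule.span_mono Set.subset_union_left hmem)
              (Submodule.span_mono Set.subset_union_right ?_)
            exact add_mem (Submodule.subset_span (by simp)) (Submodule.subset_span (by simp)))
    exact ⟨B', s', hBB.trans hB', by omega, hs', hD'⟩

/-- Once all errors are reachable from `s`, pick `x ∈ N` congruent to `s` modulo `T`; then `x - τ`
is `s` plus an error. One vector starts the process, and at most three are spent for each element of
`T`. -/
theorem IsAbundant.exists_target [Finite A] (h : IsAbundant T N k) (B₀ : Finset A)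
    (hk : B₀.card + (3 * Nat.card T + 1) ≤ k) {τ : A} (hτ : τ ∈ T) :
    ∃ B : Finset A, B₀ ⊆ B ∧ B.card ≤ B₀.card + (3 * Nat.card T + 1) ∧
      ∃ D ⊆ B, (D : Set A) ⊆ N ∧
        Disjoint (Submodule.span K (D : Set A)) (T ⊔ Submodule.span K (B₀ : Set A)) ∧
        ∃ x ∈ N, x - τ ∈ Submodule.span K (D : Set A) := by
  classical
  obtain ⟨a, ha⟩ := h.large B₀ (by omega)
  obtain ⟨d, hdN, hda⟩ := h.full a fun h' => ha (Submodule.mem_sup_left h')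
  have hd : d ∉ T ⊔ Submodule.span K (B₀ : Set A) := fun h' => ha (by
    have := sub_mem h' (Submodule.mem_sup_left hda)
    rwa [sub_sub_cancel] at this)
  have hcard := Finset.card_insert_le d B₀
  obtain ⟨B, s, hB, hcB, hs, hD⟩ := h.exists_reach B₀ (Nat.card T) {0} (insert d B₀) d
    (by simp) (by simp) (by simp) (Finset.subset_insert _ _) (by omega)
    (fun h' => hd (Submodule.mem_sup_left h'))
    (Submodule.mem_sup_right (Submodule.subset_span (by simp))) (by
      intro x hx
      rw [Finset.mem_singleton] at hx
      subst hx
      refine ⟨{d}, by simp, by simpa using hdN, ?_, ?_⟩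
      · rw [Finset.coe_singleton]
        exact disjoint_span_singleton_of_notMem hd
      · rw [add_zero, Finset.coe_singleton]
        exact Submodule.mem_span_singleton_self d)
  obtain ⟨x, hxN, hxs⟩ := h.full s hs
  obtain ⟨D, hDB, hDN, hdis, hmem⟩ := hD (x - s - τ) (sub_mem hxs hτ)
  refine ⟨B, (Finset.subset_insert _ _).trans hB, by omega, D, hDB, hDN, hdis, x, hxN, ?_⟩
  convert hmem using 1
  abel

/-- The vectors of `T` are treated one at a time. Each new `D` avoids `T` together with all vectors
used before, so the union of the sets `D` remains independent of `T`. -/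
theorem IsAbundant.exists_fill [Finite A] (h : IsAbundant T N k)
    (hk : Nat.card T * (3 * Nat.card T + 1) ≤ k) :
    ∃ D ⊆ N, Disjoint (Submodule.span K D) T ∧
      ∀ τ ∈ T, ∃ x ∈ N, x - τ ∈ Submodule.span K D := by
  classical
  have key : ∀ Θ : Finset A, (∀ a ∈ Θ, a ∈ T) → ∃ B : Finset A,
      B.card ≤ Θ.card * (3 * Nat.card T + 1) ∧ ∃ D ⊆ B, (D : Set A) ⊆ N ∧
      Disjoint (Submodule.span K (D : Set A)) T ∧
      ∀ τ ∈ Θ, ∃ x ∈ N, x - τ ∈ Submodule.span K (D : Set A) := by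
    intro Θ
    induction Θ using Finset.induction_on with
    | empty =>
      intro _
      exact ⟨∅, by simp, ∅, by simp, by simp, by simp, by simp⟩
    | insert t Θ ht ih =>
      intro hΘ
      obtain ⟨B₀, hcard, D₀, hD₀, hN₀, hdis₀, hx₀⟩ := ih fun a ha => hΘ a (by simp [ha])
      have hle : (insert t Θ).card ≤ Nat.card T := by
        have hsub : ((insert t Θ : Finset A) : Set A) ⊆ T := hΘ
        have := Set.ncard_le_ncard hsub (Set.toFinite _)
        rwa [Set.ncard_coe_finset] at this
      rw [Finset.card_insert_of_notMem ht] at hle ⊢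
      have hmul : (Θ.card + 1) * (3 * Nat.card T + 1) ≤ k :=
        (Nat.mul_le_mul_right _ hle).trans hk
      rw [add_mul, one_mul] at hmul ⊢
      obtain ⟨B, hB, hcB, D, hDB, hDN, hdis, x, hxN, hx⟩ :=
        h.exists_target B₀ (by omega) (hΘ t (by simp))
      refine ⟨B, by omega, D₀ ∪ D, Finset.union_subset (hD₀.trans hB) hDB, ?_, ?_, ?_⟩
      · rw [Finset.coe_union]
        exact Set.union_subset hN₀ hDN
      · rw [Finset.coe_union]
        exact disjoint_span_union hdis₀ le_sup_left
          ((Submodule.span_mono (Finset.coe_subset.2 hD₀)).trans le_sup_right) hdis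
      · intro τ hτ
        rw [Finset.coe_union]
        rcases Finset.mem_insert.1 hτ with rfl | hτ
        · exact ⟨x, hxN, Submodule.span_mono Set.subset_union_right hx⟩
        · obtain ⟨z, hzN, hz⟩ := hx₀ τ hτ
          exact ⟨z, hzN, Submodule.span_mono Set.subset_union_left hz⟩
  have hfin : (T : Set A).Finite := Set.toFinite _
  obtain ⟨B, -, D, -, hDN, hdis, hx⟩ := key hfin.toFinset (by simp)
  exact ⟨D, hDN, hdis, fun τ hτ => hx τ (by simpa using hτ)⟩

end Fill

/-! ### From vector obstructions to minors in the obstruction class -/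

section Obstruction

variable {K : Type*} [Field K] {F : Type*} [Field F] [Algebra K F]
  {V : Type*} [AddCommGroup V] [Module F V] {E : Type*}

/-- The vector form of having a minor in the obstruction class: after the contraction of `C`, the
coordinates `π` exhibit all points over `K`, and three vectors `a j + ω b j` whose lines have trivial
intersection. -/
def HasObs (K : Type*) [Field K] {F : Type*} [Field F] [Algebra K F] (ω : F)
    {V : Type*} [AddCommGroup V] [Module F V] {E : Type*} (v : E → V) : Prop :=
  ∃ (C : Set E) (π : V →ₗ[F] (Fin 3 → F)), LinearMap.ker π = Submodule.span F (v '' C) ∧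
    Function.Surjective π ∧
    (∀ k : Fin 3 → K, k ≠ 0 → ∃ e, ∃ f : F, f ≠ 0 ∧
      f • π (v e) = fun i => algebraMap K F (k i)) ∧
    ∃ (x : Fin 3 → E) (g : Fin 3 → Fˣ) (a b : Fin 3 → Fin 3 → K),
      (∀ j, (g j : F) • π (v (x j)) =
        fun i => algebraMap K F (a j i) + ω * algebraMap K F (b j i)) ∧
      LinearIndependent F (fun j => (g j : F) • π (v (x j))) ∧
      (∀ j, LinearIndependent K ![a j, b j]) ∧
      ∀ z : Fin 3 → K, (∀ j, z ∈ Submodule.span K {a j, b j}) → z = 0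

theorem HasObs.of_mkQ {ω : F} {v : E → V} {C : Set E} {Z : Submodule F V}
    (hZ : Z = Submodule.span F (v '' C)) (h : HasObs K ω (Z.mkQ ∘ v)) : HasObs K ω v := by
  obtain ⟨C', π, hker, hsurj, hpt, hx⟩ := h
  refine ⟨C ∪ C', π.comp Z.mkQ, ?_, hsurj.comp Z.mkQ_surjective, hpt, hx⟩
  rw [LinearMap.ker_comp, hker, Set.image_comp, ← Submodule.map_span, Submodule.comap_map_mkQ,
    Set.image_union, Submodule.span_union, hZ]

theorem lineSpan_eq {ω : F} (hω : IsQuadGen K ω) {t : ℕ} {x : Fin t → F} {a b : Fin t → K}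
    (h : ∀ i, x i = algebraMap K F (a i) + ω * algebraMap K F (b i)) :
    lineSpan (K := K) ω x = Submodule.span K {a, b} := by
  rw [lineSpan]
  congr 1
  ext c
  constructor
  · rintro ⟨a', b', h', hc⟩
    have huniq : ∀ i, a' i = a i ∧ b' i = b i := by
      intro i
      have := hω.eq_zero (s := a' i - a i) (t := b' i - b i) (by
        rw [map_sub, map_sub]
        linear_combination h i - h' i)
      exact ⟨sub_eq_zero.1 this.1, sub_eq_zero.1 this.2⟩
    have ha : a' = a := funext fun i => (huniq i).1
    have hb : b' = b := funext fun i => (huniq i).2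
    rw [ha, hb] at hc
    exact hc
  · intro hc
    exact ⟨a, b, h, hc⟩

/-- A vector `a + ωb` proportional to a vector over `K` has proportional components. Hence the three
extra elements of an obstruction differ from the elements representing the points over `K`. -/
theorem not_smul_eq_algebraMap {ω : F} (hω : IsQuadGen K ω) {a b k : Fin 3 → K} {f : F}
    (hf : f ≠ 0) (hab : LinearIndependent K ![a, b])
    (h : (f • fun i => algebraMap K F (a i) + ω * algebraMap K F (b i)) =
      fun i => algebraMap K F (k i)) : False := by
  obtain ⟨s, t, hst⟩ := hω.2 f⁻¹
  have huniq : ∀ i, a i = s * k i ∧ b i = t * k i := by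
    intro i
    have hi := congrFun h i
    simp only [Pi.smul_apply, smul_eq_mul] at hi
    have hi' : algebraMap K F (a i) + ω * algebraMap K F (b i) = f⁻¹ * algebraMap K F (k i) := by
      rw [← hi, inv_mul_cancel_left₀ hf]
    have := hω.eq_zero (s := a i - s * k i) (t := b i - t * k i) (by
      rw [map_sub, map_sub, map_mul, map_mul]
      rw [hst] at hi'
      linear_combination hi')
    exact ⟨sub_eq_zero.1 this.1, sub_eq_zero.1 this.2⟩
  rw [LinearIndependent.pair_iff] at hab
  have h1 := hab t (-s) (by
    ext i
    simp only [Pi.add_apply, Pi.smul_apply, smul_eq_mul, Pi.zero_apply, (huniq i).1, (huniq i).2]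
    ring)
  have hs : s = 0 := neg_eq_zero.1 h1.2
  rw [hs, h1.1] at hst
  simp at hst
  exact hf hst

/-- Contract `C`, keep one element for each point over `K` together with the three extra elements,
and delete the rest; `π` identifies the quotient with `F³`. -/
theorem HasObs.hasObstructionMinor [Finite E] {ω : F} (hω : IsQuadGen K ω) {v : E → V}
    (h : HasObs K ω v) : (RepMatroid.vecRep F v).HasObstructionMinor K ω := by
  classical
  obtain ⟨C, π, hker, hsurj, hpt, x, g, a, b, hx, hxli, hab, hz⟩ := h
  choose ε c hc0 hc using fun p : ℙ K (Fin 3 → K) => hpt p.rep p.rep_nonzero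
  have hnC : ∀ e, π (v e) ≠ 0 → e ∉ C := fun e he heC => he (by
    rw [← LinearMap.mem_ker, hker]
    exact Submodule.subset_span ⟨e, heC, rfl⟩)
  have hεne : ∀ p, π (v (ε p)) ≠ 0 := by
    intro p h0
    have h1 := hc p
    rw [h0, smul_zero] at h1
    apply p.rep_nonzero
    ext i
    have := congrFun h1 i
    simpa using this.symm
  have hεinj : Function.Injective ε := by
    intro p p' hpp
    have h1 := hc p
    rw [hpp] at h1
    have h2 := hc p'
    have h3 : ∀ i, c p * algebraMap K F (p'.rep i) = c p' * algebraMap K F (p.rep i) := by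
      intro i
      have e1 := congrFun h1 i
      have e2 := congrFun h2 i
      simp only [Pi.smul_apply, smul_eq_mul] at e1 e2
      rw [← e1, ← e2]
      ring
    obtain ⟨i₀, hi₀⟩ : ∃ i, p.rep i ≠ 0 := by
      by_contra! hall
      exact p.rep_nonzero (funext hall)
    have hi₀' : algebraMap K F (p.rep i₀) ≠ 0 := by simpa using hi₀
    rw [← p.mk_rep, ← p'.mk_rep, Projectivization.mk_eq_mk_iff']
    have hne : p'.rep i₀ ≠ 0 := by
      intro h0
      have := h3 i₀
      rw [h0] at this
      simp [hc0 p'] at this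
      exact hi₀ this
    have hne' : algebraMap K F (p'.rep i₀) ≠ 0 := by simpa using hne
    refine ⟨p.rep i₀ / p'.rep i₀, ?_⟩
    ext i
    apply (algebraMap K F).injective
    simp only [Pi.smul_apply, smul_eq_mul, map_mul, map_div₀]
    have e1 := h3 i
    have e2 := h3 i₀
    rw [div_mul_eq_mul_div, div_eq_iff hne']
    have : c p' * (algebraMap K F (p.rep i₀) * algebraMap K F (p'.rep i)) =
        c p' * (algebraMap K F (p.rep i) * algebraMap K F (p'.rep i₀)) := by
      linear_combination algebraMap K F (p'.rep i₀) * e1 - algebraMap K F (p'.rep i) * e2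
    exact mul_left_cancel₀ (hc0 p') this
  have hxli' : LinearIndependent F (fun j => π (v (x j))) := by
    convert hxli.units_smul g⁻¹ using 1
    ext j i
    simp [Units.smul_def]
  have hxinj : Function.Injective x := by
    intro i j hij
    exact hxli'.injective (by simp only [hij])
  have hxε : ∀ j p, x j ≠ ε p := by
    intro j p hjp
    have h1 := hc p
    have h2 : π (v (x j)) = (g j : F)⁻¹ •
        fun i => algebraMap K F (a j i) + ω * algebraMap K F (b j i) := by
      rw [← hx j, inv_smul_smul₀ (g j).ne_zero]
    rw [← hjp, h2, smul_smul] at h1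
    exact not_smul_eq_algebraMap hω
      (mul_ne_zero (hc0 p) (inv_ne_zero (g j).ne_zero)) (hab j) h1
  have hxC : ∀ j, x j ∉ C := fun j => hnC _ (hxli'.ne_zero j)
  have hεC : ∀ p, ε p ∉ C := fun p => hnC _ (hεne p)
  let D : Set (Cᶜ : Set E) := {e | e.1 ∉ Set.range x ∧ e.1 ∉ Set.range ε}
  refine ⟨C, D, ?_⟩
  let κ := {e : (Dᶜ : Set (Cᶜ : Set E)) // e.1.1 ∈ Set.range ε}
  have hxD : ∀ j, (⟨x j, hxC j⟩ : (Cᶜ : Set E)) ∈ Dᶜ := fun j hD => hD.1 ⟨j, rfl⟩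
  have hεD : ∀ p, (⟨ε p, hεC p⟩ : (Cᶜ : Set E)) ∈ Dᶜ := fun p hD => hD.2 ⟨p, rfl⟩
  let ψ : Fin 3 ⊕ κ → (Dᶜ : Set (Cᶜ : Set E)) :=
    Sum.elim (fun j => ⟨⟨x j, hxC j⟩, hxD j⟩) (fun e => e.1)
  have hψ : Function.Bijective ψ := by
    constructor
    · rintro (i | e) (j | e') hij
      · have : x i = x j := congrArg (fun z => z.1.1) hij
        rw [hxinj this]
      · obtain ⟨p, hp⟩ := e'.2
        have : x i = e'.1.1.1 := congrArg (fun z => z.1.1) hij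
        exact absurd (this.trans hp.symm) (hxε i p)
      · obtain ⟨p, hp⟩ := e.2
        have : e.1.1.1 = x j := congrArg (fun z => z.1.1) hij
        exact absurd (this.symm.trans hp.symm) (hxε j p)
      · have : e.1 = e'.1 := hij
        rw [Subtype.ext this]
    · intro e
      by_cases he : e.1.1 ∈ Set.range ε
      · exact ⟨Sum.inr ⟨e, he⟩, rfl⟩
      · have hex : e.1.1 ∈ Set.range x := by
          by_contra hex
          exact e.2 ⟨hex, he⟩
        obtain ⟨j, hj⟩ := hex
        exact ⟨Sum.inl j, Subtype.ext (Subtype.ext hj)⟩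
  let pt : κ ≃ ℙ K (Fin 3 → K) := (Equiv.ofBijective
    (fun p : ℙ K (Fin 3 → K) => (⟨⟨⟨ε p, hεC p⟩, hεD p⟩, ⟨p, rfl⟩⟩ : κ)) (by
      constructor
      · intro p p' hpp
        exact hεinj (congrArg (fun z => z.1.1.1) hpp)
      · rintro ⟨e, p, hp⟩
        exact ⟨p, Subtype.ext (Subtype.ext (Subtype.ext hp))⟩)).symm
  have hpt' : ∀ e : κ, ε (pt e) = e.1.1.1 := by
    intro e
    have := pt.symm_apply_apply e
    exact congrArg (fun z => z.1.1.1) this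
  let A : Matrix (Fin 3) (Fin 3) F :=
    Matrix.of fun i j => algebraMap K F (a j i) + ω * algebraMap K F (b j i)
  let G : Matrix (Fin 3) κ K := Matrix.of fun i e => (pt e).rep i
  have hAcol : ∀ j, A.col j = (g j : F) • π (v (x j)) := fun j => (hx j).symm
  have hline : ∀ j, lineSpan (K := K) ω (A.col j) = Submodule.span K {a j, b j} := fun j =>
    lineSpan_eq hω fun i => rfl
  refine ⟨κ, Equiv.ofBijective ψ hψ, A, G, ⟨pt, fun X => ?_⟩, ?_, ?_, ?_, ?_⟩
  · rw [RepMatroid.ofMatrix_eq_vecRep, RepMatroid.rk_vecRep, pgRk]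
    have : Submodule.span K (G.col '' X) = ⨆ p ∈ pt '' X, p.submodule := by
      simp only [iSup_image, Projectivization.submodule_eq]
      rw [← Set.biUnion_of_singleton (G.col '' X), Set.biUnion_image, Submodule.span_iUnion₂]
      rfl
    rw [this]
  · rw [Matrix.rank_eq_finrank_span_cols]
    have : A.col = fun j => (g j : F) • π (v (x j)) := funext hAcol
    rw [this, finrank_span_eq_card hxli, Fintype.card_fin]
  · intro j
    rw [hline j]
    have := finrank_span_eq_card (hab j)
    rwa [Matrix.range_cons, Matrix.range_cons, Matrix.range_empty, Set.union_empty,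
      Set.singleton_union, Fintype.card_fin] at this
  · rw [eq_bot_iff]
    intro z hzm
    rw [Submodule.mem_bot]
    refine hz z fun j => ?_
    rw [← hline j]
    exact (Submodule.mem_iInf _).1 hzm j
  · rw [RepMatroid.vecRep_contract, RepMatroid.delete, RepMatroid.restrict,
      RepMatroid.vecRep_pullback, RepMatroid.vecRep_pullback, RepMatroid.ofMatrix_eq_vecRep]
    let L : (V ⧸ Submodule.span F (v '' C)) ≃ₗ[F] (Fin 3 → F) :=
      (Submodule.quotEquivOfEq _ _ hker.symm).trans (π.quotKerEquivOfSurjective hsurj)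
    have hL : ∀ y, L (Submodule.mkQ _ y) = π y := fun y => rfl
    refine RepMatroid.projEquiv_vecRep L _ _
      (Sum.elim g fun e => Units.mk0 (c (pt e)) (hc0 _)) ?_
    rintro (j | e)
    · have : (g j : F) • L (Submodule.mkQ (Submodule.span F (v '' C)) (v (x j))) =
          A.col j := by
        rw [hL, hAcol]
      simp only [Sum.elim_inl]
      refine Eq.trans ?_ this.symm
      ext i
      rfl
    · have h1 := hc (pt e)
      rw [hpt' e] at h1
      have : c (pt e) • L (Submodule.mkQ (Submodule.span F (v '' C)) (v e.1.1.1)) =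
          fun i => algebraMap K F ((pt e).rep i) := by rw [hL, h1]
      simp only [Sum.elim_inr, Units.val_mk0]
      refine Eq.trans ?_ this.symm
      ext i
      rfl

end Obstruction

/-! ### Complements spanned by elements -/

section Complement

variable {F : Type*} [Field F] {V : Type*} [AddCommGroup V] [Module F V] {E : Type*}

/-- Take an inclusion-maximal admissible `C`. Contracting it collapses the span of `S` into the
image of `P` without collapsing `P`. -/
theorem exists_disjoint_span_extension [Finite E] (v : E → V) (P : Submodule F V) {S₀ S : Set E}
    (hS : S₀ ⊆ S) (hdis : Disjoint (Submodule.span F (v '' S₀)) P) :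
    ∃ C, S₀ ⊆ C ∧ C ⊆ S ∧ Disjoint (Submodule.span F (v '' C)) P ∧
      Submodule.span F (v '' S) ≤ P ⊔ Submodule.span F (v '' C) := by
  have hwf : WellFounded ((· > ·) : Set E → Set E → Prop) := wellFounded_gt
  obtain ⟨C, ⟨h0, hCS, hC⟩, hmax⟩ := hwf.has_min
    {C | S₀ ⊆ C ∧ C ⊆ S ∧ Disjoint (Submodule.span F (v '' C)) P} ⟨S₀, subset_rfl, hS, hdis⟩
  refine ⟨C, h0, hCS, hC, ?_⟩
  rw [Submodule.span_le]
  rintro _ ⟨e, he, rfl⟩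
  by_contra hne
  refine hmax (insert e C) ⟨h0.trans (Set.subset_insert _ _), Set.insert_subset he hCS, ?_⟩ ?_
  · rw [Set.image_insert_eq, ← Set.union_singleton]
    exact disjoint_span_union hC le_sup_left le_sup_right (disjoint_span_singleton_of_notMem hne)
  · refine ⟨Set.subset_insert _ _, fun hsub => hne ?_⟩
    exact Submodule.mem_sup_right (Submodule.subset_span ⟨e, hsub (Set.mem_insert _ _), rfl⟩)

theorem exists_isCompl_span [Finite E] {v : E → V} (hv : Submodule.span F (Set.range v) = ⊤)
    (P : Submodule F V) {S₀ : Set E} (hdis : Disjoint (Submodule.span F (v '' S₀)) P) :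
    ∃ C, S₀ ⊆ C ∧ IsCompl P (Submodule.span F (v '' C)) := by
  obtain ⟨C, h0, -, hC, hle⟩ :=
    exists_disjoint_span_extension v P (Set.subset_univ S₀) hdis
  refine ⟨C, h0, hC.symm, ?_⟩
  rw [codisjoint_iff, eq_top_iff, ← hv, ← Set.image_univ]
  exact hle

theorem span_range_mkQ_comp {v : E → V} (hv : Submodule.span F (Set.range v) = ⊤)
    (Z : Submodule F V) : Submodule.span F (Set.range (Z.mkQ ∘ v)) = ⊤ := by
  rw [Set.range_comp, Submodule.span_image, hv, Submodule.map_top, Submodule.range_mkQ]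

end Complement

/-! ### Recognizing obstructions in a three-dimensional quotient -/

section Terminal

variable {K : Type*} [Field K] {F : Type*} [Field F] [Algebra K F]
  {V : Type*} [AddCommGroup V] [Module F V] {E : Type*}

theorem hasObs_of_isCompl {ω : F} {v : E → V} {q : Fin 3 → V} (hq : LinearIndependent F q)
    {C : Set E} (hC : IsCompl (Submodule.span F (Set.range q)) (Submodule.span F (v '' C)))
    (hpt : ∀ k : Fin 3 → K, k ≠ 0 → ∃ e, ∃ f : F, f ≠ 0 ∧
      f • v e - ∑ i, algebraMap K F (k i) • q i ∈ Submodule.span F (v '' C))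
    (x : Fin 3 → E) (g : Fin 3 → Fˣ) (a b : Fin 3 → Fin 3 → K)
    (hx : ∀ j, (g j : F) • v (x j) - ∑ i, (algebraMap K F (a j i) + ω * algebraMap K F (b j i)) • q i
      ∈ Submodule.span F (v '' C))
    (hli : LinearIndependent F fun j i => algebraMap K F (a j i) + ω * algebraMap K F (b j i))
    (hab : ∀ j, LinearIndependent K ![a j, b j])
    (hz : ∀ z : Fin 3 → K, (∀ j, z ∈ Submodule.span K {a j, b j}) → z = 0) : HasObs K ω v := by
  let bq := Module.Basis.span hq
  have hbq : ∀ i, (bq i : V) = q i := fun i =>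
    congrArg Subtype.val (Module.Basis.span_apply hq i)
  let π : V →ₗ[F] (Fin 3 → F) :=
    bq.equivFun.toLinearMap.comp (Submodule.projectionOnto _ _ hC)
  have hker : LinearMap.ker π = Submodule.span F (v '' C) := by
    rw [LinearMap.ker_comp, LinearEquiv.ker, Submodule.comap_bot, Submodule.ker_projectionOnto]
  have hπ : ∀ (y : V) (c : Fin 3 → F), y - ∑ i, c i • q i ∈ Submodule.span F (v '' C) →
      π y = c := by
    intro y c hy
    rw [← hker, LinearMap.mem_ker, map_sub, sub_eq_zero] at hy
    rw [hy]
    have h1 : ∑ i, c i • q i = ((∑ i, c i • bq i : Submodule.span F (Set.range q)) : V) := by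
      simp [hbq]
    rw [h1]
    change bq.equivFun (Submodule.projectionOnto _ _ hC _) = c
    rw [Submodule.projectionOnto_apply_left, ← bq.equivFun_symm_apply, LinearEquiv.apply_symm_apply]
  have hxπ : ∀ j, (g j : F) • π (v (x j)) =
      fun i => algebraMap K F (a j i) + ω * algebraMap K F (b j i) := by
    intro j
    rw [← map_smul]
    exact hπ _ _ (hx j)
  refine ⟨C, π, hker, ?_, ?_, x, g, a, b, hxπ, ?_, hab, hz⟩
  · intro c
    exact ⟨∑ i, c i • q i, hπ _ _ (by simp)⟩
  · intro k hk
    obtain ⟨e, f, hf, he⟩ := hpt k hk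
    exact ⟨e, f, hf, by rw [← map_smul]; exact hπ _ _ he⟩
  · simp only [hxπ]
    exact hli

/-- In the coordinates `p₁, p₂, b` all points over `K` are available, and so are (ω,0,1), (0,ω,1)
and (1,ω,1). The `K`-lines of the first two meet only in the point (0,0,1), which is not on the
third line, spanned by (1,0,1) and (0,1,0). -/
theorem hasObs_of_two_dimensional [Module K V] [IsScalarTower K F V] {ω : F} (hω : IsQuadGen K ω)
    {v : E → V} {p₁ p₂ b : V}
    (hq : LinearIndependent F ![p₁, p₂, b]) {C : Set E}
    (hC : IsCompl (Submodule.span F (Set.range ![p₁, p₂, b])) (Submodule.span F (v '' C)))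
    (hpt : ∀ (f₁ f₂ : F) (c : K), f₁ • p₁ + f₂ • p₂ + c • b ≠ 0 → ∃ e, ∃ f : F, f ≠ 0 ∧
      f • v e - (f₁ • p₁ + f₂ • p₂ + c • b) ∈ Submodule.span F (v '' C)) : HasObs K ω v := by
  have hq' : ∀ f₁ f₂ f₃ : F, f₁ • p₁ + f₂ • p₂ + f₃ • b = 0 → f₁ = 0 ∧ f₂ = 0 ∧ f₃ = 0 := by
    intro f₁ f₂ f₃ h
    have := Fintype.linearIndependent_iff.1 hq ![f₁, f₂, f₃] (by simpa [Fin.sum_univ_three] using h)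
    exact ⟨this 0, this 1, this 2⟩
  have hω0 : ω ≠ 0 := fun h => hω.1 ⟨0, by rw [h, map_zero]⟩
  have hpt1 : ∀ (f₁ f₂ : F) (c : K), (f₁ ≠ 0 ∨ f₂ ≠ 0 ∨ c ≠ 0) → ∃ e, ∃ f : F, f ≠ 0 ∧
      f • v e - (f₁ • p₁ + f₂ • p₂ + c • b) ∈ Submodule.span F (v '' C) := by
    intro f₁ f₂ c hne
    refine hpt f₁ f₂ c fun h0 => ?_
    rw [← algebraMap_smul F c b] at h0
    obtain ⟨h1, h2, h3⟩ := hq' _ _ _ h0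
    simp [h1, h2] at hne h3
    exact hne h3
  obtain ⟨e₀, g₀, hg₀, he₀⟩ := hpt1 ω 0 1 (Or.inl hω0)
  obtain ⟨e₁, g₁, hg₁, he₁⟩ := hpt1 0 ω 1 (Or.inr (Or.inl hω0))
  obtain ⟨e₂, g₂, hg₂, he₂⟩ := hpt1 1 ω 1 (Or.inl one_ne_zero)
  refine hasObs_of_isCompl (K := K) hq hC ?_ ![e₀, e₁, e₂]
    ![Units.mk0 g₀ hg₀, Units.mk0 g₁ hg₁, Units.mk0 g₂ hg₂]
    ![![0, 0, 1], ![0, 0, 1], ![1, 0, 1]] ![![1, 0, 0], ![0, 1, 0], ![0, 1, 0]] ?_ ?_ ?_ ?_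
  · intro k hk
    obtain ⟨e, f, hf, he⟩ := hpt1 (algebraMap K F (k 0)) (algebraMap K F (k 1)) (k 2) (by
      by_contra! h
      simp at h
      exact hk (by ext i; fin_cases i <;> simp [h]))
    refine ⟨e, f, hf, ?_⟩
    simpa [Fin.sum_univ_three] using he
  · intro j
    fin_cases j
    · simpa [Fin.sum_univ_three] using he₀
    · simpa [Fin.sum_univ_three] using he₁
    · simpa [Fin.sum_univ_three] using he₂
  · rw [Fintype.linearIndependent_iff]
    intro c hc
    have h0 := congrFun hc 0
    have h1 := congrFun hc 1
    have h2 := congrFun hc 2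
    simp [Fin.sum_univ_three] at h0 h1 h2
    have e2 : c 0 = 0 := by
      have : ω * c 0 = 0 := by
        have h3 : ω * (c 1 + c 2) = 0 := by linear_combination h1
        rcases mul_eq_zero.1 h3 with h4 | h4
        · exact absurd h4 hω0
        · have : c 0 = 0 := by linear_combination h2 - h4
          rw [this, mul_zero]
      exact (mul_eq_zero.1 this).resolve_left hω0
    have e3 : c 2 = 0 := by rw [e2] at h0; simpa using h0
    have e4 : c 1 = 0 := by rw [e2, e3] at h2; simpa using h2
    intro i
    fin_cases i
    · exact e2
    · exact e4
    · exact e3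
  · intro j
    rw [LinearIndependent.pair_iff]
    intro s t hst
    have h0 := congrFun hst 0
    have h1 := congrFun hst 1
    have h2 := congrFun hst 2
    fin_cases j <;> simp at h0 h1 h2 <;> simp [h0, h1, h2]
  · intro z hz
    obtain ⟨s₀, t₀, h₀⟩ := Submodule.mem_span_pair.1 (hz 0)
    obtain ⟨s₁, t₁, h₁⟩ := Submodule.mem_span_pair.1 (hz 1)
    obtain ⟨s₂, t₂, h₂⟩ := Submodule.mem_span_pair.1 (hz 2)
    have a0 := congrFun h₀ 1
    have a1 := congrFun h₁ 0
    have a2 := congrFun h₂ 0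
    have a3 := congrFun h₂ 2
    simp at a0 a1 a2 a3
    have e0 : z 0 = 0 := a1.symm
    have e1 : z 1 = 0 := a0.symm
    have e2 : z 2 = 0 := by rw [← a3, a2, e0]
    ext i
    fin_cases i
    · exact e0
    · exact e1
    · exact e2

end Terminal

/-! ### Cores, abundance, and filling a core -/

section Frames

variable {K : Type*} [Field K] {F : Type*} [Field F] [Algebra K F]
  {V : Type*} [AddCommGroup V] [Module K V] [Module F V] [IsScalarTower K F V] {E : Type*}

/-- Modulo `Y`, the vectors `v e` contain all points of the `K`-form `Γ`; the subspace `Y` is spanned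
by vectors `v e`. -/
structure IsCore (ω : F) (v : E → V) (Γ : Submodule K V) (Y : Submodule F V) : Prop where
  spans : Spans ω Γ
  kform : KForm ω Γ Y
  full : ∀ γ ∈ Γ, γ ∉ Y → ∃ e, ∃ f : F, f ≠ 0 ∧ f • v e - γ ∈ Y
  gen : Y ≤ Submodule.span F (v '' {e | v e ∈ Y})

/-- All vectors outside `Y` are multiples of vectors in `Γ`. -/
def OffForm (v : E → V) (Γ : Submodule K V) (Y : Submodule F V) : Prop :=
  ∀ e, v e ∉ Y → InForm F Γ (v e)

/-- The vectors of `Γ` that are multiples of some `v e`. -/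
def formSet (F : Type*) [Field F] {K : Type*} [Field K] {V : Type*} [AddCommGroup V] [Module K V]
    [Module F V] {E : Type*} (v : E → V) (Γ : Submodule K V) : Set V :=
  {x | x ∈ Γ ∧ ∃ e, ∃ f : F, f ≠ 0 ∧ f • v e = x}

/-- No proper subspace of `Γ` contains all the vectors of `formSet F v Γ` outside an extension of `Y`
by at most `k` vectors. -/
def FormAbundant (v : E → V) (Γ : Submodule K V) (Y : Submodule F V) (k : ℕ) : Prop :=
  ∀ B : Finset V, (B : Set V) ⊆ Γ → B.card ≤ k → ∀ Γ' ≤ Γ,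
    (∀ x ∈ formSet F v Γ, x ∉ Y ⊔ Submodule.span F (B : Set V) → x ∈ Γ') → Γ' = Γ

variable {ω : F} {v : E → V} {Γ : Submodule K V} {Y : Submodule F V}

/-- Enlarging by vectors of `Γ` keeps the subspace spanned by elements: each such vector is in `Y`
or is represented modulo `Y` by an element, which then lies in the enlargement. -/
theorem IsCore.sup_span (hω : IsQuadGen K ω) (h : IsCore ω v Γ Y) {B : Set V} (hB : B ⊆ Γ) :
    IsCore ω v Γ (Y ⊔ Submodule.span F B) := by
  refine ⟨h.spans, h.kform.sup_span hω hB, fun γ hγ hγY => ?_, sup_le ?_ ?_⟩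
  · obtain ⟨e, f, hf, he⟩ := h.full γ hγ fun h' => hγY (Submodule.mem_sup_left h')
    exact ⟨e, f, hf, Submodule.mem_sup_left he⟩
  · exact h.gen.trans (Submodule.span_mono (Set.image_mono fun e he => Submodule.mem_sup_left he))
  · rw [Submodule.span_le]
    intro b hb
    have hgen := h.gen.trans (Submodule.span_mono (Set.image_mono
      (show {e | v e ∈ Y} ⊆ {e | v e ∈ Y ⊔ Submodule.span F B} from
        fun e he => Submodule.mem_sup_left he)))
    by_cases hbY : b ∈ Y
    · exact hgen hbY
    · obtain ⟨e, f, hf, he⟩ := h.full b (hB hb) hbY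
      have hmem : v e ∈ Y ⊔ Submodule.span F B := by
        have h1 : f • v e ∈ Y ⊔ Submodule.span F B := by
          rw [← sub_add_cancel (f • v e) b]
          exact Submodule.add_mem_sup he (Submodule.subset_span hb)
        simpa [smul_smul, hf] using Submodule.smul_mem _ f⁻¹ h1
      have h2 : f • v e ∈ Submodule.span F (v '' {e | v e ∈ Y ⊔ Submodule.span F B}) :=
        Submodule.smul_mem _ _ (Submodule.subset_span ⟨e, hmem, rfl⟩)
      have := sub_mem h2 (hgen he)
      rwa [sub_sub_cancel] at this

theorem OffForm.mono {Y' : Submodule F V} (h : OffForm v Γ Y) (hY : Y ≤ Y') : OffForm v Γ Y' :=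
  fun e he => h e fun h' => he (hY h')

theorem FormAbundant.sup_span {k j : ℕ} (h : FormAbundant v Γ Y (k + j)) {B : Finset V}
    (hB : (B : Set V) ⊆ Γ) (hj : B.card ≤ j) :
    FormAbundant v Γ (Y ⊔ Submodule.span F (B : Set V)) k := by
  classical
  intro B' hB' hk Γ' hΓ' hx
  refine h (B ∪ B') (by rw [Finset.coe_union]; exact Set.union_subset hB hB')
    ((Finset.card_union_le _ _).trans (by omega)) Γ' hΓ' fun x hx1 hx2 => hx x hx1 ?_
  rwa [sup_assoc, ← Submodule.span_union, ← Finset.coe_union]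

theorem IsCore.map_mkQ (h : IsCore ω v Γ Y) {Z : Submodule F V} (hZ : Z ≤ Y) :
    IsCore ω (Z.mkQ ∘ v) (Γ.map (Z.mkQ.restrictScalars K)) (Y.map Z.mkQ) := by
  refine ⟨h.spans.map_mkQ Z, h.kform.map_mkQ hZ, ?_, ?_⟩
  · rintro _ ⟨γ, hγ, rfl⟩ hγY
    obtain ⟨e, f, hf, he⟩ := h.full γ hγ fun h' => hγY ⟨γ, h', rfl⟩
    exact ⟨e, f, hf, _, he, by simp⟩
  · refine (Submodule.map_mono h.gen).trans ?_
    rw [Submodule.map_span, ← Set.image_comp]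
    exact Submodule.span_mono (Set.image_mono fun e he => ⟨_, he, rfl⟩)

theorem OffForm.map_mkQ (h : OffForm v Γ Y) (Z : Submodule F V) :
    OffForm (Z.mkQ ∘ v) (Γ.map (Z.mkQ.restrictScalars K)) (Y.map Z.mkQ) := by
  intro e he
  obtain ⟨f, hf, hm⟩ := h e fun h' => he ⟨_, h', rfl⟩
  exact ⟨f, hf, _, hm, by simp⟩

theorem FormAbundant.map_mkQ {k : ℕ} (h : FormAbundant v Γ Y k) {Z : Submodule F V} (hZ : Z ≤ Y) :
    FormAbundant (Z.mkQ ∘ v) (Γ.map (Z.mkQ.restrictScalars K)) (Y.map Z.mkQ) k := by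
  classical
  intro B hB hk Γ' hΓ' hx
  have hlift : ∀ b : V ⧸ Z, ∃ c : V, b ∈ B → c ∈ Γ ∧ Z.mkQ c = b := by
    intro b
    by_cases hb : b ∈ B
    · obtain ⟨c, hc, rfl⟩ := hB hb
      exact ⟨c, fun _ => ⟨hc, rfl⟩⟩
    · exact ⟨0, fun h' => absurd h' hb⟩
  choose l hl using hlift
  have himg : Z.mkQ '' (B.image l : Finset V) = B := by
    ext b
    simp only [Finset.coe_image, Set.mem_image, Finset.mem_coe, exists_exists_and_eq_and]
    constructor
    · rintro ⟨c, hc, rfl⟩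
      rwa [(hl c hc).2]
    · exact fun hb => ⟨b, hb, (hl b hb).2⟩
  have key := h (B.image l) (by
    intro x hx
    obtain ⟨b, hb, rfl⟩ := Finset.mem_image.1 (Finset.mem_coe.1 hx)
    exact (hl b hb).1) (Finset.card_image_le.trans hk)
    (Γ ⊓ Γ'.comap (Z.mkQ.restrictScalars K)) inf_le_left (by
      rintro x ⟨hxΓ, e, f, hf, rfl⟩ hxY
      refine ⟨hxΓ, hx _ ⟨⟨_, hxΓ, rfl⟩, e, f, hf, by simp⟩ fun hmem => hxY ?_⟩
      rw [← himg, ← Submodule.map_span, ← Submodule.map_sup] at hmem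
      exact (mkQ_mem_map_iff (hZ.trans le_sup_left)).1 hmem)
  refine le_antisymm hΓ' ?_
  rintro _ ⟨γ, hγ, rfl⟩
  have : γ ∈ Γ ⊓ Γ'.comap (Z.mkQ.restrictScalars K) := by rw [key]; exact hγ
  exact this.2

theorem finrank_quotient_map_mkQ {Y Z : Submodule F V} (hZ : Z ≤ Y) :
    Module.finrank F ((V ⧸ Z) ⧸ Y.map Z.mkQ) = Module.finrank F (V ⧸ Y) :=
  (Submodule.quotientQuotientEquivQuotient Z Y hZ).finrank_eq

/-- The core gives a multiple of `v e` close to `γ`, and `OffForm` gives a multiple exactly in `Γ`.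
The two scalars differ by a factor from `K`, so the first multiple is in `Γ` as well. -/
theorem IsCore.exists_mem_formSet (hω : IsQuadGen K ω) (h : IsCore ω v Γ Y)
    (ho : OffForm v Γ Y) {γ : V} (hγ : γ ∈ Γ) (hγY : γ ∉ Y) :
    ∃ x ∈ formSet F v Γ, x - γ ∈ Y := by
  obtain ⟨e, f, hf, he⟩ := h.full γ hγ hγY
  have heY : v e ∉ Y := fun h' => hγY (by
    have := sub_mem (Y.smul_mem f h') he
    rwa [sub_sub_cancel] at this)
  obtain ⟨f', hf', he'⟩ := ho e heY
  obtain ⟨s, hs⟩ := h.kform.exists_algebraMap_eq hω (x := γ) (y := f' • v e) hγ hγY he'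
    (f := f' * f⁻¹) (by
      have := Y.smul_mem (-(f' * f⁻¹)) he
      rw [smul_sub, smul_smul, neg_mul, inv_mul_cancel_right₀ hf, neg_smul, neg_smul,
        sub_neg_eq_add, add_comm, ← sub_eq_add_neg] at this
      exact this)
  have hs0 : s ≠ 0 := by
    rintro rfl
    rw [map_zero] at hs
    exact mul_ne_zero hf' (inv_ne_zero hf) hs
  refine ⟨f • v e, ⟨?_, e, f, hf, rfl⟩, he⟩
  have h1 : f • v e = s⁻¹ • f' • v e := by
    rw [← algebraMap_smul F s⁻¹, map_inv₀, ← hs, smul_smul]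
    congr 1
    field_simp
  rw [h1]
  exact Γ.smul_mem _ he'

theorem smul_mem_formSet {x : V} (hx : x ∈ formSet F v Γ) {c : K} (hc : c ≠ 0) :
    c • x ∈ formSet F v Γ := by
  obtain ⟨hxΓ, e, f, hf, rfl⟩ := hx
  refine ⟨Γ.smul_mem _ hxΓ, e, algebraMap K F c * f, mul_ne_zero (by simpa using hc) hf, ?_⟩
  rw [mul_smul, algebraMap_smul]

theorem exists_notMem_sup_span [Finite V] (h : Spans ω Γ) {B : Finset V}
    (hB : B.card < Module.finrank F (V ⧸ Y)) : ∃ γ ∈ Γ, γ ∉ Y ⊔ Submodule.span F (B : Set V) := by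
  classical
  by_contra! hcon
  have htop : Y ⊔ Submodule.span F (B : Set V) = ⊤ := by
    rw [eq_top_iff, ← h.span_eq_top, Submodule.span_le]
    exact hcon
  have h1 : Submodule.span F ((B.image Y.mkQ : Finset (V ⧸ Y)) : Set (V ⧸ Y)) = ⊤ := by
    rw [Finset.coe_image, ← Submodule.map_span, eq_top_iff, ← Submodule.range_mkQ Y,
      ← Submodule.map_top, ← htop, Submodule.map_sup, Submodule.mkQ_map_self, bot_sup_eq]
  have h2 := finrank_span_finset_le_card (R := F) (B.image Y.mkQ)
  rw [Set.finrank, h1, finrank_top] at h2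
  have := Finset.card_image_le (s := B) (f := Y.mkQ)
  omega

/-- This translates from `F`-spans in `V` to `K`-spans in `Γ`, with `T = Γ ∩ Y`. The codimension
exceeds `k + 1`, which gives `large`. -/
theorem IsCore.isAbundant [Finite V] (hω : IsQuadGen K ω) (h : IsCore ω v Γ Y)
    (ho : OffForm v Γ Y) {k : ℕ} (ha : FormAbundant v Γ Y k)
    (hk : k + 2 ≤ Module.finrank F (V ⧸ Y)) :
    IsAbundant ((Y.restrictScalars K).comap Γ.subtype)
      {x : Γ | (x : V) ∈ formSet F v Γ ∧ (x : V) ∉ Y} k := by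
  classical
  have hmem : ∀ (B : Finset Γ) (x : Γ),
      x ∈ (Y.restrictScalars K).comap Γ.subtype ⊔ Submodule.span K (B : Set Γ) →
      (x : V) ∈ Y ⊔ Submodule.span F ((B.image Subtype.val : Finset V) : Set V) := by
    intro B x hx
    obtain ⟨y, hy, z, hz, rfl⟩ := Submodule.mem_sup.1 hx
    have hyY : (y : V) ∈ Y := hy
    have h1 : (z : V) ∈ (Submodule.span K (B : Set Γ)).map Γ.subtype := ⟨z, hz, rfl⟩
    rw [Submodule.map_span] at h1
    rw [Finset.coe_image]
    exact Submodule.add_mem_sup hyY (Submodule.span_le_restrictScalars K F _ h1)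
  have hsub : ∀ B : Finset Γ, ((B.image Subtype.val : Finset V) : Set V) ⊆ Γ := by
    intro B x hx
    obtain ⟨b, -, rfl⟩ := Finset.mem_image.1 (Finset.mem_coe.1 hx)
    exact b.2
  refine ⟨?_, ?_, ?_, ?_⟩
  · rintro x ⟨hx, hxY⟩ c hc
    refine ⟨smul_mem_formSet hx hc, fun h' => hxY ?_⟩
    have := Y.smul_mem (algebraMap K F c⁻¹) h'
    rw [algebraMap_smul] at this
    simpa [smul_smul, hc] using this
  · intro a haY
    obtain ⟨x, hx, hxa⟩ := h.exists_mem_formSet hω ho a.2 haY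
    refine ⟨⟨x, hx.1⟩, ⟨hx, fun h' => haY ?_⟩, hxa⟩
    have := sub_mem h' hxa
    rwa [sub_sub_cancel] at this
  · intro B hB
    have key := ha (B.image Subtype.val) (hsub B) (Finset.card_image_le.trans hB)
      ((Submodule.span K {x : Γ | x ∈ {x : Γ | (x : V) ∈ formSet F v Γ ∧ (x : V) ∉ Y} ∧
        x ∉ (Y.restrictScalars K).comap Γ.subtype ⊔ Submodule.span K (B : Set Γ)}).map Γ.subtype)
      (Submodule.map_subtype_le _ _) (by
        intro x hx hxY
        refine ⟨⟨x, hx.1⟩, Submodule.subset_span ⟨⟨hx, fun h' => hxY ?_⟩, fun h' => hxY ?_⟩, rfl⟩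
        · exact Submodule.mem_sup_left h'
        · exact hmem B ⟨x, hx.1⟩ h')
    rw [eq_top_iff]
    intro x _
    obtain ⟨y, hy, hyx⟩ := key.ge x.2
    have : y = x := Subtype.ext hyx
    rwa [← this]
  · intro B hB
    obtain ⟨γ, hγ, hγY⟩ := exists_notMem_sup_span (Y := Y) h.spans (B := B.image Subtype.val)
      (lt_of_le_of_lt Finset.card_image_le (by omega))
    exact ⟨⟨γ, hγ⟩, fun h' => hγY (hmem B _ h')⟩

/-- Fill `Γ ∩ Y` by a set `D`. By the form property, `K`-disjointness of `D` from `Γ ∩ Y` becomes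
`F`-disjointness from `Y`, so the elements of `D` extend to a set spanning a complement of `Y`. -/
theorem IsCore.exists_fill [Finite V] [Finite E] (hω : IsQuadGen K ω) (h : IsCore ω v Γ Y)
    (hv : Submodule.span F (Set.range v) = ⊤)
    (ho : OffForm v Γ Y) {k c : ℕ} (ha : FormAbundant v Γ Y k)
    (hk : k + 2 ≤ Module.finrank F (V ⧸ Y)) (hc : {x | x ∈ Γ ∧ x ∈ Y}.ncard ≤ c)
    (hck : c * (3 * c + 1) ≤ k) :
    ∃ C : Set E, IsCompl Y (Submodule.span F (v '' C)) ∧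
      ∀ τ ∈ Γ, τ ∈ Y → ∃ e, ∃ f : F, f ≠ 0 ∧ f • v e - τ ∈ Submodule.span F (v '' C) := by
  have hcard : Nat.card ((Y.restrictScalars K).comap Γ.subtype) ≤ c := by
    refine le_trans ?_ hc
    rw [← Nat.card_coe_set_eq]
    refine Nat.card_le_card_of_injective (fun x => (⟨x.1.1, x.1.2, x.2⟩ : {x | x ∈ Γ ∧ x ∈ Y})) ?_
    intro x y hxy
    have : x.1.1 = y.1.1 := by simpa using hxy
    exact Subtype.ext (Subtype.ext this)
  obtain ⟨D, hDN, hdis, hτ⟩ := (h.isAbundant hω ho ha hk).exists_fill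
    ((Nat.mul_le_mul hcard (by omega)).trans hck)
  let S₀ : Set E := {e | ∃ d ∈ D, ∃ f : F, f ≠ 0 ∧ f • v e = (d : V)}
  have hS : Submodule.span F (v '' S₀) = Submodule.span F (Subtype.val '' D : Set V) := by
    apply le_antisymm
    · rw [Submodule.span_le]
      rintro _ ⟨e, ⟨d, hd, f, hf, he⟩, rfl⟩
      have : v e = f⁻¹ • (d : V) := by rw [← he, inv_smul_smul₀ hf]
      rw [this]
      exact Submodule.smul_mem _ _ (Submodule.subset_span ⟨d, hd, rfl⟩)
    · rw [Submodule.span_le]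
      rintro _ ⟨d, hd, rfl⟩
      obtain ⟨-, e, f, hf, he⟩ := (hDN hd).1
      rw [← he]
      exact Submodule.smul_mem _ _ (Submodule.subset_span ⟨e, ⟨d, hd, f, hf, he⟩, rfl⟩)
  have hKD : ∀ a, a ∈ Submodule.span K (Subtype.val '' D : Set V) →
      ∃ a' : Γ, a' ∈ Submodule.span K D ∧ (a' : V) = a := by
    intro a ha
    rw [show (Subtype.val '' D : Set V) = Γ.subtype '' D from rfl, ← Submodule.map_span] at ha
    exact ha
  have hdisY : Disjoint (Submodule.span F (v '' S₀)) Y := by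
    rw [hS, Submodule.disjoint_def]
    intro x hx hxY
    obtain ⟨a, ha, b, hb, rfl⟩ := hω.exists_of_mem_span hx
    obtain ⟨a, ha', rfl⟩ := hKD a ha
    obtain ⟨b, hb', rfl⟩ := hKD b hb
    obtain ⟨h1, h2⟩ := h.kform _ a.2 _ b.2 hxY
    rw [Submodule.disjoint_def] at hdis
    rw [hdis a ha' h1, hdis b hb' h2]
    simp
  obtain ⟨C, hSC, hC⟩ := exists_isCompl_span hv Y hdisY
  refine ⟨C, hC, fun τ hτΓ hτY => ?_⟩
  obtain ⟨x, hx, hxτ⟩ := hτ ⟨τ, hτΓ⟩ hτY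
  obtain ⟨-, e, f, hf, he⟩ := hx.1
  refine ⟨e, f, hf, Submodule.span_mono (Set.image_mono hSC) ?_⟩
  rw [hS, he]
  have h1 : ((x - ⟨τ, hτΓ⟩ : Γ) : V) ∈ (Submodule.span K D).map Γ.subtype := ⟨_, hxτ, rfl⟩
  rw [Submodule.map_span] at h1
  exact Submodule.span_le_restrictScalars K F _ h1

end Frames

/-! ### Obstructions inside a core -/

section FrameObstructions

variable {K : Type*} [Field K] {F : Type*} [Field F] [Algebra K F]
  {V : Type*} [AddCommGroup V] [Module K V] [Module F V] [IsScalarTower K F V] {E : Type*}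
  {ω : F} {v : E → V} {Γ : Submodule K V} {Y : Submodule F V}

theorem linearIndependent_triple {p₁ p₂ b : V} (hp : ∀ s t : F, s • p₁ + t • p₂ = 0 → s = 0 ∧ t = 0)
    (hb : b ∉ Submodule.span F {p₁, p₂}) : LinearIndependent F ![p₁, p₂, b] := by
  rw [Fintype.linearIndependent_iff]
  intro g hg
  simp only [Fin.sum_univ_three, Matrix.cons_val_zero, Matrix.cons_val_one, Matrix.cons_val] at hg
  have h2 : g 2 = 0 := by
    by_contra h2
    apply hb
    rw [Submodule.mem_span_pair]
    refine ⟨-((g 2)⁻¹ * g 0), -((g 2)⁻¹ * g 1), ?_⟩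
    have h3 : b = (g 2)⁻¹ • (g 2 • b) := (inv_smul_smul₀ h2 b).symm
    have h4 : g 2 • b = -(g 0 • p₁ + g 1 • p₂) := by
      rw [eq_neg_iff_add_eq_zero, add_comm]; exact hg
    rw [h3, h4]
    module
  rw [h2, zero_smul, add_zero] at hg
  obtain ⟨h0, h1⟩ := hp _ _ hg
  intro i
  fin_cases i
  · exact h0
  · exact h1
  · exact h2

theorem span_range_triple (p₁ p₂ b : V) :
    Submodule.span F (Set.range ![p₁, p₂, b]) =
      Submodule.span F {p₁, p₂} ⊔ Submodule.span F {b} := by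
  rw [← Submodule.span_union]
  congr 1
  ext x
  simp [eq_comm]
  tauto

/-- A third dimension comes from some `b ∈ Γ` outside `Y`. The form vectors in `Y + Fb` are `f₁p₁ +
f₂p₂ + cb` with `c ∈ K`, at most q²·q²·q of them, and filling makes all of them available. -/
theorem IsCore.hasObs_of_le [Finite V] [Finite E] {q : ℕ} (hK : Nat.card K = q)
    (hF : Nat.card F = q ^ 2) (hq : 0 < q) (hω : IsQuadGen K ω)
    (hv : Submodule.span F (Set.range v) = ⊤) (h : IsCore ω v Γ Y)
    (ho : OffForm v Γ Y) {k : ℕ} (ha : FormAbundant v Γ Y (k + 1))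
    (hk : k + 3 ≤ Module.finrank F (V ⧸ Y)) (hck : q ^ 5 * (3 * q ^ 5 + 1) ≤ k)
    {p₁ p₂ : V} (hp : ∀ s t : F, s • p₁ + t • p₂ = 0 → s = 0 ∧ t = 0)
    (hY : Y = Submodule.span F {p₁, p₂}) (hYΓ : ∀ x ∈ Y, x ∈ Γ) : HasObs K ω v := by
  have : Finite K := Nat.finite_of_card_ne_zero (by omega)
  have : Finite F := Nat.finite_of_card_ne_zero (by rw [hF]; positivity)
  obtain ⟨b, hbΓ, hbY⟩ := exists_notMem_sup_span (Y := Y) (B := ∅) h.spans (by simp; omega)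
  simp only [Finset.coe_empty, Submodule.span_empty, sup_bot_eq] at hbY
  have hbΓ' : ({b} : Set V) ⊆ Γ := by simpa using hbΓ
  have h' := h.sup_span hω hbΓ'
  -- Adjoining `b` costs one unit of abundance, hence the `k + 1`.
  have ha' := ha.sup_span (B := {b}) (by simpa using hbΓ) (by simp)
  rw [Finset.coe_singleton] at ha'
  have hmem : ∀ x ∈ Γ, x ∈ Y ⊔ Submodule.span F {b} →
      ∃ (f₁ f₂ : F) (c : K), f₁ • p₁ + f₂ • p₂ + c • b = x := by
    intro x hxΓ hx
    obtain ⟨y, hy, z, hz, rfl⟩ := Submodule.mem_sup.1 hx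
    obtain ⟨f, rfl⟩ := Submodule.mem_span_singleton.1 hz
    obtain ⟨s, hs⟩ := h.kform.exists_algebraMap_eq hω hbΓ hbY hxΓ (f := f) (by
      rw [sub_add_cancel_right]; exact neg_mem hy)
    rw [hY] at hy
    obtain ⟨f₁, f₂, rfl⟩ := Submodule.mem_span_pair.1 hy
    exact ⟨f₁, f₂, s, by rw [hs, algebraMap_smul]⟩
  have hcard : {x | x ∈ Γ ∧ x ∈ Y ⊔ Submodule.span F {b}}.ncard ≤ q ^ 5 := by
    let g : F × F × K → V := fun z => z.1 • p₁ + z.2.1 • p₂ + z.2.2 • b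
    have h1 : {x | x ∈ Γ ∧ x ∈ Y ⊔ Submodule.span F {b}} ⊆ Set.range g := by
      rintro x ⟨h1, h2⟩
      obtain ⟨f₁, f₂, c, hx⟩ := hmem x h1 h2
      exact ⟨(f₁, f₂, c), hx⟩
    have h2 := Set.ncard_le_ncard h1 (Set.toFinite _)
    have h3 := Finite.card_range_le g
    rw [Nat.card_coe_set_eq, Nat.card_prod, Nat.card_prod, hK, hF] at h3
    calc _ ≤ _ := h2
      _ ≤ _ := h3
      _ = q ^ 5 := by ring
  have hcod : k + 2 ≤ Module.finrank F (V ⧸ Y ⊔ Submodule.span F {b}) := by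
    have h1 := Submodule.finrank_add_le_finrank_add_finrank Y (Submodule.span F {b})
    have h2 := finrank_span_le_card (R := F) ({b} : Set V)
    have h3 := Y.finrank_quotient_add_finrank
    have h4 := (Y ⊔ Submodule.span F {b}).finrank_quotient_add_finrank
    simp at h2
    omega
  obtain ⟨C, hC, hτ⟩ := h'.exists_fill hω hv (ho.mono le_sup_left) ha' hcod hcard hck
  have hsp : Y ⊔ Submodule.span F {b} = Submodule.span F (Set.range ![p₁, p₂, b]) := by
    rw [hY, span_range_triple]
  refine hasObs_of_two_dimensional hω (linearIndependent_triple hp (by rwa [← hY])) (C := C)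
    (by rwa [← hsp]) ?_
  intro f₁ f₂ c _
  have hpY : f₁ • p₁ + f₂ • p₂ ∈ Y := by
    rw [hY, Submodule.mem_span_pair]; exact ⟨_, _, rfl⟩
  refine hτ _ (add_mem (hYΓ _ hpY) (Γ.smul_mem _ hbΓ)) (Submodule.add_mem_sup hpY ?_)
  rw [← algebraMap_smul F c b]
  exact Submodule.smul_mem _ _ (Submodule.mem_span_singleton_self b)

/-- After the contraction of `C`, the form contains a two-dimensional `F`-subspace. -/
theorem IsCore.hasObs_of_contract [Finite V] [Finite E] {q : ℕ} (hK : Nat.card K = q)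
    (hF : Nat.card F = q ^ 2) (hq : 0 < q) (hω : IsQuadGen K ω)
    (hv : Submodule.span F (Set.range v) = ⊤) (h : IsCore ω v Γ Y)
    (ho : OffForm v Γ Y) {k : ℕ} (ha : FormAbundant v Γ Y (k + 1))
    (hk : k + 3 ≤ Module.finrank F (V ⧸ Y)) (hck : q ^ 5 * (3 * q ^ 5 + 1) ≤ k)
    {C : Set E} (hC : ∀ e ∈ C, v e ∈ Y) {p₁ p₂ : V}
    (hp : ∀ s t : F, s • p₁ + t • p₂ ∈ Submodule.span F (v '' C) → s = 0 ∧ t = 0)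
    (h₁ : ∀ f : F, ∃ γ ∈ Γ, f • p₁ - γ ∈ Submodule.span F (v '' C))
    (h₂ : ∀ f : F, ∃ γ ∈ Γ, f • p₂ - γ ∈ Submodule.span F (v '' C)) : HasObs K ω v := by
  have hZY : Submodule.span F (v '' C) ≤ Y := by
    rw [Submodule.span_le]; rintro _ ⟨e, he, rfl⟩; exact hC e he
  -- Both `p` and `ωp` are congruent modulo `Y` to form vectors, which the form property allows only
  -- for vectors of `Y`.
  have hpY : ∀ p : V, (∀ f : F, ∃ γ ∈ Γ, f • p - γ ∈ Submodule.span F (v '' C)) → p ∈ Y := by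
    intro p hp
    obtain ⟨γ, hγ, hγ'⟩ := hp 1
    obtain ⟨δ, hδ, hδ'⟩ := hp ω
    rw [one_smul] at hγ'
    have := (h.kform (-δ) (neg_mem hδ) γ hγ (by
      have := sub_mem (hZY hδ') (Y.smul_mem ω (hZY hγ'))
      convert this using 1
      module)).2
    have h3 := add_mem (hZY hγ') this
    rwa [sub_add_cancel] at h3
  set X := Submodule.span F {p₁, p₂} with hX
  have hXY : X ≤ Y := by
    rw [hX, Submodule.span_le]
    rintro x (rfl | rfl)
    · exact hpY _ h₁
    · exact hpY _ h₂
  have hdis : Disjoint (Submodule.span F (v '' C)) X := by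
    rw [Submodule.disjoint_def]
    intro x hx hxX
    obtain ⟨s, t, rfl⟩ := Submodule.mem_span_pair.1 hxX
    obtain ⟨rfl, rfl⟩ := hp s t hx
    simp
  -- Complete `C` inside `Y` so that contraction reduces `Y` to the image of `X`, which lies
  -- entirely in the form.
  obtain ⟨C₀, hCC₀, hC₀, hdis₀, hle⟩ := exists_disjoint_span_extension v X
    (S₀ := C) (S := {e | v e ∈ Y}) hC hdis
  set Z := Submodule.span F (v '' C₀) with hZ
  have : Finite (V ⧸ Z) := Finite.of_surjective _ Z.mkQ_surjective
  have hZY₀ : Z ≤ Y := by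
    rw [hZ, Submodule.span_le]; rintro _ ⟨e, he, rfl⟩; exact hC₀ he
  have hYZ : Y = X ⊔ Z := le_antisymm (h.gen.trans hle) (sup_le hXY hZY₀)
  have hCZ : Submodule.span F (v '' C) ≤ Z := Submodule.span_mono (Set.image_mono hCC₀)
  have hYm : Y.map Z.mkQ = Submodule.span F {Z.mkQ p₁, Z.mkQ p₂} := by
    rw [hYZ, Submodule.map_sup, Submodule.mkQ_map_self, sup_bot_eq, hX, Submodule.map_span,
      Set.image_pair]
  have hmk : ∀ p : V, (∀ f : F, ∃ γ ∈ Γ, f • p - γ ∈ Submodule.span F (v '' C)) → ∀ f : F,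
      f • Z.mkQ p ∈ Γ.map (Z.mkQ.restrictScalars K) := by
    intro p hp f
    obtain ⟨γ, hγ, hγ'⟩ := hp f
    refine ⟨γ, hγ, ?_⟩
    rw [← map_smul, eq_comm, ← sub_eq_zero]
    change Z.mkQ (f • p) - Z.mkQ γ = 0
    rw [← map_sub, Submodule.mkQ_apply, Submodule.Quotient.mk_eq_zero]
    exact hCZ hγ'
  refine HasObs.of_mkQ hZ ?_
  refine (h.map_mkQ hZY₀).hasObs_of_le hK hF hq hω (span_range_mkQ_comp hv Z) (ho.map_mkQ Z)
    (ha.map_mkQ hZY₀) (by rw [finrank_quotient_map_mkQ hZY₀]; exact hk) hck (p₁ := Z.mkQ p₁)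
    (p₂ := Z.mkQ p₂) ?_ hYm ?_
  · intro s t hst
    rw [← map_smul, ← map_smul, ← map_add, Submodule.mkQ_apply,
      Submodule.Quotient.mk_eq_zero] at hst
    have h0 : s • p₁ + t • p₂ = 0 := by
      rw [Submodule.disjoint_def] at hdis₀
      exact hdis₀ _ hst (Submodule.mem_span_pair.2 ⟨s, t, rfl⟩)
    exact hp s t (by rw [h0]; exact zero_mem _)
  · intro x hx
    rw [hYm] at hx
    obtain ⟨s, t, rfl⟩ := Submodule.mem_span_pair.1 hx
    exact add_mem (hmk _ h₁ s) (hmk _ h₂ t)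

/-- Three vectors on lines of a plane that have no common point. -/
structure IsBadTriple (K : Type*) [Field K] {F : Type*} [Field F] [Algebra K F] (ω : F)
    {V : Type*} [AddCommGroup V] [Module F V] {E : Type*} (v : E → V)
    (q : Fin 3 → V) (x : Fin 3 → E) (g : Fin 3 → Fˣ) (a b : Fin 3 → Fin 3 → K) : Prop where
  eq : ∀ j, (g j : F) • v (x j) = ∑ i, (algebraMap K F (a j i) + ω * algebraMap K F (b j i)) • q i
  li : LinearIndependent F fun j i => algebraMap K F (a j i) + ω * algebraMap K F (b j i)
  li_pair : ∀ j, LinearIndependent K ![a j, b j]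
  inter : ∀ z : Fin 3 → K, (∀ j, z ∈ Submodule.span K {a j, b j}) → z = 0

/-- Contract a complement `Z` of the plane inside `Y`. By `hspec` the contracted elements are in the
form, so `Γ` still maps to a genuine form. There `Γ ∩ Y` is just the `K`-span of the three vectors
`p i`, and filling it supplies all points of the plane. -/
theorem IsCore.hasObs_of_badTriple [Finite V] [Finite E] {q : ℕ} (hK : Nat.card K = q)
    (hq : 0 < q) (hω : IsQuadGen K ω)
    (hv : Submodule.span F (Set.range v) = ⊤) (h : IsCore ω v Γ Y)
    (ho : OffForm v Γ Y) {k : ℕ} (ha : FormAbundant v Γ Y k)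
    (hk : k + 2 ≤ Module.finrank F (V ⧸ Y)) (hck : q ^ 5 * (3 * q ^ 5 + 1) ≤ k)
    (hΓ : KForm ω Γ ⊥) {p : Fin 3 → V} (hpΓ : ∀ i, p i ∈ Γ) (hpY : ∀ i, p i ∈ Y)
    (hp : LinearIndependent F p) {x : Fin 3 → E} {g : Fin 3 → Fˣ} {a b : Fin 3 → Fin 3 → K}
    (hx : IsBadTriple K ω v p x g a b)
    (hspec : ∀ e, v e ∈ Y → v e ∉ Submodule.span F (Set.range p) → InForm F Γ (v e)) :
    HasObs K ω v := by
  have : Finite K := Nat.finite_of_card_ne_zero (by omega)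
  set X := Submodule.span F (Set.range p) with hX
  have hXY : X ≤ Y := by
    rw [hX, Submodule.span_le]; rintro _ ⟨i, rfl⟩; exact hpY i
  obtain ⟨C, -, hCY, hdis, hle⟩ := exists_disjoint_span_extension v X
    (S₀ := ∅) (S := {e | v e ∈ Y}) (Set.empty_subset _) (by simp)
  set Z := Submodule.span F (v '' C) with hZ
  have : Finite (V ⧸ Z) := Finite.of_surjective _ Z.mkQ_surjective
  have hZY : Z ≤ Y := by
    rw [hZ, Submodule.span_le]; rintro _ ⟨e, he, rfl⟩; exact hCY he
  have hYZ : Y = X ⊔ Z := le_antisymm (h.gen.trans hle) (sup_le hXY hZY)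
  rw [Submodule.disjoint_def] at hdis
  have hCΓ : ∀ e ∈ C, InForm F Γ (v e) := by
    intro e he
    by_cases heX : v e ∈ X
    · have h0 := hdis (v e) (Submodule.subset_span ⟨e, he, rfl⟩) heX
      exact ⟨1, one_ne_zero, by rw [h0, smul_zero]; exact zero_mem _⟩
    · exact hspec e (hCY he) heX
  have hZΓ : KForm ω Γ Z := by
    have h1 := hΓ.sup_span hω (S := {y | y ∈ Γ ∧ y ∈ Z}) (fun y hy => hy.1)
    have h2 : Submodule.span F {y | y ∈ Γ ∧ y ∈ Z} = Z := by
      apply le_antisymm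
      · rw [Submodule.span_le]; exact fun y hy => hy.2
      · rw [hZ, Submodule.span_le]
        rintro _ ⟨e, he, rfl⟩
        obtain ⟨f, hf, hfe⟩ := hCΓ e he
        have h3 : f • v e ∈ Submodule.span F {y | y ∈ Γ ∧ y ∈ Z} := Submodule.subset_span
          ⟨hfe, Z.smul_mem _ (Submodule.subset_span ⟨e, he, rfl⟩)⟩
        simpa [smul_smul, hf] using Submodule.smul_mem _ f⁻¹ h3
    rwa [h2, bot_sup_eq] at h1
  have hZΓ' := hZΓ.map_mkQ le_rfl
  rw [Submodule.mkQ_map_self] at hZΓ'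
  have hYm : Y.map Z.mkQ = Submodule.span F (Set.range (Z.mkQ ∘ p)) := by
    rw [hYZ, Submodule.map_sup, Submodule.mkQ_map_self, sup_bot_eq, hX, Submodule.map_span,
      Set.range_comp]
  have hpΓ' : ∀ i, Z.mkQ (p i) ∈ Γ.map (Z.mkQ.restrictScalars K) := fun i => ⟨p i, hpΓ i, rfl⟩
  have hp' : LinearIndependent F (Z.mkQ ∘ p) := by
    refine hp.map ?_
    rw [Submodule.ker_mkQ, disjoint_comm, Submodule.disjoint_def]
    exact fun y hy hyX => hdis y hy hyX
  have hcard : {y | y ∈ Γ.map (Z.mkQ.restrictScalars K) ∧ y ∈ Y.map Z.mkQ}.ncard ≤ q ^ 5 := by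
    let g : (Fin 3 → K) → V ⧸ Z := fun c => ∑ i, c i • Z.mkQ (p i)
    have h1 : {y | y ∈ Γ.map (Z.mkQ.restrictScalars K) ∧ y ∈ Y.map Z.mkQ} ⊆ Set.range g := by
      rintro y ⟨hy1, hy2⟩
      rw [hYm] at hy2
      obtain ⟨c, hc, d, hd, rfl⟩ := hω.exists_of_mem_span hy2
      have hle : Submodule.span K (Set.range (Z.mkQ ∘ p)) ≤ Γ.map (Z.mkQ.restrictScalars K) := by
        rw [Submodule.span_le]; rintro _ ⟨i, rfl⟩; exact hpΓ' i
      have h2 := hZΓ' (c - (c + ω • d)) (sub_mem (hle hc) hy1) d (hle hd) (by simp)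
      have h3 : c + ω • d = c := by
        have := h2.1
        rw [Submodule.mem_bot, sub_eq_zero] at this
        exact this.symm
      rw [h3]
      obtain ⟨s, hs⟩ := (Submodule.mem_span_range_iff_exists_fun K).1 hc
      exact ⟨s, hs⟩
    have h2 := Set.ncard_le_ncard h1 (Set.toFinite _)
    have h3 := Finite.card_range_le g
    rw [Nat.card_coe_set_eq, Nat.card_fun, hK, Nat.card_eq_fintype_card, Fintype.card_fin] at h3
    -- Only q³ vectors need filling; the bound is weakened to q⁵ so that one numerical hypothesis
    -- serves both obstructions.
    exact h2.trans (h3.trans (Nat.pow_le_pow_right hq (by norm_num)))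
  obtain ⟨C', hC', hτ⟩ := (h.map_mkQ hZY).exists_fill hω (span_range_mkQ_comp hv Z)
    (ho.map_mkQ Z) (ha.map_mkQ hZY) (by rw [finrank_quotient_map_mkQ hZY]; exact hk) hcard hck
  refine HasObs.of_mkQ hZ ?_
  refine hasObs_of_isCompl hp' (C := C') (by rwa [← hYm]) ?_ x g a b ?_ hx.li hx.li_pair
    hx.inter
  · intro c _
    simp only [algebraMap_smul]
    refine hτ _ (Submodule.sum_mem _ fun i _ => Submodule.smul_mem _ _ (hpΓ' i)) ?_
    rw [hYm]
    refine Submodule.sum_mem _ fun i _ => ?_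
    rw [← algebraMap_smul F]
    exact Submodule.smul_mem _ _ (Submodule.subset_span ⟨i, rfl⟩)
  · intro j
    rw [Function.comp_apply, ← map_smul, hx.eq j]
    simp only [Function.comp_apply, map_sum, map_smul, sub_self, zero_mem]

/-- The version of `IsCore.hasObs_of_contract` when all points of the form are present. -/
theorem hasObs_of_contract_of_full [Finite V] [Finite E] (hω : IsQuadGen K ω)
    (hv : Submodule.span F (Set.range v) = ⊤) (h : IsCore ω v Γ ⊥)
    {C : Set E} (hC : Module.finrank F (Submodule.span F (v '' C)) + 3 ≤ Module.finrank F V)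
    {p₁ p₂ : V}
    (hp : ∀ s t : F, s • p₁ + t • p₂ ∈ Submodule.span F (v '' C) → s = 0 ∧ t = 0)
    (h₁ : ∀ f : F, ∃ γ ∈ Γ, f • p₁ - γ ∈ Submodule.span F (v '' C))
    (h₂ : ∀ f : F, ∃ γ ∈ Γ, f • p₂ - γ ∈ Submodule.span F (v '' C)) : HasObs K ω v := by
  classical
  set Z := Submodule.span F (v '' C) with hZ
  have hcod : 3 ≤ Module.finrank F (V ⧸ Z) := by
    have := Z.finrank_quotient_add_finrank
    omega
  have hlt : ({p₁, p₂} : Finset V).card < Module.finrank F (V ⧸ Z) := by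
    have := Finset.card_le_two (a := p₁) (b := p₂)
    omega
  -- Codimension three leaves room for a form vector independent of `p₁` and `p₂` modulo `Z`.
  obtain ⟨b, hbΓ, hb⟩ := exists_notMem_sup_span (Y := Z) h.spans hlt
  have hb' : Z.mkQ b ∉ Submodule.span F {Z.mkQ p₁, Z.mkQ p₂} := by
    intro hmem
    apply hb
    rw [← Set.image_pair, ← Submodule.map_span, ← Submodule.mem_comap,
      Submodule.comap_map_mkQ] at hmem
    simpa using hmem
  have hli := linearIndependent_triple (F := F) (p₁ := Z.mkQ p₁) (p₂ := Z.mkQ p₂) (b := Z.mkQ b) (by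
    intro s t hst
    rw [← map_smul, ← map_smul, ← map_add, Submodule.mkQ_apply,
      Submodule.Quotient.mk_eq_zero] at hst
    exact hp s t hst) hb'
  obtain ⟨C', -, hC'⟩ := exists_isCompl_span (span_range_mkQ_comp hv Z)
    (Submodule.span F (Set.range ![Z.mkQ p₁, Z.mkQ p₂, Z.mkQ b])) (S₀ := ∅) (by simp)
  refine HasObs.of_mkQ hZ (hasObs_of_two_dimensional hω hli hC' ?_)
  intro f₁ f₂ c hne
  obtain ⟨γ₁, hγ₁, h1⟩ := h₁ f₁
  obtain ⟨γ₂, hγ₂, h2⟩ := h₂ f₂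
  have hmk : f₁ • Z.mkQ p₁ + f₂ • Z.mkQ p₂ + c • Z.mkQ b = Z.mkQ (γ₁ + γ₂ + c • b) := by
    have e1 : f₁ • Z.mkQ p₁ = Z.mkQ γ₁ := by
      rw [← map_smul, ← sub_eq_zero, ← map_sub, Submodule.mkQ_apply,
        Submodule.Quotient.mk_eq_zero]
      exact h1
    have e2 : f₂ • Z.mkQ p₂ = Z.mkQ γ₂ := by
      rw [← map_smul, ← sub_eq_zero, ← map_sub, Submodule.mkQ_apply,
        Submodule.Quotient.mk_eq_zero]
      exact h2
    rw [e1, e2, map_add, map_add]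
    rfl
  rw [hmk] at hne ⊢
  obtain ⟨e, f, hf, he⟩ := h.full (γ₁ + γ₂ + c • b)
    (add_mem (add_mem hγ₁ hγ₂) (Γ.smul_mem _ hbΓ)) (by
      rw [Submodule.mem_bot]
      intro h0
      rw [h0, map_zero] at hne
      exact hne rfl)
  rw [Submodule.mem_bot, sub_eq_zero] at he
  refine ⟨e, f, hf, ?_⟩
  rw [← he]
  simp

theorem hasObs_of_badTriple_of_full [Finite V] [Finite E]
    (hv : Submodule.span F (Set.range v) = ⊤) (h : IsCore ω v Γ ⊥)
    {p : Fin 3 → V} (hpΓ : ∀ i, p i ∈ Γ)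
    (hp : LinearIndependent F p) {x : Fin 3 → E} {g : Fin 3 → Fˣ} {a b : Fin 3 → Fin 3 → K}
    (hx : IsBadTriple K ω v p x g a b) : HasObs K ω v := by
  obtain ⟨C, -, hC⟩ := exists_isCompl_span hv (Submodule.span F (Set.range p)) (S₀ := ∅) (by simp)
  refine hasObs_of_isCompl hp hC ?_ x g a b ?_ hx.li hx.li_pair hx.inter
  · intro c hc
    obtain ⟨e, f, hf, he⟩ := h.full (∑ i, algebraMap K F (c i) • p i)
      (Submodule.sum_mem _ fun i _ => by rw [algebraMap_smul]; exact Γ.smul_mem _ (hpΓ i)) (by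
        rw [Submodule.mem_bot]
        intro h0
        apply hc
        ext i
        simpa using Fintype.linearIndependent_iff.1 hp _ h0 i)
    rw [Submodule.mem_bot] at he
    exact ⟨e, f, hf, by rw [he]; exact zero_mem _⟩
  · intro j
    rw [hx.eq j]
    simp

end FrameObstructions

/-! ### Geometry of the special lines -/

section Structure

variable {K : Type*} [Field K] {F : Type*} [Field F] [Algebra K F]
  {V : Type*} [AddCommGroup V] [Module K V] [Module F V] [IsScalarTower K F V] {E : Type*}

/-- The vectors `v e` are multiples of vectors of a `K`-form extended by all multiples of `p`. -/
def IsHat (K : Type*) [Field K] {F : Type*} [Field F] [Algebra K F] (ω : F)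
    {V : Type*} [AddCommGroup V] [Module K V] [Module F V] {E : Type*} (v : E → V) : Prop :=
  ∃ p : V, p ≠ 0 ∧ ∃ Γ : Submodule K V, (∀ f : F, f • p ∈ Γ) ∧ Spans ω Γ ∧
    KForm ω Γ (Submodule.span F {p}) ∧ ∀ e, InForm F Γ (v e)

/-- The vectors `v e` are multiples of vectors of a `K`-form or lie on one special line. -/
def IsBar (K : Type*) [Field K] {F : Type*} [Field F] [Algebra K F] (ω : F)
    {V : Type*} [AddCommGroup V] [Module K V] [Module F V] {E : Type*} (v : E → V) : Prop :=
  ∃ Γ : Submodule K V, Spans ω Γ ∧ KForm ω Γ ⊥ ∧ ∃ a ∈ Γ, ∃ b ∈ Γ, ∃ c ∈ Γ,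
    LinearIndependent K ![a, b, c] ∧
    ∀ e, InForm F Γ (v e) ∨ v e ∈ Submodule.span F {a + ω • b, c}

variable {ω : F} {v : E → V} {Γ : Submodule K V}

theorem inForm_of_eq_smul {x γ : V} (hγ : γ ∈ Γ) (f : F) (hx : x = f • γ) : InForm F Γ x := by
  by_cases hf : f = 0
  · exact ⟨1, one_ne_zero, by rw [hx, hf]; simp⟩
  · exact ⟨f⁻¹, inv_ne_zero hf, by rwa [hx, inv_smul_smul₀ hf]⟩

theorem InForm.mono {Γ' : Submodule K V} {x : V} (h : InForm F Γ x) (hle : Γ ≤ Γ') :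
    InForm F Γ' x :=
  let ⟨f, hf, hx⟩ := h
  ⟨f, hf, hle hx⟩

theorem smul_mem_of_smul_mem (hω : IsQuadGen K ω) {x : V} (hx : x ∈ Γ) (hx' : ω • x ∈ Γ) (f : F) :
    f • x ∈ Γ := by
  obtain ⟨s, t, hst, -⟩ := hω.exists_smul_eq V f
  rw [hst, smul_comm_tower]
  exact add_mem (Γ.smul_mem _ hx) (Γ.smul_mem _ hx')

/-- If `a` and `b` were dependent, `a + ωb` would be a multiple of one of them. So a special element
determines a line of `Γ`. -/
theorem Spans.exists_line (hs : Spans ω Γ) {x : V} (hx : ¬ InForm F Γ x) :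
    ∃ a ∈ Γ, ∃ b ∈ Γ, x = a + ω • b ∧ LinearIndependent K ![a, b] := by
  obtain ⟨a, ha, b, hb, rfl⟩ := hs x
  refine ⟨a, ha, b, hb, rfl, ?_⟩
  by_cases ha0 : a = 0
  · exact absurd (inForm_of_eq_smul hb ω (by rw [ha0, zero_add])) hx
  rw [LinearIndependent.pair_iff' ha0]
  intro s hsb
  refine hx (inForm_of_eq_smul ha (1 + ω * algebraMap K F s) ?_)
  rw [← hsb, add_smul, one_smul, mul_smul, algebraMap_smul]

theorem span_pair_eq_of_mem {a b x y : V} (hx : x ∈ Submodule.span K {a, b})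
    (hy : y ∈ Submodule.span K {a, b}) (hxy : LinearIndependent K ![x, y]) :
    Submodule.span K {a, b} = Submodule.span K {x, y} := by
  classical
  symm
  have : FiniteDimensional K (Submodule.span K {a, b}) :=
    FiniteDimensional.span_of_finite K (Set.toFinite _)
  apply Submodule.eq_of_le_of_finrank_le
  · rw [Submodule.span_le]
    rintro z (rfl | rfl)
    · exact hx
    · exact hy
  · have h1 := finrank_span_eq_card hxy
    rw [Matrix.range_cons_cons_empty, Fintype.card_fin] at h1
    rw [h1]
    have h2 := finrank_span_le_card (R := K) ({a, b} : Set V)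
    refine h2.trans ?_
    rw [Set.toFinset_insert, Set.toFinset_singleton]
    exact Finset.card_le_two

/-- In terms of `p` and `r` the vector is `αp + βr`. Here `β = 0` would put it in the form, and so
would a ratio `α/β` in `K`. -/
theorem exists_normal_form (hω : IsQuadGen K ω) {a b x p r : V} (hx : ¬ InForm F Γ x)
    (hxab : x = a + ω • b) (hpr : Submodule.span K {a, b} = Submodule.span K {p, r})
    (hp : p ∈ Γ) (hr : r ∈ Γ) :
    ∃ (g : Fˣ) (s t : K), t ≠ 0 ∧
      (g : F) • x = (algebraMap K F s + ω * algebraMap K F t) • p + r := by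
  have ha : a ∈ Submodule.span K {p, r} := hpr ▸ Submodule.subset_span (by simp)
  have hb : b ∈ Submodule.span K {p, r} := hpr ▸ Submodule.subset_span (by simp)
  obtain ⟨a₀, a₁, rfl⟩ := Submodule.mem_span_pair.1 ha
  obtain ⟨b₀, b₁, rfl⟩ := Submodule.mem_span_pair.1 hb
  set α := algebraMap K F a₀ + ω * algebraMap K F b₀ with hα
  set β := algebraMap K F a₁ + ω * algebraMap K F b₁ with hβ
  have hx' : x = α • p + β • r := by
    rw [hxab, hα, hβ]
    simp only [← algebraMap_smul F (_ : K) (_ : V)]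
    module
  have hβ0 : β ≠ 0 := fun h0 => hx (inForm_of_eq_smul hp α (by rw [hx', h0, zero_smul, add_zero]))
  obtain ⟨s, t, hst⟩ := hω.2 (β⁻¹ * α)
  have hg : β⁻¹ • x = (algebraMap K F s + ω * algebraMap K F t) • p + r := by
    rw [hx', smul_add, smul_smul, inv_smul_smul₀ hβ0, hst]
  refine ⟨(Units.mk0 β hβ0)⁻¹, s, t, ?_, by simpa using hg⟩
  rintro rfl
  refine hx ⟨β⁻¹, inv_ne_zero hβ0, ?_⟩
  rw [hg, map_zero, mul_zero, add_zero, algebraMap_smul]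
  exact add_mem (Γ.smul_mem _ hp) hr

/-- Adjoin all multiples of `p` to `Γ`. A vector whose line passes through `p` is, up to a scalar, a
vector of `Γ` plus a multiple of `p`. -/
theorem isHat_of_concurrent (hω : IsQuadGen K ω) (hs : Spans ω Γ) (hf : KForm ω Γ ⊥) {p : V}
    (hp : p ≠ 0) (hpΓ : p ∈ Γ)
    (h : ∀ e, ¬ InForm F Γ (v e) → ∃ a ∈ Γ, ∃ b ∈ Γ, v e = a + ω • b ∧ p ∈ Submodule.span K {a, b}) :
    IsHat K ω v := by
  have hpf : KForm ω Γ (Submodule.span F {p}) := by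
    have := hf.sup_span hω (S := {p}) (by simpa using hpΓ)
    rwa [bot_sup_eq] at this
  set Γ' := Γ ⊔ (Submodule.span F {p}).restrictScalars K with hΓ'
  have hle : Γ ≤ Γ' := le_sup_left
  have hpm : ∀ y ∈ Submodule.span F {p}, y ∈ Γ' := fun y hy => Submodule.mem_sup_right hy
  refine ⟨p, hp, Γ', fun f => hpm _ (Submodule.smul_mem _ _ (Submodule.mem_span_singleton_self p)),
    hs.mono hle, ?_, ?_⟩
  · intro a ha b hb hab
    obtain ⟨a, ha', y, hy, rfl⟩ := Submodule.mem_sup.1 ha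
    obtain ⟨b, hb', z, hz, rfl⟩ := Submodule.mem_sup.1 hb
    rw [Submodule.restrictScalars_mem] at hy hz
    obtain ⟨h1, h2⟩ := hpf a ha' b hb' (by
      have := sub_mem hab (add_mem hy (Submodule.smul_mem _ ω hz))
      convert this using 1
      rw [smul_add]; abel)
    exact ⟨add_mem h1 hy, add_mem h2 hz⟩
  · intro e
    by_cases he : InForm F Γ (v e)
    · exact he.mono hle
    obtain ⟨a, ha, b, hb, hab, hpab⟩ := h e he
    obtain ⟨s, t, rfl⟩ := Submodule.mem_span_pair.1 hpab
    rw [hab]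
    by_cases ht : t = 0
    · have hs0 : s ≠ 0 := by rintro rfl; simp [ht] at hp
      have hω0 : ω ≠ 0 := by rintro rfl; exact hω.1 ⟨0, map_zero _⟩
      refine ⟨ω⁻¹, inv_ne_zero hω0, ?_⟩
      rw [smul_add, inv_smul_smul₀ hω0]
      refine add_mem (hpm _ ?_) (hle hb)
      refine Submodule.mem_span_singleton.2 ⟨ω⁻¹ * algebraMap K F s⁻¹, ?_⟩
      rw [ht, zero_smul, add_zero, mul_smul, algebraMap_smul, inv_smul_smul₀ hs0]
    -- With `p = sa + tb`, eliminating `b` gives `a + ωb = g a + ωt⁻¹ p`.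
    · set g := 1 + ω * algebraMap K F (-(t⁻¹ * s)) with hg
      have hg0 : g ≠ 0 := by
        intro h0
        rw [hg, ← map_one (algebraMap K F)] at h0
        exact one_ne_zero (hω.eq_zero h0).1
      have hb' : b = t⁻¹ • (s • a + t • b) + (-(t⁻¹ * s)) • a := by
        rw [smul_add, smul_smul, inv_smul_smul₀ ht, neg_smul]; abel
      refine ⟨g⁻¹, inv_ne_zero hg0, ?_⟩
      have : g⁻¹ • (a + ω • b) = a + (g⁻¹ * ω * algebraMap K F t⁻¹) • (s • a + t • b) := by
        have h1 : a + ω • b = g • a + (ω * algebraMap K F t⁻¹) • (s • a + t • b) := by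
          conv_lhs => rw [hb']
          rw [hg, add_smul, one_smul, mul_smul, mul_smul, algebraMap_smul, algebraMap_smul, smul_add]
          abel
        rw [h1, smul_add, inv_smul_smul₀ hg0, smul_smul, mul_assoc]
      rw [this]
      exact add_mem (hle ha) (hpm _ (Submodule.smul_mem _ _ (Submodule.mem_span_singleton_self _)))

theorem linearIndependent_pair_of_notMem {x y : V} (hx : x ≠ 0) (hy : y ∉ Submodule.span K {x}) :
    LinearIndependent K ![x, y] := by
  rw [LinearIndependent.pair_iff' hx]
  intro s hs
  exact hy (hs ▸ Submodule.smul_mem _ _ (Submodule.mem_span_singleton_self x))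

theorem mem_of_not_linearIndependent {x y : V} (hx : x ≠ 0) (hy : y ≠ 0)
    (h : ¬ LinearIndependent K ![x, y]) {L : Submodule K V} : x ∈ L ↔ y ∈ L := by
  rw [LinearIndependent.pair_iff' hx] at h
  push Not at h
  obtain ⟨s, rfl⟩ := h
  have hs : s ≠ 0 := by rintro rfl; simp at hy
  exact (L.smul_mem_iff hs).symm

/-- Three lines without a common point that meet pairwise are the sides of a triangle. -/
theorem triangle_of_not_concurrent {a b : Fin 3 → V} {p q r : V} (hp : p ≠ 0) (hq : q ≠ 0)
    (hr : r ≠ 0)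
    (hp0 : p ∈ Submodule.span K {a 0, b 0}) (hp1 : p ∈ Submodule.span K {a 1, b 1})
    (hq0 : q ∈ Submodule.span K {a 0, b 0}) (hq2 : q ∈ Submodule.span K {a 2, b 2})
    (hr1 : r ∈ Submodule.span K {a 1, b 1}) (hr2 : r ∈ Submodule.span K {a 2, b 2})
    (h : ∀ z, (∀ j, z ∈ Submodule.span K {a j, b j}) → z = 0) :
    Submodule.span K {a 0, b 0} = Submodule.span K {p, q} ∧
    Submodule.span K {a 1, b 1} = Submodule.span K {p, r} ∧
    Submodule.span K {a 2, b 2} = Submodule.span K {q, r} ∧ LinearIndependent K ![p, q, r] := by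
  have h' : ∀ z, z ≠ 0 → z ∈ Submodule.span K {a 0, b 0} → z ∈ Submodule.span K {a 1, b 1} →
      z ∉ Submodule.span K {a 2, b 2} := by
    intro z hz h0 h1 h2
    exact hz (h z fun j => by fin_cases j <;> assumption)
  have hpq : LinearIndependent K ![p, q] := by
    by_contra hcon
    exact h' p hp hp0 hp1 ((mem_of_not_linearIndependent hp hq hcon).2 hq2)
  have hpr : LinearIndependent K ![p, r] := by
    by_contra hcon
    exact h' p hp hp0 hp1 ((mem_of_not_linearIndependent hp hr hcon).2 hr2)
  have hqr : LinearIndependent K ![q, r] := by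
    by_contra hcon
    exact h' q hq hq0 ((mem_of_not_linearIndependent hq hr hcon).2 hr1) hq2
  have e0 := span_pair_eq_of_mem hp0 hq0 hpq
  refine ⟨e0, span_pair_eq_of_mem hp1 hr1 hpr, span_pair_eq_of_mem hq2 hr2 hqr, ?_⟩
  refine linearIndependent_triple (LinearIndependent.pair_iff.1 hpq) ?_
  rw [← e0]
  exact fun hr0 => h' r hr hr0 hr1 hr2

theorem le_span_range_triangle {a b : Fin 3 → V} {p q r : V}
    (h₀ : Submodule.span K {a 0, b 0} = Submodule.span K {p, q})
    (h₁ : Submodule.span K {a 1, b 1} = Submodule.span K {p, r})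
    (h₂ : Submodule.span K {a 2, b 2} = Submodule.span K {q, r}) (j : Fin 3) :
    Submodule.span K {a j, b j} ≤ Submodule.span K (Set.range ![p, q, r]) := by
  have hp : p ∈ Set.range ![p, q, r] := ⟨0, rfl⟩
  have hq : q ∈ Set.range ![p, q, r] := ⟨1, rfl⟩
  have hr : r ∈ Set.range ![p, q, r] := ⟨2, rfl⟩
  have e₀ : Submodule.span K {a 0, b 0} ≤ Submodule.span K (Set.range ![p, q, r]) := by
    rw [h₀]; exact Submodule.span_mono (Set.pair_subset hp hq)
  have e₁ : Submodule.span K {a 1, b 1} ≤ Submodule.span K (Set.range ![p, q, r]) := by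
    rw [h₁]; exact Submodule.span_mono (Set.pair_subset hp hr)
  have e₂ : Submodule.span K {a 2, b 2} ≤ Submodule.span K (Set.range ![p, q, r]) := by
    rw [h₂]; exact Submodule.span_mono (Set.pair_subset hq hr)
  fin_cases j
  · exact e₀
  · exact e₁
  · exact e₂

/-- The three lines have no common point, so the meeting points cannot all coincide; two distinct
ones determine the fourth line. -/
theorem le_of_meets_triangle {a b : Fin 3 → V} {c d r₀ r₁ r₂ : V} (h₀ : r₀ ≠ 0) (h₁ : r₁ ≠ 0)
    (h₂ : r₂ ≠ 0)
    (hr₀ : r₀ ∈ Submodule.span K {a 0, b 0}) (hr₁ : r₁ ∈ Submodule.span K {a 1, b 1})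
    (hr₂ : r₂ ∈ Submodule.span K {a 2, b 2}) (hr₀' : r₀ ∈ Submodule.span K {c, d})
    (hr₁' : r₁ ∈ Submodule.span K {c, d}) (hr₂' : r₂ ∈ Submodule.span K {c, d})
    (h : ∀ z, (∀ j, z ∈ Submodule.span K {a j, b j}) → z = 0) {Q : Submodule K V}
    (hQ : ∀ j, Submodule.span K {a j, b j} ≤ Q) : Submodule.span K {c, d} ≤ Q := by
  by_cases h01 : LinearIndependent K ![r₀, r₁]
  · rw [span_pair_eq_of_mem hr₀' hr₁' h01, Submodule.span_le]
    rintro z (rfl | rfl)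
    · exact hQ 0 hr₀
    · exact hQ 1 hr₁
  by_cases h02 : LinearIndependent K ![r₀, r₂]
  · rw [span_pair_eq_of_mem hr₀' hr₂' h02, Submodule.span_le]
    rintro z (rfl | rfl)
    · exact hQ 0 hr₀
    · exact hQ 2 hr₂
  refine absurd (h r₀ fun j => ?_) h₀
  fin_cases j
  · exact hr₀
  · exact (mem_of_not_linearIndependent h₀ h₁ h01).2 hr₁
  · exact (mem_of_not_linearIndependent h₀ h₂ h02).2 hr₂

/-- The hypothesis that no contraction of special elements produces a two-dimensional `F`-subspace
inside the form. -/
def NoPlane (v : E → V) (Γ : Submodule K V) (F : Type*) [Field F] [Module F V] : Prop :=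
  ∀ C : Set E, (∀ e ∈ C, ¬ InForm F Γ (v e)) →
    Module.finrank F (Submodule.span F (v '' C)) ≤ 2 → ∀ p₁ p₂ : V,
    (∀ s t : F, s • p₁ + t • p₂ ∈ Submodule.span F (v '' C) → s = 0 ∧ t = 0) →
    (∀ f : F, ∃ γ ∈ Γ, f • p₁ - γ ∈ Submodule.span F (v '' C)) →
    (∀ f : F, ∃ γ ∈ Γ, f • p₂ - γ ∈ Submodule.span F (v '' C)) → False

/-- Modulo `a + ωb`, the vector `ωb` equals `-a`. Hence contracting a special element puts the whole
`F`-line of `b` into the form. -/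
theorem exists_sub_mem_of_line (hω : IsQuadGen K ω) {Z : Submodule F V} {a b : V} (ha : a ∈ Γ)
    (hb : b ∈ Γ) (hZ : a + ω • b ∈ Z) (f : F) : ∃ γ ∈ Γ, f • b - γ ∈ Z := by
  obtain ⟨s, t, hst, -⟩ := hω.exists_smul_eq V f
  refine ⟨s • b - t • a, sub_mem (Γ.smul_mem _ hb) (Γ.smul_mem _ ha), ?_⟩
  have h1 : f • b - (s • b - t • a) = algebraMap K F t • (a + ω • b) := by
    rw [hst, algebraMap_smul, smul_add, smul_comm_tower ω t b]
    abel
  rw [h1]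
  exact Z.smul_mem _ hZ

/-- If `Γ` is not a genuine form, then `b` and `ωb` lie in `Γ` for some `b ≠ 0`, so `Γ` contains an
`F`-line ⟨p⟩. By `NoPlane` it is the only one, and `Γ` is a form modulo `p`. A special element would
create a second `F`-line when contracted. -/
theorem NoPlane.kform_or_isHat (hω : IsQuadGen K ω) (hs : Spans ω Γ) (hA : NoPlane v Γ F) :
    KForm ω Γ ⊥ ∨ IsHat K ω v := by
  by_cases hU : ∃ p : V, p ≠ 0 ∧ ∀ f : F, f • p ∈ Γ
  swap
  · left
    intro a ha b hb hab
    rw [Submodule.mem_bot] at hab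
    have hb0 : b = 0 := by
      by_contra hb0
      refine hU ⟨b, hb0, smul_mem_of_smul_mem hω hb ?_⟩
      rw [add_comm, ← eq_neg_iff_add_eq_zero] at hab
      rw [hab]
      exact neg_mem ha
    rw [hb0, smul_zero, add_zero] at hab
    rw [Submodule.mem_bot, Submodule.mem_bot]
    exact ⟨hab, hb0⟩
  right
  obtain ⟨p, hp, hpΓ⟩ := hU
  have hU : ∀ y, (∀ f : F, f • y ∈ Γ) → y ∈ Submodule.span F {p} := by
    intro y hy
    by_contra hyp
    have hli := LinearIndependent.pair_iff.1 (linearIndependent_pair_of_notMem hp hyp)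
    refine hA ∅ (fun e he => he.elim)
      (by rw [Set.image_empty, Submodule.span_empty, finrank_bot]; norm_num) p y ?_ (fun f => ⟨_, hpΓ f, by simp⟩)
      (fun f => ⟨_, hy f, by simp⟩)
    simpa using hli
  have hpf : KForm ω Γ (Submodule.span F {p}) := by
    intro a ha b hb hab
    have hb' : b ∈ Submodule.span F {p} := by
      refine hU b (smul_mem_of_smul_mem hω hb ?_)
      obtain ⟨f, hf⟩ := Submodule.mem_span_singleton.1 hab
      have := sub_mem (hpΓ f) ha
      rwa [hf, add_sub_cancel_left] at this
    refine ⟨?_, hb'⟩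
    have := sub_mem hab (Submodule.smul_mem _ ω hb')
    rwa [add_sub_cancel_right] at this
  refine ⟨p, hp, Γ, hpΓ, hs, hpf, fun e => ?_⟩
  by_contra he
  obtain ⟨a, ha, b, hb, hab, -⟩ := hs.exists_line he
  have hbp : b ∉ Submodule.span F {p} := by
    intro hbp
    obtain ⟨f, rfl⟩ := Submodule.mem_span_singleton.1 hbp
    refine he ⟨1, one_ne_zero, ?_⟩
    rw [one_smul, hab, smul_smul]
    exact add_mem ha (hpΓ _)
  refine hA {e} (by simpa using he) ?_ p b ?_ (fun f => ⟨_, hpΓ f, by simp⟩)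
    (exists_sub_mem_of_line hω ha hb (by rw [← hab]; exact Submodule.subset_span (by simp)))
  · rw [Set.image_singleton]
    have h2 := finrank_span_le_card (R := F) ({v e} : Set V)
    simp only [Set.toFinset_singleton, Finset.card_singleton] at h2
    omega
  · intro s t hst
    rw [Set.image_singleton, Submodule.mem_span_singleton] at hst
    obtain ⟨c, hc⟩ := hst
    by_cases hc0 : c = 0
    · rw [hc0, zero_smul] at hc
      exact LinearIndependent.pair_iff.1 (linearIndependent_pair_of_notMem hp hbp) s t hc.symm
    -- Here the two `F`-lines coincide modulo `v e`. Then `v e` is a combination of `p` and `b`;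
    -- comparing components modulo `p` gives `v e = f p + (t₀ + ω) b`, which is in the form.
    exfalso
    have h1 : v e = (c⁻¹ * s) • p + (c⁻¹ * t) • b := by
      rw [mul_smul, mul_smul, ← smul_add, ← hc, inv_smul_smul₀ hc0]
    obtain ⟨t₀, t₁, ht, ht'⟩ := hω.exists_smul_eq V (c⁻¹ * t)
    obtain ⟨h2, h3⟩ := hpf (a - t₀ • b) (sub_mem ha (Γ.smul_mem _ hb)) ((1 - t₁) • b)
      (Γ.smul_mem _ hb) (by
        refine Submodule.mem_span_singleton.2 ⟨c⁻¹ * s, ?_⟩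
        rw [eq_comm, ← sub_eq_zero] at h1 ⊢
        rw [hab, ht] at h1
        rw [sub_smul, one_smul, smul_sub]
        rw [← neg_eq_zero, ← h1]
        abel)
    obtain ⟨f, hf⟩ := Submodule.mem_span_singleton.1 h2
    have ht1 : t₁ = 1 := by
      by_contra ht1
      have h4 : algebraMap K F (1 - t₁) ≠ 0 := 
        (map_ne_zero _).2 (sub_ne_zero.2 (Ne.symm ht1))
      rw [← algebraMap_smul F] at h3
      exact hbp ((Submodule.smul_mem_iff _ h4).1 h3)
    have hne : algebraMap K F t₀ + ω ≠ 0 := by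
      intro h0
      exact one_ne_zero (hω.eq_zero (s := t₀) (t := 1) (by rwa [map_one, mul_one])).2
    refine he ⟨(algebraMap K F t₀ + ω)⁻¹, inv_ne_zero hne, ?_⟩
    have h5 : v e = f • p + (algebraMap K F t₀ + ω) • b := by
      rw [hab, hf, add_smul, algebraMap_smul]; abel
    rw [h5, smul_add, inv_smul_smul₀ hne, smul_smul]
    exact add_mem (hpΓ _) hb

/-- If two special lines did not meet, `a, b, a', b'` would be `F`-independent, and contracting both
elements would put the independent `F`-lines of `b` and `b'` into the form. -/
theorem NoPlane.exists_mem_inf (hω : IsQuadGen K ω) (hf : KForm ω Γ ⊥) (hA : NoPlane v Γ F)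
    {e e' : E} (he : ¬ InForm F Γ (v e)) (he' : ¬ InForm F Γ (v e')) {a b a' b' : V}
    (ha : a ∈ Γ) (hb : b ∈ Γ) (ha' : a' ∈ Γ) (hb' : b' ∈ Γ) (hab : v e = a + ω • b)
    (hab' : v e' = a' + ω • b') (hli : LinearIndependent K ![a, b])
    (hli' : LinearIndependent K ![a', b']) :
    ∃ p, p ≠ 0 ∧ p ∈ Submodule.span K {a, b} ∧ p ∈ Submodule.span K {a', b'} := by
  classical
  by_contra hcon
  push Not at hcon
  have h4 : LinearIndependent K (Sum.elim ![a, b] ![a', b']) := by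
    refine hli.sum_type hli' ?_
    rw [Matrix.range_cons_cons_empty, Matrix.range_cons_cons_empty, Submodule.disjoint_def]
    intro x hx hx'
    by_contra hx0
    exact hcon x hx0 hx hx'
  have h5 := hf.linearIndependent hω (b := Sum.elim ![a, b] ![a', b']) (by
    rintro (i | i) <;> fin_cases i <;> simpa) h4
  rw [Fintype.linearIndependent_iff] at h5
  refine hA {e, e'} (by rintro x (rfl | rfl) <;> assumption) ?_ b b' ?_
    (exists_sub_mem_of_line hω ha hb (by rw [← hab]; exact Submodule.subset_span (by simp)))
    (exists_sub_mem_of_line hω ha' hb' (by rw [← hab']; exact Submodule.subset_span (by simp)))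
  · rw [Set.image_pair]
    have h2 := finrank_span_le_card (R := F) ({v e, v e'} : Set V)
    refine h2.trans ?_
    rw [Set.toFinset_insert, Set.toFinset_singleton]
    exact Finset.card_le_two
  · intro s t hst
    rw [Set.image_pair] at hst
    obtain ⟨c, d, hcd⟩ := Submodule.mem_span_pair.1 hst
    have h6 := h5 (Sum.elim ![c, c * ω - s] ![d, d * ω - t]) (by
      simp only [Fintype.sum_sum_type, Fin.sum_univ_two, Sum.elim_inl, Sum.elim_inr,
        Matrix.cons_val_zero, Matrix.cons_val_one]
      rw [hab, hab', ← sub_eq_zero] at hcd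
      rw [← hcd]
      module)
    have h7 := h6 (Sum.inl 0)
    have h8 := h6 (Sum.inl 1)
    have h9 := h6 (Sum.inr 0)
    have h10 := h6 (Sum.inr 1)
    simp only [Sum.elim_inl, Sum.elim_inr, Matrix.cons_val_zero, Matrix.cons_val_one] at h7 h8 h9 h10
    rw [h7, zero_mul, zero_sub, neg_eq_zero] at h8
    rw [h9, zero_mul, zero_sub, neg_eq_zero] at h10
    exact ⟨h8, h10⟩

/-- The hypothesis that no three special elements form a bad triple in a plane containing all special
elements. -/
def NoBadTriple (ω : F) (v : E → V) (Γ : Submodule K V) : Prop :=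
  ∀ (p : Fin 3 → V) (x : Fin 3 → E) (g : Fin 3 → Fˣ) (a b : Fin 3 → Fin 3 → K),
    (∀ i, p i ∈ Γ) → LinearIndependent F p → IsBadTriple K ω v p x g a b →
    (∀ j, ¬ InForm F Γ (v (x j))) →
    (∀ e, ¬ InForm F Γ (v e) → v e ∈ Submodule.span F (Set.range p)) → False

/-- Up to sign the expression is the determinant of the three special vectors in the basis `p, q,
r`. The sides of the triangle have no common point, so a nonzero value would give a bad triple. -/
theorem triangle_det_eq_zero (hD : NoBadTriple ω v Γ) {x : Fin 3 → E} (hx : ∀ j, ¬ InForm F Γ (v (x j))) {p q r : V}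
    (hp : p ∈ Γ) (hq : q ∈ Γ) (hr : r ∈ Γ) (hli : LinearIndependent F ![p, q, r])
    (hsp : ∀ e, ¬ InForm F Γ (v e) → v e ∈ Submodule.span F (Set.range ![p, q, r]))
    {g₀ g₁ g₂ : Fˣ} {s₀ t₀ s₁ t₁ s₂ t₂ : K} (ht₀ : t₀ ≠ 0) (ht₁ : t₁ ≠ 0) (ht₂ : t₂ ≠ 0)
    (h₀ : (g₀ : F) • v (x 0) = (algebraMap K F s₀ + ω * algebraMap K F t₀) • p + q)
    (h₁ : (g₁ : F) • v (x 1) = (algebraMap K F s₁ + ω * algebraMap K F t₁) • p + r)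
    (h₂ : (g₂ : F) • v (x 2) = (algebraMap K F s₂ + ω * algebraMap K F t₂) • q + r) :
    (algebraMap K F s₁ + ω * algebraMap K F t₁) + (algebraMap K F s₀ + ω * algebraMap K F t₀) *
      (algebraMap K F s₂ + ω * algebraMap K F t₂) = 0 := by
  by_contra hdet
  refine hD ![p, q, r] x ![g₀, g₁, g₂] ![![s₀, 1, 0], ![s₁, 0, 1], ![0, s₂, 1]]
    ![![t₀, 0, 0], ![t₁, 0, 0], ![0, t₂, 0]] ?_ hli ⟨?_, ?_, ?_, ?_⟩ hx hsp
  · intro i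
    fin_cases i
    · exact hp
    · exact hq
    · exact hr
  · intro j
    fin_cases j
    · simpa [Fin.sum_univ_three] using h₀
    · simpa [Fin.sum_univ_three] using h₁
    · simpa [Fin.sum_univ_three] using h₂
  · rw [Fintype.linearIndependent_iff]
    intro c hc
    have e0 := congrFun hc 0
    have e1 := congrFun hc 1
    have e2 := congrFun hc 2
    simp [Fin.sum_univ_three] at e0 e1 e2
    set σ₀ := algebraMap K F s₀ + ω * algebraMap K F t₀
    set σ₁ := algebraMap K F s₁ + ω * algebraMap K F t₁
    set σ₂ := algebraMap K F s₂ + ω * algebraMap K F t₂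
    have c2 : c 2 = 0 := by
      have : (σ₁ + σ₀ * σ₂) * c 2 = 0 := by linear_combination -e0 + σ₀ * e1 + σ₁ * e2
      exact (mul_eq_zero.1 this).resolve_left hdet
    rw [c2] at e1 e2
    intro i
    fin_cases i
    · simpa using e1
    · simpa using e2
    · exact c2
  · intro j
    rw [LinearIndependent.pair_iff]
    intro s t hst
    have e0 := congrFun hst 0
    have e1 := congrFun hst 1
    have e2 := congrFun hst 2
    fin_cases j
    · simp at e0 e1
      simp [e1, ht₀] at e0
      exact ⟨e1, e0⟩
    · simp at e0 e2
      simp [e2, ht₁] at e0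
      exact ⟨e2, e0⟩
    · simp at e1 e2
      simp [e2, ht₂] at e1
      exact ⟨e2, e1⟩
  · intro z hz
    obtain ⟨s, t, e0⟩ := Submodule.mem_span_pair.1 (hz 0)
    obtain ⟨s', t', e1⟩ := Submodule.mem_span_pair.1 (hz 1)
    obtain ⟨s'', t'', e2⟩ := Submodule.mem_span_pair.1 (hz 2)
    have f0 := congrFun e0 2
    have f1 := congrFun e1 1
    have f2 := congrFun e2 0
    simp at f0 f1 f2
    ext i
    fin_cases i
    · exact f2.symm
    · exact f1.symm
    · exact f0.symm

/-- Take `a = s₀p + q` and `b = t₀p`, so that `a + ωb` is the normalized `v e₀`. For `c` subtract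
`t₀t₁⁻¹` times the normalized `v e₁`: the ω-parts cancel, and `c` lies in `Γ`. -/
theorem isBar_of_two_lines (hs : Spans ω Γ) (hf : KForm ω Γ ⊥) {p q r : V} (hp : p ∈ Γ)
    (hq : q ∈ Γ) (hr : r ∈ Γ) (hli : LinearIndependent K ![p, q, r]) {g₀ g₁ : Fˣ} {s₀ t₀ s₁ t₁ : K}
    (ht₀ : t₀ ≠ 0) (ht₁ : t₁ ≠ 0) {e₀ e₁ : E}
    (h0 : (g₀ : F) • v e₀ = (algebraMap K F s₀ + ω * algebraMap K F t₀) • p + q)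
    (h1 : (g₁ : F) • v e₁ = (algebraMap K F s₁ + ω * algebraMap K F t₁) • p + r)
    (hall : ∀ e, ¬ InForm F Γ (v e) → v e ∈ Submodule.span F {v e₀, v e₁}) : IsBar K ω v := by
  refine ⟨Γ, hs, hf, s₀ • p + q, add_mem (Γ.smul_mem _ hp) hq, t₀ • p, Γ.smul_mem _ hp,
    (s₀ - t₀ * t₁⁻¹ * s₁) • p + q - (t₀ * t₁⁻¹) • r,
    sub_mem (add_mem (Γ.smul_mem _ hp) hq) (Γ.smul_mem _ hr), ?_, ?_⟩
  · rw [Fintype.linearIndependent_iff] at hli ⊢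
    intro c hc
    simp [Fin.sum_univ_three] at hc
    have h := hli ![c 0 * s₀ + c 1 * t₀ + c 2 * (s₀ - t₀ * t₁⁻¹ * s₁), c 0 + c 2,
      -(c 2 * (t₀ * t₁⁻¹))] (by
        simp [Fin.sum_univ_three]
        rw [← hc]
        module)
    have c2 := h 2
    have c1 := h 1
    have c0 := h 0
    simp [ht₀, ht₁] at c2
    simp [c2] at c1
    simp [c2, c1, ht₀] at c0
    intro i
    fin_cases i
    · exact c1
    · exact c0
    · exact c2
  · intro e
    by_cases he : InForm F Γ (v e)
    · exact Or.inl he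
    right
    refine Submodule.span_le.2 ?_ (hall e he)
    set ℓ := Submodule.span F {s₀ • p + q + ω • t₀ • p,
      (s₀ - t₀ * t₁⁻¹ * s₁) • p + q - (t₀ * t₁⁻¹) • r} with hℓ
    have m0 : (g₀ : F) • v e₀ ∈ ℓ := by
      rw [h0]
      refine Submodule.subset_span (Or.inl ?_)
      rw [add_smul, mul_smul, algebraMap_smul, algebraMap_smul]
      abel
    have m1 : (g₁ : F) • v e₁ ∈ ℓ := by
      have hd : algebraMap K F (t₀ * t₁⁻¹) ≠ 0 := by simp [ht₀, ht₁]
      have hm := sub_mem m0 (show _ ∈ ℓ from Submodule.subset_span (Or.inr rfl))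
      have : (g₀ : F) • v e₀ - ((s₀ - t₀ * t₁⁻¹ * s₁) • p + q - (t₀ * t₁⁻¹) • r) =
          algebraMap K F (t₀ * t₁⁻¹) • (g₁ : F) • v e₁ := by
        have ht : algebraMap K F t₁ ≠ 0 := by simpa using ht₁
        rw [h0, h1]
        simp only [← algebraMap_smul F (_ : K) (_ : V)]
        simp only [map_sub, map_mul, map_inv₀]
        match_scalars
        · field_simp
          ring
        · ring
        · field_simp
      rw [this] at hm
      exact (Submodule.smul_mem_iff _ hd).1 hm
    rintro y (rfl | rfl)
    · exact (Submodule.smul_mem_iff _ g₀.ne_zero).1 m0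
    · exact (Submodule.smul_mem_iff _ g₁.ne_zero).1 m1

/-- Special lines meet pairwise, so they are concurrent or contain a triangle. In the second case
the vanishing determinants put all special elements on one `F`-line. -/
theorem isHat_or_isBar [Nontrivial V] (hω : IsQuadGen K ω) (hs : Spans ω Γ)
    (hA : NoPlane v Γ F) (hD : KForm ω Γ ⊥ → NoBadTriple ω v Γ) : IsHat K ω v ∨ IsBar K ω v := by
  rcases hA.kform_or_isHat hω hs with hf | hhat
  swap
  · exact Or.inl hhat
  have hD := hD hf
  choose! a b hab using fun e (he : ¬ InForm F Γ (v e)) =>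
    (let ⟨a, ha, b, hb, h⟩ := hs.exists_line he
    ⟨a, b, ha, hb, h⟩ : ∃ a b, a ∈ Γ ∧ b ∈ Γ ∧ v e = a + ω • b ∧ LinearIndependent K ![a, b])
  have hL : ∀ e, ¬ InForm F Γ (v e) → Submodule.span K {a e, b e} ≤ Γ := by
    intro e he
    rw [Submodule.span_le]
    rintro x (rfl | rfl)
    · exact (hab e he).1
    · exact (hab e he).2.1
  have hmeet : ∀ e e', ¬ InForm F Γ (v e) → ¬ InForm F Γ (v e') →
      ∃ p, p ≠ 0 ∧ p ∈ Submodule.span K {a e, b e} ∧ p ∈ Submodule.span K {a e', b e'} := by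
    intro e e' he he'
    obtain ⟨h1, h2, h3, h4⟩ := hab e he
    obtain ⟨h1', h2', h3', h4'⟩ := hab e' he'
    exact hA.exists_mem_inf hω hf he he' h1 h2 h1' h2' h3 h3' h4 h4'
  by_cases hconc : ∃ p : V, p ≠ 0 ∧ p ∈ Γ ∧
      ∀ e, ¬ InForm F Γ (v e) → p ∈ Submodule.span K {a e, b e}
  · obtain ⟨p, hp, hpΓ, hpe⟩ := hconc
    refine Or.inl (isHat_of_concurrent hω hs hf hp hpΓ fun e he => ?_)
    obtain ⟨h1, h2, h3, h4⟩ := hab e he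
    exact ⟨_, h1, _, h2, h3, hpe e he⟩
  push Not at hconc
  right
  -- every triangle of special lines determines the same line over `F`
  have key : ∀ x : Fin 3 → E, (∀ j, ¬ InForm F Γ (v (x j))) →
      (∀ z, (∀ j, z ∈ Submodule.span K {a (x j), b (x j)}) → z = 0) →
      ∃ p ∈ Γ, ∃ q ∈ Γ, ∃ r ∈ Γ, ∃ (g₀ g₁ g₂ : Fˣ) (s₀ t₀ s₁ t₁ s₂ t₂ : K),
        LinearIndependent K ![p, q, r] ∧ t₀ ≠ 0 ∧ t₁ ≠ 0 ∧ t₂ ≠ 0 ∧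
        (g₀ : F) • v (x 0) = (algebraMap K F s₀ + ω * algebraMap K F t₀) • p + q ∧
        (g₁ : F) • v (x 1) = (algebraMap K F s₁ + ω * algebraMap K F t₁) • p + r ∧
        (g₂ : F) • v (x 2) = (algebraMap K F s₂ + ω * algebraMap K F t₂) • q + r ∧
        (algebraMap K F s₁ + ω * algebraMap K F t₁) +
          (algebraMap K F s₀ + ω * algebraMap K F t₀) *
          (algebraMap K F s₂ + ω * algebraMap K F t₂) = 0 := by
    intro x hx hcon
    obtain ⟨p, hp, hp0, hp1⟩ := hmeet _ _ (hx 0) (hx 1)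
    obtain ⟨q, hq, hq0, hq2⟩ := hmeet _ _ (hx 0) (hx 2)
    obtain ⟨r, hr, hr1, hr2⟩ := hmeet _ _ (hx 1) (hx 2)
    obtain ⟨l0, l1, l2, hli⟩ := triangle_of_not_concurrent (a := a ∘ x) (b := b ∘ x) hp hq hr hp0 hp1
      hq0 hq2 hr1 hr2 hcon
    have hpΓ := hL _ (hx 0) hp0
    have hqΓ := hL _ (hx 0) hq0
    have hrΓ := hL _ (hx 1) hr1
    obtain ⟨g₀, s₀, t₀, ht₀, h₀⟩ := exists_normal_form hω (hx 0) (hab _ (hx 0)).2.2.1 l0 hpΓ hqΓ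
    obtain ⟨g₁, s₁, t₁, ht₁, h₁⟩ := exists_normal_form hω (hx 1) (hab _ (hx 1)).2.2.1 l1 hpΓ hrΓ
    obtain ⟨g₂, s₂, t₂, ht₂, h₂⟩ := exists_normal_form hω (hx 2) (hab _ (hx 2)).2.2.1 l2 hqΓ hrΓ
    refine ⟨p, hpΓ, q, hqΓ, r, hrΓ, g₀, g₁, g₂, s₀, t₀, s₁, t₁, s₂, t₂, hli, ht₀, ht₁, ht₂, h₀, h₁,
      h₂, ?_⟩
    have hmem : ∀ i, ![p, q, r] i ∈ Γ := by
      intro i; fin_cases i <;> assumption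
    have hQ : ∀ j, Submodule.span K {a (x j), b (x j)} ≤
        Submodule.span K (Set.range ![p, q, r]) := le_span_range_triangle l0 l1 l2
    refine triangle_det_eq_zero hD hx hpΓ hqΓ hrΓ (hf.linearIndependent hω hmem hli) ?_ ht₀ ht₁ ht₂
      h₀ h₁ h₂
    -- Every special line meets all three sides, so it lies in the plane of the triangle, as
    -- `NoBadTriple` requires.
    intro e he
    obtain ⟨r₀, hr₀, h0, h0'⟩ := hmeet _ _ (hx 0) he
    obtain ⟨r₁, hr₁, h1, h1'⟩ := hmeet _ _ (hx 1) he
    obtain ⟨r₂, hr₂, h2, h2'⟩ := hmeet _ _ (hx 2) he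
    have hle := le_of_meets_triangle (a := a ∘ x) (b := b ∘ x) hr₀ hr₁ hr₂ h0 h1 h2 h0' h1' h2' hcon hQ
    have hle' : ∀ y ∈ Submodule.span K {a e, b e}, y ∈ Submodule.span F (Set.range ![p, q, r]) :=
      fun y hy => Submodule.span_le_restrictScalars K F _ (hle hy)
    rw [(hab e he).2.2.1]
    exact add_mem (hle' _ (Submodule.subset_span (by simp)))
      (Submodule.smul_mem _ _ (hle' _ (Submodule.subset_span (by simp))))
  have key' : ∀ x : Fin 3 → E, (∀ j, ¬ InForm F Γ (v (x j))) →
      (∀ z, (∀ j, z ∈ Submodule.span K {a (x j), b (x j)}) → z = 0) →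
      v (x 2) ∈ Submodule.span F {v (x 0), v (x 1)} := by
    intro x hx hcon
    obtain ⟨p, -, q, -, r, -, g₀, g₁, g₂, s₀, t₀, s₁, t₁, s₂, t₂, -, -, -, -, h0, h1, h2, hdet⟩ :=
      key x hx hcon
    rw [← Submodule.smul_mem_iff _ g₂.ne_zero, Submodule.mem_span_pair]
    refine ⟨(algebraMap K F s₂ + ω * algebraMap K F t₂) * g₀, g₁, ?_⟩
    rw [mul_smul, h0, h1, h2]
    rw [eq_neg_of_add_eq_zero_left hdet]
    module
  -- choose a triangle
  obtain ⟨p₀, hp₀⟩ := exists_ne (0 : V)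
  obtain ⟨γ, hγ, hγ0⟩ : ∃ γ ∈ Γ, γ ≠ 0 := by
    by_contra hcon
    push Not at hcon
    obtain ⟨y, hy, z, hz, h⟩ := hs p₀
    rw [hcon y hy, hcon z hz] at h
    simp at h
    exact hp₀ h
  obtain ⟨e₀, he₀, -⟩ := hconc γ hγ0 hγ
  have ha₀ : a e₀ ≠ 0 := (hab e₀ he₀).2.2.2.ne_zero 0
  obtain ⟨e₁, he₁, hn₁⟩ := hconc (a e₀) ha₀ (hab e₀ he₀).1
  obtain ⟨p, hp, hp0, hp1⟩ := hmeet _ _ he₀ he₁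
  obtain ⟨e₂, he₂, hn₂⟩ := hconc p hp (hL _ he₀ hp0)
  -- The lines of `e₀` and `e₁` differ, since only the first contains `a e₀`. They meet only in `p`,
  -- which the line of `e₂` avoids.
  have hcon : ∀ z, (∀ j, z ∈ Submodule.span K {a (![e₀, e₁, e₂] j), b (![e₀, e₁, e₂] j)}) →
      z = 0 := by
    intro z hz
    by_contra hz0
    have z0 : z ∈ Submodule.span K {a e₀, b e₀} := hz 0
    have z1 : z ∈ Submodule.span K {a e₁, b e₁} := hz 1
    have z2 : z ∈ Submodule.span K {a e₂, b e₂} := hz 2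
    by_cases hli : LinearIndependent K ![p, z]
    · apply hn₁
      rw [span_pair_eq_of_mem hp1 z1 hli, ← span_pair_eq_of_mem hp0 z0 hli]
      exact Submodule.subset_span (by simp)
    · exact hn₂ ((mem_of_not_linearIndependent hp hz0 hli).2 z2)
  have hx : ∀ j, ¬ InForm F Γ (v (![e₀, e₁, e₂] j)) := by
    intro j; fin_cases j <;> assumption
  have hv₂ : v e₂ ∈ Submodule.span F {v e₀, v e₁} := key' ![e₀, e₁, e₂] hx hcon
  have hall : ∀ e, ¬ InForm F Γ (v e) → v e ∈ Submodule.span F {v e₀, v e₁} := by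
    intro e he
    have hle : ∀ i j, i ∈ ({e₀, e₁, e₂} : Set E) → j ∈ ({e₀, e₁, e₂} : Set E) →
        Submodule.span F {v i, v j} ≤ Submodule.span F {v e₀, v e₁} := by
      have hmem : ∀ i ∈ ({e₀, e₁, e₂} : Set E), v i ∈ Submodule.span F {v e₀, v e₁} := by
        rintro i (rfl | rfl | rfl)
        · exact Submodule.subset_span (by simp)
        · exact Submodule.subset_span (by simp)
        · exact hv₂
      intro i j hi hj
      rw [Submodule.span_le]
      rintro y (rfl | rfl)
      · exact hmem i hi
      · exact hmem j hj
    have hsp : ∀ i ∈ ({e₀, e₁, e₂} : Set E), ¬ InForm F Γ (v i) := by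
      rintro i (rfl | rfl | rfl) <;> assumption
    by_contra hne
    -- If `v e` is off the `F`-line, `e` forms no triangle with two of the three elements. Then its
    -- line passes through all three vertices of the triangle, which are not collinear.
    have hcc : ∀ i j, i ∈ ({e₀, e₁, e₂} : Set E) → j ∈ ({e₀, e₁, e₂} : Set E) →
        ∃ z, z ≠ 0 ∧ z ∈ Submodule.span K {a i, b i} ∧ z ∈ Submodule.span K {a j, b j} ∧
          z ∈ Submodule.span K {a e, b e} := by
      intro i j hi hj
      by_contra hcc
      push Not at hcc
      have hk : v e ∈ Submodule.span F {v i, v j} := key' ![i, j, e] ?_ ?_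
      · exact hne (hle i j hi hj hk)
      · intro k
        fin_cases k
        · exact hsp i hi
        · exact hsp j hj
        · exact he
      · intro z hz
        by_contra hz0
        exact hcc z hz0 (hz 0) (hz 1) (hz 2)
    obtain ⟨p, hp, p0, p1, pe⟩ := hcc e₀ e₁ (by simp) (by simp)
    obtain ⟨q, hq, q0, q2, qe⟩ := hcc e₀ e₂ (by simp) (by simp)
    obtain ⟨r, hr, r1, r2, re⟩ := hcc e₁ e₂ (by simp) (by simp)
    obtain ⟨l0, l1, l2, hli⟩ := triangle_of_not_concurrent (a := a ∘ ![e₀, e₁, e₂])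
      (b := b ∘ ![e₀, e₁, e₂]) hp hq hr p0 p1 q0 q2 r1 r2 hcon
    have hpq : LinearIndependent K ![p, q] := by
      rw [LinearIndependent.pair_iff]
      intro s t hst
      have := Fintype.linearIndependent_iff.1 hli ![s, t, 0] (by
        simpa [Fin.sum_univ_three] using hst)
      exact ⟨this 0, this 1⟩
    rw [span_pair_eq_of_mem pe qe hpq, ← span_pair_eq_of_mem p0 q0 hpq] at re
    exact hr (hcon r fun j => by fin_cases j <;> assumption)
  obtain ⟨p, hp, q, hq, r, hr, g₀, g₁, g₂, s₀, t₀, s₁, t₁, s₂, t₂, hli, ht₀, ht₁, ht₂, h0, h1, -, -⟩ :=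
    key ![e₀, e₁, e₂] hx hcon
  exact isBar_of_two_lines hs hf hp hq hr hli ht₀ ht₁ h0 h1 hall

end Structure

/-! ### Shrinking and lifting forms for the induction step -/

section Induction

variable {K : Type*} [Field K] {F : Type*} [Field F] [Algebra K F]
  {V : Type*} [AddCommGroup V] [Module K V] [Module F V] [IsScalarTower K F V] {E : Type*}
  {ω : F} {v : E → V} {Γ : Submodule K V} {Y : Submodule F V}

/-- Both triples are independent, and one lies in the span of the other. So a plane carrying a bad
triple lies in every subspace that contains its three elements. -/
theorem IsBadTriple.mem_span {p : Fin 3 → V} {x : Fin 3 → E} {g : Fin 3 → Fˣ}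
    {a b : Fin 3 → Fin 3 → K} (h : IsBadTriple K ω v p x g a b) (hp : LinearIndependent F p)
    (i : Fin 3) : p i ∈ Submodule.span F (Set.range (v ∘ x)) := by
  have hmap : LinearIndependent F fun j => (g j : F) • v (x j) := by
    have h1 := h.li.map' (Fintype.linearCombination F p)
      (LinearMap.ker_eq_bot.2 (linearIndependent_iff_injective_fintypeLinearCombination.1 hp))
    have h2 : (fun j => (g j : F) • v (x j)) = Fintype.linearCombination F p ∘
        fun j i => algebraMap K F (a j i) + ω * algebraMap K F (b j i) := by
      ext j
      rw [h.eq j]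
      simp [Fintype.linearCombination_apply]
    rw [h2]
    exact h1
  have hle : Submodule.span F (Set.range fun j => (g j : F) • v (x j)) ≤
      Submodule.span F (Set.range p) := by
    rw [Submodule.span_le]
    rintro _ ⟨j, rfl⟩
    change (g j : F) • v (x j) ∈ _
    rw [h.eq j]
    exact Submodule.sum_mem _ fun i _ => Submodule.smul_mem _ _ (Submodule.subset_span ⟨i, rfl⟩)
  have : FiniteDimensional F (Submodule.span F (Set.range p)) :=
    FiniteDimensional.span_of_finite F (Set.finite_range p)
  have heq := Submodule.eq_of_le_of_finrank_eq hle (by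
    rw [finrank_span_eq_card hmap, finrank_span_eq_card hp])
  have hpi : p i ∈ Submodule.span F (Set.range p) := Submodule.subset_span ⟨i, rfl⟩
  rw [← heq] at hpi
  refine Submodule.span_le.2 ?_ hpi
  rintro _ ⟨j, rfl⟩
  exact Submodule.smul_mem _ _ (Submodule.subset_span ⟨j, rfl⟩)

/-- Rank five suffices: `NoPlane` contracts rank at most two, and the obstruction needs three more
dimensions. -/
theorem isHat_or_isBar_of_full [Finite V] [Finite E] (hω : IsQuadGen K ω)
    (hv : Submodule.span F (Set.range v) = ⊤) (h : IsCore ω v Γ ⊥) (hr : 5 ≤ Module.finrank F V)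
    (hO : ¬ HasObs K ω v) : IsHat K ω v ∨ IsBar K ω v := by
  have : Nontrivial V := Module.nontrivial_of_finrank_pos (R := F) (by omega)
  refine isHat_or_isBar hω h.spans ?_ fun _ => ?_
  · intro C _ hC p₁ p₂ hp h₁ h₂
    exact hO (hasObs_of_contract_of_full hω hv h (by omega) hp h₁ h₂)
  · intro p x g a b hpΓ hp hx _ _
    exact hO (hasObs_of_badTriple_of_full hv h hpΓ hp hx)

theorem IsCore.isHat_or_isBar [Finite V] [Finite E] {q : ℕ} (hK : Nat.card K = q)
    (hF : Nat.card F = q ^ 2) (hq : 0 < q) (hω : IsQuadGen K ω)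
    (hv : Submodule.span F (Set.range v) = ⊤) (h : IsCore ω v Γ Y)
    (ho : OffForm v Γ Y) {k : ℕ} (ha : FormAbundant v Γ Y (k + 1))
    (hk : k + 3 ≤ Module.finrank F (V ⧸ Y)) (hck : q ^ 5 * (3 * q ^ 5 + 1) ≤ k)
    (hO : ¬ HasObs K ω v) : IsHat K ω v ∨ IsBar K ω v := by
  have : Nontrivial V := Module.nontrivial_of_finrank_pos (R := F) (by
    have := Y.finrank_quotient_add_finrank
    omega)
  have hsp : ∀ e, ¬ InForm F Γ (v e) → v e ∈ Y := fun e he => by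
    by_contra hY
    exact he (ho e hY)
  refine _root_.isHat_or_isBar hω h.spans ?_ fun hf => ?_
  · intro C hC _ p₁ p₂ hp h₁ h₂
    exact hO (h.hasObs_of_contract hK hF hq hω hv ho ha hk hck (fun e he => hsp e (hC e he)) hp h₁ h₂)
  · intro p x g a b hpΓ hp hx hxs hall
    refine hO (h.hasObs_of_badTriple hK hq hω hv ho (k := k)
      (fun B hB hBk => ha B hB (by omega)) (by omega) hck hf hpΓ ?_ hp hx ?_)
    · intro i
      refine Submodule.span_le.2 ?_ (hx.mem_span hp i)
      rintro _ ⟨j, rfl⟩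
      exact hsp _ (hxs j)
    · intro e _ he
      by_contra hne
      exact he (hall e hne)

/-- If abundance fails, all elements outside the extension `Y'` have multiples in a proper subspace
`Γ'` of `Γ`. Were the `F`-span of `Γ'` proper, it would cover all elements together with `Y'`,
contrary to roundness. So `Γ'` still spans. -/
theorem IsCore.exists_lt_of_not_formAbundant [Finite V] (hω : IsQuadGen K ω)
    (hround : RepMatroid.RoundVec F v) {k : ℕ} (h : IsCore ω v Γ Y) (ho : OffForm v Γ Y)
    (hY : k < Module.finrank F (V ⧸ Y)) (hna : ¬ FormAbundant v Γ Y k) :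
    ∃ (Γ' : Submodule K V) (Y' : Submodule F V), IsCore ω v Γ' Y' ∧ OffForm v Γ' Y' ∧ Γ' < Γ ∧
      Module.finrank F (V ⧸ Y) ≤ Module.finrank F (V ⧸ Y') + k := by
  classical
  unfold FormAbundant at hna
  push Not at hna
  obtain ⟨B, hBΓ, hBk, Γ', hle, hx, hne⟩ := hna
  set Y' := Y ⊔ Submodule.span F (B : Set V) with hY'
  have h' : IsCore ω v Γ Y' := h.sup_span hω hBΓ
  have hcod : Module.finrank F (V ⧸ Y) ≤ Module.finrank F (V ⧸ Y') + k := by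
    have h1 := Submodule.finrank_add_le_finrank_add_finrank Y (Submodule.span F (B : Set V))
    have h2 := finrank_span_finset_le_card (R := F) B
    have h3 := Y.finrank_quotient_add_finrank
    have h4 := Y'.finrank_quotient_add_finrank
    rw [Set.finrank] at h2
    rw [← hY'] at h1
    omega
  have hoff : OffForm v Γ' Y' := by
    intro e he
    obtain ⟨f, hf, hfe⟩ := ho e fun hY => he (Submodule.mem_sup_left hY)
    refine ⟨f, hf, hx _ ⟨hfe, e, f, hf, rfl⟩ ?_⟩
    rwa [Submodule.smul_mem_iff _ hf]
  have hY'top : Y' ≠ ⊤ := by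
    intro htop
    have h4 := Y'.finrank_quotient_add_finrank
    rw [htop, finrank_top] at h4
    rw [htop] at hcod
    omega
  refine ⟨Γ', Y', ⟨?_, h'.kform.mono hle, fun γ hγ => h'.full γ (hle hγ), h'.gen⟩, hoff,
    lt_of_le_of_ne hle hne, hcod⟩
  apply spans_of_span_eq_top hω
  by_contra hsp
  obtain ⟨e, he1, he2⟩ := hround _ _ hY'top hsp
  obtain ⟨f, hf, hfe⟩ := hoff e he1
  exact he2 ((Submodule.smul_mem_iff _ hf).1 (Submodule.subset_span hfe))

/-- In a round configuration the form can be shrunk until it is abundant. -/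
theorem IsCore.exists_formAbundant [Finite V] (hω : IsQuadGen K ω) (hround : RepMatroid.RoundVec F v)
    (k : ℕ) : ∀ (j : ℕ) (Γ : Submodule K V) (Y : Submodule F V), IsCore ω v Γ Y → OffForm v Γ Y →
      Module.finrank K Γ ≤ Module.finrank F V + j → (j + 1) * k < Module.finrank F (V ⧸ Y) →
      ∃ (Γ' : Submodule K V) (Y' : Submodule F V), IsCore ω v Γ' Y' ∧ OffForm v Γ' Y' ∧
        FormAbundant v Γ' Y' k ∧ Module.finrank F (V ⧸ Y) ≤ Module.finrank F (V ⧸ Y') + j * k := by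
  intro j
  induction j with
  | zero =>
    -- The form already has the least dimension a spanning form can have, so no further shrinking is
    -- possible.
    intro Γ Y h ho hΓ hY
    refine ⟨Γ, Y, h, ho, ?_, by omega⟩
    by_contra hna
    obtain ⟨Γ', Y', h', -, hlt, -⟩ := h.exists_lt_of_not_formAbundant hω hround ho (by omega) hna
    have h1 := Submodule.finrank_lt_finrank_of_lt hlt
    have h2 := h'.spans.finrank_le
    omega
  | succ j ih =>
    intro Γ Y h ho hΓ hY
    by_cases ha : FormAbundant v Γ Y k
    · exact ⟨Γ, Y, h, ho, ha, by omega⟩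
    obtain ⟨Γ', Y', h', ho', hlt, hcod⟩ :=
      h.exists_lt_of_not_formAbundant hω hround ho (by nlinarith) ha
    have h1 := Submodule.finrank_lt_finrank_of_lt hlt
    obtain ⟨Γ₁, Y₁, h₁, ho₁, ha₁, hcod₁⟩ := ih Γ' Y' h' ho' (by omega) (by nlinarith)
    exact ⟨Γ₁, Y₁, h₁, ho₁, ha₁, by nlinarith⟩

/-- Two `K`-forms with the same points agree up to a scalar. -/
theorem KForm.exists_scalar {Λ : Submodule K V} (hω : IsQuadGen K ω) (hΓ : KForm ω Γ Y)
    (hΛf : KForm ω Λ Y) (h : ∀ x ∈ Λ, x ∉ Y → ∃ f : F, f ≠ 0 ∧ ∃ γ ∈ Γ, f • x - γ ∈ Y) :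
    ∃ f₀ : F, f₀ ≠ 0 ∧ ∀ x ∈ Λ, ∃ γ ∈ Γ, f₀ • x - γ ∈ Y := by
  by_cases hΛ : ∃ x₀ ∈ Λ, x₀ ∉ Y
  swap
  · push Not at hΛ
    exact ⟨1, one_ne_zero, fun x hx => ⟨0, zero_mem _, by simpa using hΛ x hx⟩⟩
  obtain ⟨x₀, hx₀, hx₀Y⟩ := hΛ
  obtain ⟨f₀, hf₀, γ₀, hγ₀, h₀⟩ := h x₀ hx₀ hx₀Y
  have hγ₀Y : γ₀ ∉ Y := by
    intro hγ
    have := add_mem h₀ hγ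
    rw [sub_add_cancel, Submodule.smul_mem_iff _ hf₀] at this
    exact hx₀Y this
  refine ⟨f₀, hf₀, fun x hx => ?_⟩
  by_cases hdep : ∃ c : K, x - c • x₀ ∈ Y
  · obtain ⟨c, hc⟩ := hdep
    refine ⟨c • γ₀, Γ.smul_mem _ hγ₀, ?_⟩
    have := add_mem (Y.smul_mem f₀ hc) (Y.smul_mem (algebraMap K F c) h₀)
    convert this using 1
    rw [algebraMap_smul, smul_sub, smul_sub, smul_comm_tower]
    abel
  push Not at hdep
  have hxY : x ∉ Y := fun hxY => hdep 0 (by simpa using hxY)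
  have hsY : x + x₀ ∉ Y := fun hxY => hdep (-1) (by simpa using hxY)
  -- Compare the multipliers `f`, `f₀`, `f'` of `x`, `x₀`, `x + x₀`. The ω-parts of `f'/f` and
  -- `f'/f₀` must vanish, so `f₀/f` is in `K`.
  obtain ⟨f, hf, γ, hγ, h₁⟩ := h x hx hxY
  obtain ⟨f', hf', γ', hγ', h₂⟩ := h (x + x₀) (add_mem hx hx₀) hsY
  have hγY : γ ∉ Y := by
    intro hγ
    have := add_mem h₁ hγ
    rw [sub_add_cancel, Submodule.smul_mem_iff _ hf] at this
    exact hxY this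
  obtain ⟨s, t, hst, hst'⟩ := hω.exists_smul_eq V (f' * f⁻¹)
  obtain ⟨s₀, t₀, hst₀, hst₀'⟩ := hω.exists_smul_eq V (f' * f₀⁻¹)
  have hmem : (f' * f⁻¹) • γ + (f' * f₀⁻¹) • γ₀ - γ' ∈ Y := by
    have := sub_mem h₂ (add_mem (Y.smul_mem (f' * f⁻¹) h₁) (Y.smul_mem (f' * f₀⁻¹) h₀))
    convert this using 1
    rw [smul_sub, smul_sub, smul_smul, smul_smul, inv_mul_cancel_right₀ hf,
      inv_mul_cancel_right₀ hf₀, smul_add]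
    abel
  rw [hst, hst₀] at hmem
  obtain ⟨-, h3⟩ := hΓ (s • γ + s₀ • γ₀ - γ')
    (sub_mem (add_mem (Γ.smul_mem _ hγ) (Γ.smul_mem _ hγ₀)) hγ') (t • γ + t₀ • γ₀)
    (add_mem (Γ.smul_mem _ hγ) (Γ.smul_mem _ hγ₀)) (by
      convert hmem using 1
      rw [smul_add]; abel)
  have ht : t = 0 := by
    -- Otherwise `x` would be a multiple of `x₀` modulo `Y`, with a scalar in `K` because `Λ` is a
    -- form.
    by_contra ht
    have hc : -(algebraMap K F (t⁻¹ * t₀) * (f⁻¹ * f₀)) • x₀ - x ∈ Y := by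
      have h4 := add_mem (add_mem h3 (Y.smul_mem (algebraMap K F t) h₁))
        (Y.smul_mem (algebraMap K F t₀) h₀)
      have h5 := neg_mem (Y.smul_mem (f⁻¹ * algebraMap K F t⁻¹) h4)
      have ht' : algebraMap K F t ≠ 0 := by simpa using ht
      convert h5 using 1
      simp only [← algebraMap_smul F (_ : K) (_ : V)]
      simp only [map_mul, map_inv₀]
      match_scalars <;> field_simp <;> ring
    obtain ⟨c, hc'⟩ := hΛf.exists_algebraMap_eq hω hx₀ hx₀Y hx hc
    rw [hc', algebraMap_smul] at hc
    refine hdep c ?_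
    rw [← neg_sub]
    exact neg_mem hc
  rw [ht, map_zero, mul_zero, add_zero] at hst'
  have ht₀ : t₀ = 0 := by
    by_contra ht₀
    rw [ht, zero_smul, zero_add, ← algebraMap_smul F, Submodule.smul_mem_iff _ (by simpa using ht₀)]
      at h3
    exact hγ₀Y h3
  rw [ht₀, map_zero, mul_zero, add_zero] at hst₀'
  refine ⟨(s₀⁻¹ * s) • γ, Γ.smul_mem _ hγ, ?_⟩
  have h6 : algebraMap K F (s₀⁻¹ * s) = f₀ * f⁻¹ := by
    rw [map_mul, map_inv₀, ← hst', ← hst₀']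
    field_simp
  rw [← algebraMap_smul F (s₀⁻¹ * s) γ, h6]
  have := Y.smul_mem (f₀ * f⁻¹) h₁
  rwa [smul_sub, smul_smul, inv_mul_cancel_right₀ hf] at this

/-- One scalar `f₀` carries all of `Λ` into `Γ` modulo `Y`. Write `γ = f₀x₁ + ωf₀x₂` with `x₁, x₂ ∈
Λ`; the form property of `Γ` removes the second term modulo `Y`, and the point of `x₁` is available.
-/
theorem IsCore.of_offForm {Λ : Submodule K V} (hω : IsQuadGen K ω) (h : IsCore ω v Λ Y)
    (hs : Spans ω Γ) (hf : KForm ω Γ Y) (ho : OffForm v Γ Y) : IsCore ω v Γ Y := by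
  obtain ⟨f₀, hf₀, h₀⟩ := hf.exists_scalar hω h.kform (fun x hx hxY => by
    obtain ⟨e, f, hf, he⟩ := h.full x hx hxY
    have heY : v e ∉ Y := by
      intro heY
      have := sub_mem (Y.smul_mem f heY) he
      rw [sub_sub_cancel] at this
      exact hxY this
    obtain ⟨g, hg, hge⟩ := ho e heY
    refine ⟨g * f⁻¹, mul_ne_zero hg (inv_ne_zero hf), _, hge, ?_⟩
    have := neg_mem (Y.smul_mem (g * f⁻¹) he)
    rwa [smul_sub, smul_smul, inv_mul_cancel_right₀ hf, neg_sub] at this)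
  refine ⟨hs, hf, fun γ hγ hγY => ?_, h.gen⟩
  obtain ⟨x₁, hx₁, x₂, hx₂, hx⟩ := h.spans (f₀⁻¹ • γ)
  obtain ⟨γ₁, hγ₁, h₁⟩ := h₀ x₁ hx₁
  obtain ⟨γ₂, hγ₂, h₂⟩ := h₀ x₂ hx₂
  have hγ' : γ = f₀ • x₁ + ω • f₀ • x₂ := by
    rw [smul_comm ω, ← smul_add, ← hx, smul_inv_smul₀ hf₀]
  have h3 := (hf (γ₁ - γ) (sub_mem hγ₁ hγ) γ₂ hγ₂ (by
    have := neg_mem (add_mem h₁ (Y.smul_mem ω h₂))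
    convert this using 1
    rw [hγ', smul_sub]
    abel)).1
  have h4 : f₀ • x₁ - γ ∈ Y := by
    have := add_mem h₁ h3
    rwa [sub_add_sub_cancel] at this
  have hx₁Y : x₁ ∉ Y := by
    intro hx₁Y
    have := sub_mem (Y.smul_mem f₀ hx₁Y) h4
    rw [sub_sub_cancel] at this
    exact hγY this
  obtain ⟨e, f, hf, he⟩ := h.full x₁ hx₁ hx₁Y
  refine ⟨e, f₀ * f, mul_ne_zero hf₀ hf, ?_⟩
  have := add_mem (Y.smul_mem f₀ he) h4
  rwa [smul_sub, smul_smul, sub_add_sub_cancel] at this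

/-- `Y` is generated over `P` by vectors of `Γ`: its elements outside `P ⊔ span F S` have multiples
in `Γ`, and `S` is in `Γ` already. Now `KForm.sup_span` applies. -/
theorem KForm.of_gen (hω : IsQuadGen K ω) {P : Submodule F V} (h : KForm ω Γ P) {S : Set V}
    (hS : S ⊆ Γ) (hY : P ⊔ Submodule.span F S ≤ Y) (ho : OffForm v Γ (P ⊔ Submodule.span F S))
    (hgen : Y ≤ Submodule.span F (v '' {e | v e ∈ Y})) : KForm ω Γ Y := by
  have h1 := h.sup_span hω (S := {y | y ∈ Γ ∧ y ∈ Y}) (fun y hy => hy.1)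
  have h2 : P ⊔ Submodule.span F {y | y ∈ Γ ∧ y ∈ Y} = Y := by
    apply le_antisymm
    · exact sup_le (le_sup_left.trans hY) (Submodule.span_le.2 fun y hy => hy.2)
    · refine hgen.trans (Submodule.span_le.2 ?_)
      rintro _ ⟨e, he, rfl⟩
      by_cases heP : v e ∈ P ⊔ Submodule.span F S
      · have hSY : S ⊆ {y | y ∈ Γ ∧ y ∈ Y} := fun y hy =>
          ⟨hS hy, hY (Submodule.mem_sup_right (Submodule.subset_span hy))⟩
        exact sup_le_sup_left (Submodule.span_mono hSY) P heP
      · obtain ⟨f, hf, hfe⟩ := ho e heP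
        have h3 : f • v e ∈ Submodule.span F {y | y ∈ Γ ∧ y ∈ Y} :=
          Submodule.subset_span ⟨hfe, Y.smul_mem f he⟩
        exact Submodule.mem_sup_right ((Submodule.smul_mem_iff _ hf).1 h3)
  rwa [h2] at h1

/-- Each basis vector of `P` is `a + ωb`, which accounts for the factor two. -/
theorem Spans.exists_finset [Finite V] (hs : Spans ω Γ) (P : Submodule F V) :
    ∃ B : Finset V, (B : Set V) ⊆ Γ ∧ B.card ≤ 2 * Module.finrank F P ∧
      P ≤ Submodule.span F (B : Set V) := by
  classical
  let y := Module.finBasis F P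
  choose a ha b hb hab using fun i => hs (y i : V)
  refine ⟨Finset.univ.image a ∪ Finset.univ.image b, ?_, ?_, ?_⟩
  · intro z hz
    simp only [Finset.coe_union, Finset.coe_image, Finset.coe_univ, Set.image_univ] at hz
    rcases hz with ⟨i, rfl⟩ | ⟨i, rfl⟩
    · exact ha i
    · exact hb i
  · refine (Finset.card_union_le _ _).trans ?_
    have h1 := Finset.card_image_le (s := Finset.univ) (f := a)
    have h2 := Finset.card_image_le (s := Finset.univ) (f := b)
    simp only [Finset.card_univ, Fintype.card_fin] at h1 h2
    omega
  · intro z hz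
    rw [← span_range_basis_coe y, Submodule.mem_span_range_iff_exists_fun] at hz
    obtain ⟨c, rfl⟩ := hz
    refine Submodule.sum_mem _ fun i _ => Submodule.smul_mem _ _ ?_
    rw [hab i]
    exact add_mem (Submodule.subset_span (by simp)) (Submodule.smul_mem _ _
      (Submodule.subset_span (by simp)))

theorem Spans.comap_mkQ {Z : Submodule F V} {Γ' : Submodule K (V ⧸ Z)} (h : Spans ω Γ') :
    Spans ω (Γ'.comap (Z.mkQ.restrictScalars K)) := by
  intro x
  obtain ⟨a, ha, b, hb, hab⟩ := h (Z.mkQ x)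
  obtain ⟨b, rfl⟩ := Z.mkQ_surjective b
  refine ⟨x - ω • b, ?_, b, hb, by abel⟩
  change Z.mkQ (x - ω • b) ∈ Γ'
  rwa [map_sub, map_smul, hab, add_sub_cancel_right]

theorem KForm.comap_mkQ {Z : Submodule F V} {Γ' : Submodule K (V ⧸ Z)} {P : Submodule F (V ⧸ Z)}
    (h : KForm ω Γ' P) : KForm ω (Γ'.comap (Z.mkQ.restrictScalars K)) (P.comap Z.mkQ) := by
  intro a ha b hb hab
  exact h (Z.mkQ a) ha (Z.mkQ b) hb (by simpa using hab)

theorem finrank_comap_mkQ [Finite V] (Z : Submodule F V) (P : Submodule F (V ⧸ Z)) :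
    Module.finrank F (P.comap Z.mkQ) = Module.finrank F P + Module.finrank F Z := by
  have hZ : Z ≤ P.comap Z.mkQ := by
    intro z hz
    have : Z.mkQ z = 0 := by simpa using hz
    rw [Submodule.mem_comap, this]
    exact zero_mem _
  have h1 := (P.comap Z.mkQ).finrank_quotient_add_finrank
  have h2 := P.finrank_quotient_add_finrank
  have h3 := Z.finrank_quotient_add_finrank
  have h4 := finrank_quotient_map_mkQ hZ
  rw [Submodule.map_comap_eq_of_surjective Z.mkQ_surjective] at h4
  omega

/-- The structure of a single-element contraction lifts to a form that is correct outside a small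
subspace. -/
theorem exists_form_of_contract [Finite V] {x : V}
    (h : IsHat K ω ((Submodule.span F {x}).mkQ ∘ v) ∨ IsBar K ω ((Submodule.span F {x}).mkQ ∘ v)) :
    ∃ (Γ : Submodule K V) (P : Submodule F V) (S : Set V), Spans ω Γ ∧ KForm ω Γ P ∧ S ⊆ Γ ∧
      OffForm v Γ (P ⊔ Submodule.span F S) ∧ Module.finrank F P ≤ 2 ∧
      Module.finrank F (P ⊔ Submodule.span F S : Submodule F V) ≤ 4 := by
  classical
  set Z := Submodule.span F {x} with hZ
  have hZ1 : Module.finrank F Z ≤ 1 := by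
    have h2 := finrank_span_le_card (R := F) ({x} : Set V)
    simpa only [Set.toFinset_singleton, Finset.card_singleton] using h2
  have hin : ∀ (Γ' : Submodule K (V ⧸ Z)) (y : V), InForm F Γ' (Z.mkQ y) →
      InForm F (Γ'.comap (Z.mkQ.restrictScalars K)) y := by
    rintro Γ' y ⟨f, hf, hfy⟩
    refine ⟨f, hf, ?_⟩
    change Z.mkQ (f • y) ∈ Γ'
    rwa [map_smul]
  rcases h with ⟨p, -, Γ', -, hs, hf, hall⟩ | ⟨Γ', hs, hf, a, ha, b, hb, c, hc, -, hall⟩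
  -- Hat case: the full preimage form works modulo the span of `x` and a lift of `p`, and no further
  -- vectors are needed.
  · have hP : Module.finrank F ((Submodule.span F {p}).comap Z.mkQ) ≤ 2 := by
      rw [finrank_comap_mkQ]
      have h2 := finrank_span_le_card (R := F) ({p} : Set (V ⧸ Z))
      simp only [Set.toFinset_singleton, Finset.card_singleton] at h2
      omega
    refine ⟨_, _, ∅, hs.comap_mkQ, hf.comap_mkQ, Set.empty_subset _, fun e _ => hin _ _ (hall e), hP,
      ?_⟩
    rw [Submodule.span_empty, sup_bot_eq]
    omega
  -- Bar case: the form property holds modulo `x`, and the special line is absorbed by adjoining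
  -- lifts of `a`, `b`, `c`, for dimension at most 1 + 3.
  · have hP : (⊥ : Submodule F (V ⧸ Z)).comap Z.mkQ = Z := by
      rw [← LinearMap.ker, Submodule.ker_mkQ]
    obtain ⟨a, rfl⟩ := Z.mkQ_surjective a
    obtain ⟨b, rfl⟩ := Z.mkQ_surjective b
    obtain ⟨c, rfl⟩ := Z.mkQ_surjective c
    refine ⟨_, _, {a, b, c}, hs.comap_mkQ, hf.comap_mkQ, ?_, ?_, ?_, ?_⟩
    · rintro y (rfl | rfl | rfl)
      · exact ha
      · exact hb
      · exact hc
    · intro e he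
      rcases hall e with h | h
      · exact hin _ _ h
      · exfalso
        apply he
        rw [hP]
        obtain ⟨s, t, hst⟩ := Submodule.mem_span_pair.1 h
        have h1 : v e - (s • (a + ω • b) + t • c) ∈ Z := by
          rw [← Submodule.Quotient.mk_eq_zero, ← Submodule.mkQ_apply, map_sub, sub_eq_zero]
          rw [Function.comp_apply] at hst
          rw [← hst]
          simp
        have h2 : s • (a + ω • b) + t • c ∈ Submodule.span F {a, b, c} := by
          have m : ∀ y ∈ ({a, b, c} : Set V), y ∈ Submodule.span F {a, b, c} := fun y hy =>
            Submodule.subset_span hy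
          exact add_mem (Submodule.smul_mem _ _ (add_mem (m a (by simp)) (Submodule.smul_mem _ _
            (m b (by simp))))) (Submodule.smul_mem _ _ (m c (by simp)))
        rw [← sub_add_cancel (v e) (s • (a + ω • b) + t • c)]
        exact Submodule.add_mem_sup h1 h2
    · rw [hP]; omega
    · rw [hP]
      have h1 := Submodule.finrank_add_le_finrank_add_finrank Z (Submodule.span F {a, b, c})
      have h2 := finrank_span_finset_le_card (R := F) ({a, b, c} : Finset V)
      have h3 := Finset.card_le_three (a := a) (b := b) (c := c)
      rw [Set.finrank] at h2
      have h4 : ((({a, b, c} : Finset V)) : Set V) = {a, b, c} := by simp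
      rw [h4] at h2
      omega

end Induction

/-! ### The induction on the dimension -/

section Main

variable {K : Type*} [Field K] {F : Type*} [Field F] [Algebra K F] {E : Type*} {ω : F}

/-- A round configuration that projects from some of its elements onto a large projective geometry has
one of the two structures, or an obstruction. -/
theorem isHat_or_isBar_of_isCore [Finite E] {q : ℕ} (hK : Nat.card K = q)
    (hF : Nat.card F = q ^ 2) (hq : 0 < q) (hω : IsQuadGen K ω) {k : ℕ}
    (hck : q ^ 5 * (3 * q ^ 5 + 1) ≤ k) (d : ℕ) :
    ∀ (V : Type u) [AddCommGroup V] [Module K V] [Module F V] [IsScalarTower K F V] [Finite V]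
      (v : E → V) (C : Set E) (Λ : Submodule K V), Module.finrank F V = d →
      Submodule.span F (Set.range v) = ⊤ → RepMatroid.RoundVec F v →
      IsCore ω v Λ (Submodule.span F (v '' C)) →
      3 * k + 14 ≤ Module.finrank F (V ⧸ Submodule.span F (v '' C)) → ¬ HasObs K ω v →
      IsHat K ω v ∨ IsBar K ω v := by
  induction d using Nat.strong_induction_on with
  | _ d ih =>
    intro V _ _ _ _ _ v C Λ hd hv hround hΛ hn hO
    set W := Submodule.span F (v '' C) with hW
    have hWn := W.finrank_quotient_add_finrank
    by_cases hC : ∀ e ∈ C, v e = 0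
    · have hbot : W = ⊥ := by
        rw [hW, Submodule.span_eq_bot]
        rintro _ ⟨e, he, rfl⟩
        exact hC e he
      rw [hbot] at hΛ
      exact isHat_or_isBar_of_full hω hv hΛ (by omega) hO
    push Not at hC
    obtain ⟨e, heC, he⟩ := hC
    have hZW : Submodule.span F {v e} ≤ W := by
      rw [Submodule.span_singleton_le_iff_mem]
      exact Submodule.subset_span ⟨e, heC, rfl⟩
    have hZ := (Submodule.span F {v e}).finrank_quotient_add_finrank
    rw [finrank_span_singleton he] at hZ
    have : Finite (V ⧸ Submodule.span F {v e}) :=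
      Finite.of_surjective _ (Submodule.span F {v e}).mkQ_surjective
    have hWm : Submodule.span F (((Submodule.span F {v e}).mkQ ∘ v) '' C) =
        W.map (Submodule.span F {v e}).mkQ := by
      rw [Set.image_comp, hW, Submodule.map_span]
    obtain ⟨Γ, P, S, hs, hf, hS, ho, hP2, hP4⟩ := exists_form_of_contract
      (ih _ (by omega) (V ⧸ Submodule.span F {v e}) ((Submodule.span F {v e}).mkQ ∘ v) C _ rfl
        (span_range_mkQ_comp hv _) (hround.mkQ _) (by rw [hWm]; exact hΛ.map_mkQ hZW)
        (by rw [hWm, finrank_quotient_map_mkQ hZW]; exact hn)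
        (fun h => hO (HasObs.of_mkQ (C := {e}) (by rw [Set.image_singleton]) h)))
    -- The exceptional subspace has dimension at most 4, so at most 8 vectors of `Λ` cover it.
    obtain ⟨B, hBΛ, hBc, hPB⟩ := hΛ.spans.exists_finset (P ⊔ Submodule.span F S)
    set Y := W ⊔ Submodule.span F (B : Set V) with hY
    have hPY : P ⊔ Submodule.span F S ≤ Y := hPB.trans le_sup_right
    have hΛY : IsCore ω v Λ Y := hΛ.sup_span hω hBΛ
    have hfY : KForm ω Γ Y := hf.of_gen hω hS hPY ho hΛY.gen
    have hoY : OffForm v Γ Y := ho.mono hPY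
    have hcore : IsCore ω v Γ Y := hΛY.of_offForm hω hs hfY hoY
    have hcod : Module.finrank F (V ⧸ W) ≤ Module.finrank F (V ⧸ Y) + 8 := by
      have h1 := Submodule.finrank_add_le_finrank_add_finrank W (Submodule.span F (B : Set V))
      have h2 := finrank_span_finset_le_card (R := F) B
      have h4 := Y.finrank_quotient_add_finrank
      rw [Set.finrank] at h2
      rw [← hY] at h1
      omega
    -- dim_K `Γ` ≤ dim `V` + 2, so the form shrinks at most twice, each time at the cost of `k + 1`
    -- in codimension. From `3k + 14` there remains at least `3k + 14 - 8 - 2(k + 1) = k + 4`.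
    have hfr := hf.finrank_le hω
    obtain ⟨Γ₁, Y₁, h₁, ho₁, ha₁, hcod₁⟩ := IsCore.exists_formAbundant hω hround (k + 1) 2 Γ Y hcore
      hoY (by omega) (by omega)
    exact h₁.isHat_or_isBar hK hF hq hω hv ho₁ ha₁ (by omega) hck hO

end Main

/-! ### The fundamental theorem of projective geometry -/

section FundamentalTheorem

variable {K : Type*} [Field K] {F : Type*} [Field F]
  {A : Type*} [AddCommGroup A] [Module K A] [FiniteDimensional K A]
  {U : Type*} [AddCommGroup U] [Module F U] [FiniteDimensional F U]

/-- The map `w` preserves the rank of all sets of vectors. -/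
def PreservesRank (K : Type*) [Field K] (F : Type*) [Field F] {A : Type*} [AddCommGroup A]
    [Module K A] {U : Type*} [AddCommGroup U] [Module F U] (w : A → U) : Prop :=
  ∀ S : Set A, Module.finrank F (Submodule.span F (w '' S)) =
    Module.finrank K (Submodule.span K S)

variable {w : A → U}

theorem PreservesRank.linearIndependent (hw : PreservesRank K F w) {ι : Type*} [Fintype ι]
    {a : ι → A} (ha : LinearIndependent K a) : LinearIndependent F (w ∘ a) := by
  rw [linearIndependent_iff_card_eq_finrank_span] at ha ⊢
  rw [ha, Set.finrank, Set.finrank, Set.range_comp, hw]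

theorem PreservesRank.pair (hw : PreservesRank K F w) {a b : A} (h : LinearIndependent K ![a, b]) :
    ∀ s t : F, s • w a + t • w b = 0 → s = 0 ∧ t = 0 := by
  have h1 := hw.linearIndependent h
  intro s t hst
  have := Fintype.linearIndependent_iff.1 h1 ![s, t] (by simpa [Fin.sum_univ_two] using hst)
  exact ⟨this 0, this 1⟩

theorem PreservesRank.triple (hw : PreservesRank K F w) {a b c : A}
    (h : LinearIndependent K ![a, b, c]) :
    ∀ s t r : F, s • w a + t • w b + r • w c = 0 → s = 0 ∧ t = 0 ∧ r = 0 := by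
  have h1 := hw.linearIndependent h
  intro s t r hst
  have := Fintype.linearIndependent_iff.1 h1 ![s, t, r] (by simpa [Fin.sum_univ_three] using hst)
  exact ⟨this 0, this 1, this 2⟩

theorem PreservesRank.mem_span (hw : PreservesRank K F w) {S : Set A} {c : A}
    (hc : c ∈ Submodule.span K S) : w c ∈ Submodule.span F (w '' S) := by
  have h1 : Submodule.span F (w '' S) ≤ Submodule.span F (w '' insert c S) :=
    Submodule.span_mono (Set.image_mono (Set.subset_insert _ _))
  have h2 := Submodule.eq_of_le_of_finrank_eq h1 (by
    rw [hw, hw, Submodule.span_insert_eq_span hc])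
  rw [h2]
  exact Submodule.subset_span ⟨c, Set.mem_insert _ _, rfl⟩

theorem PreservesRank.exists_pair (hw : PreservesRank K F w) {a b c : A}
    (hc : c ∈ Submodule.span K {a, b}) : ∃ s t : F, s • w a + t • w b = w c := by
  have := hw.mem_span hc
  rwa [Set.image_pair, Submodule.mem_span_pair] at this

theorem PreservesRank.ne_zero (hw : PreservesRank K F w) {a : A} (ha : a ≠ 0) : w a ≠ 0 := by
  have h1 := hw {a}
  rw [Set.image_singleton, finrank_span_singleton ha] at h1
  intro h0
  rw [h0, Submodule.span_zero_singleton, finrank_bot] at h1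
  exact zero_ne_one h1

theorem linearIndependent_pair_add {a b : A} (h : LinearIndependent K ![a, b]) :
    LinearIndependent K ![a + b, b] := by
  rw [LinearIndependent.pair_iff] at h ⊢
  intro s t hst
  obtain ⟨h1, h2⟩ := h s (s + t) (by rw [← hst]; module)
  exact ⟨h1, by rwa [h1, zero_add] at h2⟩

theorem linearIndependent_pair_swap {a b : A} (h : LinearIndependent K ![a, b]) :
    LinearIndependent K ![b, a] := by
  rw [LinearIndependent.pair_iff] at h ⊢
  intro s t hst
  exact (h t s (by rwa [add_comm])).symm

theorem PreservesRank.exists_scale (hw : PreservesRank K F w) {a b : A}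
    (h : LinearIndependent K ![a, b]) :
    ∃ s t : F, s ≠ 0 ∧ t ≠ 0 ∧ s • w a + w b = t • w (a + b) := by
  obtain ⟨α, β, hαβ⟩ := hw.exists_pair (a := a) (b := b) (c := a + b)
    (add_mem (Submodule.subset_span (by simp)) (Submodule.subset_span (by simp)))
  have hα : α ≠ 0 := by
    rintro rfl
    have := (hw.pair (linearIndependent_pair_add h) 1 (-β) (by rw [← hαβ]; module)).1
    exact one_ne_zero this
  have hβ : β ≠ 0 := by
    rintro rfl
    have h' := linearIndependent_pair_add (linearIndependent_pair_swap h)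
    rw [add_comm b a] at h'
    have := (hw.pair h' 1 (-α) (by rw [← hαβ]; module)).1
    exact one_ne_zero this
  refine ⟨β⁻¹ * α, β⁻¹, mul_ne_zero (inv_ne_zero hβ) hα, inv_ne_zero hβ, ?_⟩
  rw [← hαβ, smul_add, smul_smul, inv_smul_smul₀ hβ]

/-- The point `a + b + c` is on the line through `a + c` and `b`, the line through `b + c` and `a`,
and the line through `a + b` and `c`. Comparing coordinates with respect to `w a, w b, w c` shows
that scaling relative to `c` is additive. -/
theorem PreservesRank.add_eq (hw : PreservesRank K F w) {a b c : A}
    (h : LinearIndependent K ![a, b, c]) {sa ta sb tb s t : F} (hta : ta ≠ 0) (htb : tb ≠ 0)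
    (ha : sa • w a + w c = ta • w (a + c)) (hb : sb • w b + w c = tb • w (b + c))
    (hab : s • w (a + b) + w c = t • w (a + b + c)) :
    s • w (a + b) = sa • w a + sb • w b := by
  have hli := hw.triple h
  have m : ∀ y z : A, y + z ∈ Submodule.span K {y, z} := fun y z =>
    add_mem (Submodule.subset_span (by simp)) (Submodule.subset_span (by simp))
  obtain ⟨x, y, hxy⟩ := hw.exists_pair (m (a + c) b)
  obtain ⟨x', y', hxy'⟩ := hw.exists_pair (m (b + c) a)
  obtain ⟨α, β, hαβ⟩ := hw.exists_pair (m a b)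
  have ha' : w (a + c) = ta⁻¹ • (sa • w a + w c) := by rw [ha, inv_smul_smul₀ hta]
  have hb' : w (b + c) = tb⁻¹ • (sb • w b + w c) := by rw [hb, inv_smul_smul₀ htb]
  rw [ha', show a + c + b = a + b + c by abel] at hxy
  rw [hb', show b + c + a = a + b + c by abel] at hxy'
  obtain ⟨h1, h2, h3⟩ := hli (x * ta⁻¹ * sa - y') (y - x' * tb⁻¹ * sb) (x * ta⁻¹ - x' * tb⁻¹) (by
    rw [← sub_eq_zero.2 (hxy.trans hxy'.symm)]
    module)
  rw [← hαβ, ← hxy] at hab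
  obtain ⟨h4, h5, h6⟩ := hli (s * α - t * (x * ta⁻¹ * sa)) (s * β - t * y) (1 - t * (x * ta⁻¹)) (by
    rw [← sub_eq_zero.2 hab]
    module)
  rw [← hαβ]
  have e1 : s * α = sa := by linear_combination h4 - sa * h6
  have e2 : s * β = sb := by
    linear_combination h5 - sb * h6 + t * h2 - t * sb * h3
  rw [smul_add, smul_smul, smul_smul, e1, e2]

theorem exists_triple_of_two_lt_finrank (hA : 3 ≤ Module.finrank K A) (a b : A) :
    ∃ c, c ∉ Submodule.span K {a, b} := by
  classical
  by_contra hcon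
  push Not at hcon
  have h1 : Submodule.span K {a, b} = ⊤ := by
    rw [eq_top_iff]; exact fun x _ => hcon x
  have h2 := finrank_span_le_card (R := K) ({a, b} : Set A)
  rw [h1, finrank_top, Set.toFinset_insert, Set.toFinset_singleton] at h2
  have := Finset.card_le_two (a := a) (b := b)
  omega

theorem linearIndependent_triple_of_ind2 {a b c : A} (hc : c ≠ 0)
    (h : Ind2 (Submodule.span K {c}) a b) : LinearIndependent K ![a, b, c] := by
  refine linearIndependent_triple (fun s t hst => h s t (by rw [hst]; exact zero_mem _)) ?_
  intro hmem
  obtain ⟨s, t, hst⟩ := Submodule.mem_span_pair.1 hmem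
  obtain ⟨rfl, rfl⟩ := h s t (by rw [hst]; exact Submodule.mem_span_singleton_self c)
  simp at hst
  exact hc hst.symm

/-- The additive part of the fundamental theorem of projective geometry. -/
theorem PreservesRank.exists_addMonoidHom (hw : PreservesRank K F w) (hA : 3 ≤ Module.finrank K A) :
    ∃ g : A →+ U, ∀ a, a ≠ 0 → ∃ s : F, s ≠ 0 ∧ g a = s • w a := by
  have : Nontrivial A := Module.nontrivial_of_finrank_pos (R := K) (by omega)
  obtain ⟨c, hc⟩ := exists_ne (0 : A)
  set y := Submodule.span K {c} with hy
  have hpair : ∀ a, a ∉ y → LinearIndependent K ![a, c] := fun a ha =>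
    linearIndependent_pair_swap (linearIndependent_pair_of_notMem hc ha)
  -- Normalize `w a` so that adding `w c` gives a multiple of `w (a + c)`.
  choose! s t hs ht hst using fun a (ha : a ∉ y) => hw.exists_scale (hpair a ha)
  obtain ⟨g, hg⟩ := exists_addMonoidHom_eq_of_additive_off y (fun a ha => by
    obtain ⟨b, hb⟩ := exists_triple_of_two_lt_finrank hA c a
    refine ⟨b, ind2_of_notMem ha ?_⟩
    rwa [hy, ← Submodule.span_union, Set.singleton_union]) (fun a => s a • w a) (fun a b hab => by
      have ha := hab.left_notMem
      have hb := hab.symm.left_notMem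
      exact hw.add_eq (linearIndependent_triple_of_ind2 hc hab) (ht a ha) (ht b hb) (hst a ha)
        (hst b hb) (hst _ hab.add_notMem))
  refine ⟨g, fun a ha => ?_⟩
  by_cases hay : a ∈ y
  swap
  · exact ⟨s a, hs a hay, hg a hay⟩
  obtain ⟨b, hb⟩ := exists_triple_of_two_lt_finrank hA c c
  rw [Set.pair_eq_singleton] at hb
  obtain ⟨b', hb'⟩ := exists_triple_of_two_lt_finrank hA c b
  have hb'y : b' ∉ y := fun h => hb' (Submodule.span_mono (by simp) h)
  obtain ⟨k, rfl⟩ := Submodule.mem_span_singleton.1 hay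
  have hk : k ≠ 0 := by rintro rfl; simp at ha
  have hspan : y = Submodule.span K {k • c} :=
    (Submodule.span_singleton_smul_eq (IsUnit.mk0 k hk) c).symm
  have hli : ∀ d, d ∉ y → LinearIndependent K ![k • c, d] := fun d hd =>
    linearIndependent_pair_of_notMem ha (by rwa [← hspan])
  -- On `y` nothing is known about `g` directly. For every `d` outside `y` its value is on the line
  -- through `w (k • c)` and `w d`; two independent choices of `d` leave only the multiples of `w (k
  -- • c)`.
  have hmem : ∀ d, d ∉ y → ∃ p r : F, g (k • c) = p • w (k • c) + r • w d := by
    intro d hd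
    have hd' : k • c + d ∉ y := fun h => hd (by
      have := sub_mem h hay; rwa [add_sub_cancel_left] at this)
    obtain ⟨p, r, hpr⟩ := hw.exists_pair (a := k • c) (b := d) (c := k • c + d)
      (add_mem (Submodule.subset_span (by simp)) (Submodule.subset_span (by simp)))
    refine ⟨s (k • c + d) * p, s (k • c + d) * r - s d, ?_⟩
    have h1 : g (k • c) = g (k • c + d) - g d := by rw [map_add, add_sub_cancel_right]
    rw [h1, hg _ hd', hg _ hd, ← hpr]
    module
  obtain ⟨p, r, hpr⟩ := hmem b hb
  obtain ⟨p', r', hpr'⟩ := hmem b' hb'y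
  have h3 : LinearIndependent K ![k • c, b, b'] := by
    refine linearIndependent_triple (LinearIndependent.pair_iff.1 (hli b hb)) fun h => hb' ?_
    refine Submodule.span_le.2 ?_ h
    rintro z (rfl | rfl)
    · exact Submodule.smul_mem _ _ (Submodule.subset_span (by simp))
    · exact Submodule.subset_span (by simp)
  obtain ⟨-, hr, -⟩ := hw.triple h3 (p - p') r (-r') (by
    rw [← sub_eq_zero.2 (hpr.symm.trans hpr')]
    module)
  rw [hr, zero_smul, add_zero] at hpr
  refine ⟨p, ?_, hpr⟩
  rintro rfl
  have hd' : k • c + b ∉ y := fun h => hb (by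
    have := sub_mem h hay; rwa [add_sub_cancel_left] at this)
  have h4 : g (k • c + b) = g b := by rw [map_add, hpr, zero_smul, zero_add]
  rw [hg _ hd', hg _ hb] at h4
  have := (hw.pair (linearIndependent_pair_add (hli b hb)) (s (k • c + b)) (-s b) (by
    rw [h4]; module)).1
  exact hs _ hd' this

/-- Either image is the set of all roots of `X ^ |K| - X` in `F`. -/
theorem range_ringHom_eq_of_finite [Finite K] (σ τ : K →+* F) : Set.range σ = Set.range τ := by
  classical
  cases nonempty_fintype K
  have h1 : 1 < Fintype.card K := Fintype.one_lt_card
  have key : ∀ σ : K →+* F, Finset.univ.image σ =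
      (Polynomial.X ^ Fintype.card K - Polynomial.X : Polynomial F).roots.toFinset := by
    intro σ
    apply Finset.eq_of_subset_of_card_le
    · intro x hx
      obtain ⟨k, -, rfl⟩ := Finset.mem_image.1 hx
      rw [Multiset.mem_toFinset, Polynomial.mem_roots (FiniteField.X_pow_card_sub_X_ne_zero F h1)]
      simp [← map_pow, FiniteField.pow_card]
    · rw [Finset.card_image_of_injective _ σ.injective, Finset.card_univ]
      refine (Multiset.toFinset_card_le _).trans ((Polynomial.card_roots' _).trans ?_)
      rw [FiniteField.X_pow_card_sub_X_natDegree_eq F h1]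
  have h2 := congrArg (fun s : Finset F => (s : Set F)) ((key σ).trans (key τ).symm)
  simpa using h2

/-- `g` multiplies each `k • a` by a scalar. Evaluating at `a + b` shows that independent vectors
have the same scalar; dependent ones are compared through a third vector. -/
theorem PreservesRank.exists_ringHom (hw : PreservesRank K F w) (hA : 3 ≤ Module.finrank K A)
    {g : A →+ U} (hg : ∀ a, a ≠ 0 → ∃ s : F, s ≠ 0 ∧ g a = s • w a) :
    ∃ σ : K →+* F, ∀ (k : K) (a : A), g (k • a) = σ k • g a := by
  have hpair : ∀ a b, LinearIndependent K ![a, b] → ∀ s t : F, s • g a + t • g b = 0 →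
      s = 0 ∧ t = 0 := by
    intro a b hab s t hst
    obtain ⟨s', hs', ha⟩ := hg a (hab.ne_zero 0)
    obtain ⟨t', ht', hb⟩ := hg b (hab.ne_zero 1)
    rw [ha, hb, smul_smul, smul_smul] at hst
    obtain ⟨h1, h2⟩ := hw.pair hab _ _ hst
    exact ⟨(mul_eq_zero.1 h1).resolve_right hs', (mul_eq_zero.1 h2).resolve_right ht'⟩
  have hex : ∀ (k : K) (a : A), ∃ c : F, g (k • a) = c • g a := by
    intro k a
    by_cases ha : k • a = 0
    · exact ⟨0, by rw [ha, map_zero, zero_smul]⟩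
    have ha0 : a ≠ 0 := by rintro rfl; simp at ha
    obtain ⟨s, hs, h1⟩ := hg _ ha
    obtain ⟨s', hs', h2⟩ := hg a ha0
    have h3 := hw.mem_span (S := {a}) (Submodule.smul_mem _ k (Submodule.mem_span_singleton_self a))
    rw [Set.image_singleton, Submodule.mem_span_singleton] at h3
    obtain ⟨c, hc⟩ := h3
    refine ⟨s * c * s'⁻¹, ?_⟩
    rw [h1, h2, ← hc, smul_smul, smul_smul, inv_mul_cancel_right₀ hs']
  choose σ' hσ' using hex
  have hind : ∀ k a b, LinearIndependent K ![a, b] → σ' k a = σ' k b := by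
    intro k a b hab
    have h1 : σ' k (a + b) • (g a + g b) = σ' k a • g a + σ' k b • g b := by
      rw [← map_add, ← hσ', smul_add, map_add, hσ', hσ']
    obtain ⟨h2, h3⟩ := hpair a b hab (σ' k (a + b) - σ' k a) (σ' k (a + b) - σ' k b) (by
      rw [← sub_eq_zero.2 h1]; module)
    rw [← sub_eq_zero.1 h2, sub_eq_zero.1 h3]
  have : Nontrivial A := Module.nontrivial_of_finrank_pos (R := K) (by omega)
  obtain ⟨c, hc⟩ := exists_ne (0 : A)
  have hall : ∀ k a, g (k • a) = σ' k c • g a := by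
    intro k a
    by_cases ha : a = 0
    · simp [ha]
    obtain ⟨d, hd⟩ := exists_triple_of_two_lt_finrank hA c a
    have h1 : LinearIndependent K ![c, d] := linearIndependent_pair_of_notMem hc fun h =>
      hd (Submodule.span_mono (by simp) h)
    have h2 : LinearIndependent K ![a, d] := linearIndependent_pair_of_notMem ha fun h =>
      hd (Submodule.span_mono (by simp) h)
    rw [hσ', hind k a d h2, hind k c d h1]
  have hgc : g c ≠ 0 := by
    obtain ⟨s, hs, h1⟩ := hg c hc
    rw [h1]
    exact smul_ne_zero hs (hw.ne_zero hc)
  have hinj := smul_left_injective F hgc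
  refine ⟨{ toFun := fun k => σ' k c, map_one' := ?_, map_mul' := ?_, map_zero' := ?_,
            map_add' := ?_ }, hall⟩
  · apply hinj
    change σ' 1 c • g c = (1 : F) • g c
    rw [← hall, one_smul, one_smul]
  · intro k l
    apply hinj
    change σ' (k * l) c • g c = (σ' k c * σ' l c) • g c
    rw [← hall, mul_smul, hall, hall, smul_smul]
  · apply hinj
    change σ' 0 c • g c = (0 : F) • g c
    rw [← hall, zero_smul, zero_smul, map_zero]
  · intro k l
    apply hinj
    change σ' (k + l) c • g c = (σ' k c + σ' l c) • g c
    rw [← hall, add_smul, map_add, hall, hall, add_smul]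

/-- The fundamental theorem of projective geometry, for representations of a projective geometry over
a finite field. -/
theorem PreservesRank.exists_kform [Finite K] [Algebra K F] [Module K U] [IsScalarTower K F U] {ω : F}
    (hω : IsQuadGen K ω) (hw : PreservesRank K F w) (hA : 3 ≤ Module.finrank K A)
    (hsp : Submodule.span F (Set.range w) = ⊤) :
    ∃ Λ : Submodule K U, Spans ω Λ ∧ KForm ω Λ ⊥ ∧
      ∀ γ ∈ Λ, γ ≠ 0 → ∃ a, a ≠ 0 ∧ ∃ f : F, f ≠ 0 ∧ f • w a = γ := by
  obtain ⟨g, hg⟩ := hw.exists_addMonoidHom hA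
  obtain ⟨σ, hσ⟩ := hw.exists_ringHom hA hg
  have hrange := range_ringHom_eq_of_finite σ (algebraMap K F)
  -- The range of `g` is closed under the given action of `K`, although `σ` need not be
  -- `algebraMap`, because both have the same image.
  let Λ : Submodule K U :=
    { g.range with
      smul_mem' := by
        rintro k _ ⟨a, rfl⟩
        obtain ⟨l, hl⟩ : algebraMap K F k ∈ Set.range σ := hrange ▸ ⟨k, rfl⟩
        refine ⟨l • a, ?_⟩
        rw [hσ, hl, algebraMap_smul] }
  have hmem : ∀ x, x ∈ Λ ↔ ∃ a, g a = x := fun x => Iff.rfl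
  have hne : ∀ a, a ≠ 0 → g a ≠ 0 := by
    intro a ha
    obtain ⟨s, hs, h1⟩ := hg a ha
    rw [h1]
    exact smul_ne_zero hs (hw.ne_zero ha)
  refine ⟨Λ, spans_of_span_eq_top hω ?_, ?_, ?_⟩
  · rw [eq_top_iff, ← hsp, Submodule.span_le]
    rintro _ ⟨a, rfl⟩
    by_cases ha : a = 0
    · have h0 : w a = 0 := by
        have h1 := hw {a}
        rw [ha, Set.image_singleton, Submodule.span_zero_singleton, finrank_bot] at h1
        rw [ha]
        by_contra h2
        rw [finrank_span_singleton h2] at h1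
        exact one_ne_zero h1
      rw [h0]
      exact zero_mem _
    · obtain ⟨s, hs, h1⟩ := hg a ha
      have : s • w a ∈ Submodule.span F (Λ : Set U) := Submodule.subset_span ⟨a, h1⟩
      exact (Submodule.smul_mem_iff _ hs).1 this
  · rintro _ ⟨a, rfl⟩ _ ⟨b, rfl⟩ hab
    rw [Submodule.mem_bot] at hab ⊢
    rw [Submodule.mem_bot]
    change g a + ω • g b = 0 at hab
    change g a = 0 ∧ g b = 0
    by_cases hb : b = 0
    · rw [hb, map_zero, smul_zero, add_zero] at hab
      rw [hb, map_zero]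
      exact ⟨hab, rfl⟩
    by_cases hab' : a ∈ Submodule.span K {b}
    · obtain ⟨k, rfl⟩ := Submodule.mem_span_singleton.1 hab'
      rw [hσ, ← add_smul] at hab
      obtain ⟨l, hl⟩ : σ k ∈ Set.range (algebraMap K F) := hrange ▸ ⟨k, rfl⟩
      rcases smul_eq_zero.1 hab with h | h
      · rw [← hl] at h
        exact absurd (hω.eq_zero (s := l) (t := 1) (by rwa [map_one, mul_one])).2 one_ne_zero
      · exact absurd h (hne b hb)
    · have hli := linearIndependent_pair_swap (linearIndependent_pair_of_notMem hb hab')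
      obtain ⟨s, hs, h1⟩ := hg a (hli.ne_zero 0)
      obtain ⟨t, ht, h2⟩ := hg b hb
      rw [h1, h2, smul_smul] at hab
      exact absurd (hw.pair hli _ _ hab).1 hs
  · rintro _ ⟨a, rfl⟩ h0
    change g a ≠ 0 at h0
    have ha : a ≠ 0 := by rintro rfl; simp at h0
    obtain ⟨s, hs, h1⟩ := hg a ha
    exact ⟨a, ha, s, hs, h1.symm⟩

end FundamentalTheorem

/-! ### From a projective geometry minor to a core -/

section Geometry

variable {K : Type*} [Field K] {F : Type*} [Field F]
  {U : Type*} [AddCommGroup U] [Module F U] {n : ℕ}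

open Classical in
/-- The extension of a map on the points of a projective space to all vectors. -/
noncomputable def vectorMap (u : ℙ K (Fin n → K) → U) (a : Fin n → K) : U :=
  if h : a = 0 then 0 else u (Projectivization.mk K a h)

theorem preservesRank_vectorMap {u : ℙ K (Fin n → K) → U}
    (hu : ∀ X, Module.finrank F (Submodule.span F (u '' X)) = pgRk K X) :
    PreservesRank K F (vectorMap u) := by
  intro S
  set X : Set (ℙ K (Fin n → K)) := {p | ∃ a ∈ S, ∃ h : a ≠ 0, p = Projectivization.mk K a h}
  have h1 : Submodule.span F (vectorMap u '' S) = Submodule.span F (u '' X) := by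
    apply le_antisymm <;> rw [Submodule.span_le]
    · rintro _ ⟨a, ha, rfl⟩
      by_cases h : a = 0
      · rw [vectorMap, dif_pos h]; exact zero_mem _
      · rw [vectorMap, dif_neg h]
        exact Submodule.subset_span ⟨_, ⟨a, ha, h, rfl⟩, rfl⟩
    · rintro _ ⟨_, ⟨a, ha, h, rfl⟩, rfl⟩
      refine Submodule.subset_span ⟨a, ha, ?_⟩
      rw [vectorMap, dif_neg h]
  have h2 : (⨆ p ∈ X, p.submodule : Submodule K (Fin n → K)) = Submodule.span K S := by
    apply le_antisymm
    · refine iSup₂_le ?_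
      rintro _ ⟨a, ha, h, rfl⟩
      rw [Projectivization.submodule_mk, Submodule.span_singleton_le_iff_mem]
      exact Submodule.subset_span ha
    · rw [Submodule.span_le]
      intro a ha
      by_cases h : a = 0
      · rw [h]; exact zero_mem _
      · refine Submodule.mem_iSup_of_mem (Projectivization.mk K a h)
          (Submodule.mem_iSup_of_mem ⟨a, ha, h, rfl⟩ ?_)
        rw [Projectivization.submodule_mk]
        exact Submodule.mem_span_singleton_self a
  rw [h1, hu, pgRk, h2]

theorem finrank_map_of_disjoint_ker {V V' : Type*} [AddCommGroup V] [Module F V] [AddCommGroup V']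
    [Module F V'] (f : V →ₗ[F] V') (S : Submodule F V) (h : Disjoint S (LinearMap.ker f)) :
    Module.finrank F (S.map f) = Module.finrank F S := by
  have h1 : Function.Injective (f.domRestrict S) := by
    rw [← LinearMap.ker_eq_bot, LinearMap.ker_eq_bot']
    intro x hx
    rw [Submodule.disjoint_def] at h
    exact Subtype.ext (h x x.2 hx)
  rw [← LinearMap.finrank_range_of_inj h1, LinearMap.range_domRestrict]

/-- A projective geometry minor yields a contraction that is a projective geometry up to additional
elements. -/
theorem exists_isCore_of_hasPGMinor {V : Type*} [AddCommGroup V] [Module F V] [Finite V] [Algebra K F]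
    [Module K V] [IsScalarTower K F V] [Finite K] {E : Type*} [Finite E] {ω : F}
    (hω : IsQuadGen K ω) {v : E → V} (hv : Submodule.span F (Set.range v) = ⊤) (hn : 3 ≤ n)
    (h : (RepMatroid.vecRep F v).HasPGMinor K n) :
    ∃ (C : Set E) (Λ : Submodule K V), IsCore ω v Λ (Submodule.span F (v '' C)) ∧
      Module.finrank F (V ⧸ Submodule.span F (v '' C)) = n := by
  obtain ⟨C, D, φ, hφ⟩ := h
  set Z := Submodule.span F (v '' C) with hZ
  have hu : ∀ X, Module.finrank F
      (Submodule.span F ((fun p => Z.mkQ (v (φ.symm p).1.1)) '' X)) = pgRk K X := by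
    intro X
    have h1 := hφ (φ.symm '' X)
    rw [RepMatroid.vecRep_contract, RepMatroid.delete, RepMatroid.restrict,
      RepMatroid.vecRep_pullback, RepMatroid.rk_vecRep, Equiv.image_symm_image,
      ← Set.image_comp] at h1
    exact h1
  set R := Submodule.span F (Set.range fun p => Z.mkQ (v (φ.symm p).1.1)) with hR
  -- The elements of the geometry need not span after contracting `C`. Contracting a complement of
  -- their span as well makes them spanning and preserves their ranks.
  obtain ⟨C', -, hC'⟩ := exists_isCompl_span (span_range_mkQ_comp hv Z) R (S₀ := ∅) (by simp)
  set N := Submodule.span F ((Z.mkQ ∘ v) '' C') with hN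
  set W := Submodule.span F (v '' (C ∪ C')) with hW
  have hWN : W = N.comap Z.mkQ := by
    rw [hW, hN, Set.image_comp, ← Submodule.map_span, Submodule.comap_map_mkQ, Set.image_union,
      Submodule.span_union]
  have hZW : Z ≤ W := Submodule.span_mono (Set.image_mono Set.subset_union_left)
  let θ : V ⧸ Z →ₗ[F] V ⧸ W := Submodule.factor hZW
  have hθ : ∀ x : V, θ (Z.mkQ x) = W.mkQ x := fun x => rfl
  have hker : LinearMap.ker θ = N := by
    ext x
    obtain ⟨x, rfl⟩ := Z.mkQ_surjective x
    rw [LinearMap.mem_ker, hθ, Submodule.mkQ_apply, Submodule.Quotient.mk_eq_zero, hWN,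
      Submodule.mem_comap]
  have himg : ∀ X, (fun p => W.mkQ (v (φ.symm p).1.1)) '' X =
      θ '' ((fun p => Z.mkQ (v (φ.symm p).1.1)) '' X) := by
    intro X
    rw [← Set.image_comp]
    rfl
  have hu' : ∀ X, Module.finrank F
      (Submodule.span F ((fun p => W.mkQ (v (φ.symm p).1.1)) '' X)) = pgRk K X := by
    intro X
    rw [himg, ← Submodule.map_span, finrank_map_of_disjoint_ker, hu]
    rw [hker]
    exact hC'.disjoint.mono_left (Submodule.span_mono (Set.image_subset_range _ _))
  have hRW : Submodule.span F (Set.range fun p => W.mkQ (v (φ.symm p).1.1)) = ⊤ := by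
    rw [← Set.image_univ, himg, ← Submodule.map_span, Set.image_univ, ← hR]
    have h1 : (R ⊔ N).map θ = ⊤ := by
      rw [hC'.sup_eq_top, Submodule.map_top, LinearMap.range_eq_top]
      intro y
      obtain ⟨x, rfl⟩ := W.mkQ_surjective y
      exact ⟨Z.mkQ x, rfl⟩
    rwa [Submodule.map_sup, ← hker, (LinearMap.le_ker_iff_map).1 le_rfl, sup_bot_eq] at h1
  have : Finite (V ⧸ W) := Finite.of_surjective _ W.mkQ_surjective
  have hpr := preservesRank_vectorMap hu'
  have hfr : Module.finrank F (V ⧸ W) = n := by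
    have h1 := hu' Set.univ
    rw [Set.image_univ, hRW, finrank_top] at h1
    have h2 := hpr Set.univ
    rw [Submodule.span_univ, finrank_top, Module.finrank_fin_fun] at h2
    rw [← h2]
    refine le_antisymm ?_ (Submodule.finrank_le _)
    have h3 : (⊤ : Submodule F (V ⧸ W)) ≤
        Submodule.span F (vectorMap (fun p => W.mkQ (v (φ.symm p).1.1)) '' Set.univ) := by
      rw [← hRW, Submodule.span_le]
      rintro _ ⟨p, rfl⟩
      induction p using Projectivization.ind with
      | h a ha =>
        refine Submodule.subset_span ⟨a, Set.mem_univ _, ?_⟩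
        rw [vectorMap, dif_neg ha]
    have := Submodule.finrank_mono h3
    rwa [finrank_top] at this
  have hsp : Submodule.span F (Set.range (vectorMap fun p => W.mkQ (v (φ.symm p).1.1))) = ⊤ := by
    rw [← Set.image_univ]
    apply Submodule.eq_top_of_finrank_eq
    rw [hpr, Submodule.span_univ, finrank_top, Module.finrank_fin_fun, hfr]
  obtain ⟨Λ, hs, hf, hpt⟩ := hpr.exists_kform hω (by rwa [Module.finrank_fin_fun]) hsp
  refine ⟨C ∪ C', Λ.comap (W.mkQ.restrictScalars K), ⟨hs.comap_mkQ, ?_, ?_, ?_⟩, hfr⟩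
  · have := hf.comap_mkQ
    rwa [← LinearMap.ker, Submodule.ker_mkQ] at this
  · intro γ hγ hγW
    obtain ⟨a, ha, f, hf, hfa⟩ := hpt (W.mkQ γ) hγ (by
      rwa [Submodule.mkQ_apply, Ne, Submodule.Quotient.mk_eq_zero])
    rw [vectorMap, dif_neg ha] at hfa
    refine ⟨(φ.symm (Projectivization.mk K a ha)).1.1, f, hf, ?_⟩
    rw [← Submodule.Quotient.mk_eq_zero, ← Submodule.mkQ_apply, map_sub, map_smul, sub_eq_zero]
    exact hfa
  · refine Submodule.span_mono (Set.image_mono fun e he => ?_)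
    exact Submodule.subset_span ⟨e, he, rfl⟩

end Geometry

/-! ### Coordinates: from the two structures to the two matrices -/

section Matrices

variable {K : Type*} [Field K]

theorem pgRk_singleton {A : Type*} [AddCommGroup A] [Module K A] (p : ℙ K A) : pgRk K {p} = 1 := by
  rw [pgRk, iSup_singleton]
  exact p.finrank_submodule

theorem eq_of_pgRk_pair {A : Type*} [AddCommGroup A] [Module K A] [FiniteDimensional K A]
    {p p' : ℙ K A} (h : pgRk K {p, p'} = 1) : p = p' := by
  rw [pgRk, iSup_pair] at h
  apply Projectivization.submodule_injective
  have h1 := Submodule.eq_of_le_of_finrank_eq (le_sup_left : p.submodule ≤ p.submodule ⊔ p'.submodule)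
    (by rw [h, p.finrank_submodule])
  have h2 := Submodule.eq_of_le_of_finrank_eq
    (le_sup_right : p'.submodule ≤ p.submodule ⊔ p'.submodule) (by rw [h, p'.finrank_submodule])
  exact h1.trans h2.symm

/-- The isomorphism is only an abstract one, but it shows that the columns are pairwise non-parallel
and as numerous as the points, so by finiteness every point occurs. -/
theorem IsPGMatrix.exists_smul_col [Finite K] {m : ℕ} {κ : Type*} {A : Matrix (Fin m) κ K}
    (hA : IsPGMatrix A) {a : Fin m → K} (ha : a ≠ 0) : ∃ (j : κ) (c : Kˣ), (c : K) • A.col j = a := by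
  obtain ⟨φ, hφ⟩ := hA
  simp only [RepMatroid.ofMatrix_eq_vecRep, RepMatroid.rk_vecRep] at hφ
  have hne : ∀ j, A.col j ≠ 0 := by
    intro j h0
    have h1 := hφ {j}
    rw [Set.image_singleton, Set.image_singleton, pgRk_singleton, h0, Submodule.span_zero_singleton,
      finrank_bot] at h1
    exact zero_ne_one h1
  have hinj : Function.Injective fun p => Projectivization.mk K (A.col (φ.symm p)) (hne _) := by
    intro p p' h
    have h1 := hφ {φ.symm p, φ.symm p'}
    rw [Set.image_pair, Set.image_pair, φ.apply_symm_apply, φ.apply_symm_apply] at h1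
    apply eq_of_pgRk_pair
    rw [← h1]
    obtain ⟨c, hc⟩ := (Projectivization.mk_eq_mk_iff' K _ _ (hne _) (hne _)).1 h
    rw [Submodule.span_insert_eq_span (by
      rw [← hc]; exact Submodule.smul_mem _ _ (Submodule.mem_span_singleton_self _)),
      finrank_span_singleton (hne _)]
  obtain ⟨p, hp⟩ := Finite.surjective_of_injective hinj (Projectivization.mk K a ha)
  obtain ⟨c, hc⟩ := (Projectivization.mk_eq_mk_iff K _ _ ha (hne (φ.symm p))).1 hp.symm
  exact ⟨_, c, hc⟩

variable {F : Type*} [Field F] [Algebra K F]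
  {V : Type*} [AddCommGroup V] [Module K V] [Module F V] [IsScalarTower K F V] {E : Type*}
  {ω : F} {v : E → V} {Γ : Submodule K V}

theorem formBasis_equivFun (hω : IsQuadGen K ω) (hs : Spans ω Γ) (hf : KForm ω Γ ⊥) {ι : Type*}
    [Fintype ι] (b : Module.Basis ι K Γ) (x : Γ) (i : ι) :
    (formBasis hω hs hf b).equivFun (x : V) i = algebraMap K F (b.equivFun x i) := by
  have h1 : (x : V) = ∑ i, algebraMap K F (b.equivFun x i) • formBasis hω hs hf b i := by
    have h2 := congrArg Subtype.val (b.sum_equivFun x)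
    rw [Submodule.coe_sum] at h2
    rw [← h2]
    simp [formBasis_apply]
  conv_lhs => rw [h1]
  rw [← (formBasis hω hs hf b).equivFun_symm_apply, LinearEquiv.apply_symm_apply]

/-- Elements sent to the same column are parallel, and a simplification set has only one element in
each parallel class; so the choice of columns is injective. -/
theorem projEquivToRestriction_of_cols [Finite V] {S : Set E}
    (hS : (RepMatroid.vecRep F v).IsSimplificationSet S) {ρ κ : Type*} [Fintype ρ]
    (A : Matrix ρ κ F) (L : V ≃ₗ[F] (ρ → F))
    (h : ∀ e, v e ≠ 0 → ∃ (j : κ) (d : Fˣ), A.col j = (d : F) • L (v e)) :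
    ((RepMatroid.vecRep F v).restrict S).ProjEquivToRestriction (RepMatroid.ofMatrix A) := by
  have hne : ∀ e ∈ S, v e ≠ 0 := by
    intro e he h0
    have h1 := hS.1 e he
    rw [RepMatroid.IsNonloop, RepMatroid.rk_vecRep, Set.image_singleton, h0,
      Submodule.span_zero_singleton, finrank_bot] at h1
    exact zero_ne_one h1
  choose φ d hd using fun e : S => h e (hne e e.2)
  refine ⟨⟨φ, ?_⟩, ?_⟩
  · intro e e' hee
    apply Subtype.ext
    refine hS.2.1 e e.2 e' e'.2 ⟨hS.1 e e.2, hS.1 e' e'.2, ?_⟩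
    have h1 : (d e : F) • v e = (d e' : F) • v e' := by
      apply L.injective
      rw [map_smul, map_smul, ← hd, ← hd, hee]
    rw [RepMatroid.rk_vecRep, Set.image_pair, Submodule.span_insert_eq_span,
      finrank_span_singleton (hne e' e'.2)]
    rw [← Submodule.smul_mem_iff _ (d e).ne_zero, h1]
    exact Submodule.smul_mem _ _ (Submodule.mem_span_singleton_self _)
  · rw [RepMatroid.ofMatrix_eq_vecRep, RepMatroid.vecRep_pullback, RepMatroid.restrict,
      RepMatroid.vecRep_pullback]
    exact RepMatroid.projEquiv_vecRep L _ _ d fun e => hd e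

theorem finrank_form (hω : IsQuadGen K ω) [Finite V] (hs : Spans ω Γ) (hf : KForm ω Γ ⊥) :
    Module.finrank K Γ = Module.finrank F V := by
  rw [Module.finrank_eq_card_basis (formBasis hω hs hf (Module.finBasis K Γ)), Fintype.card_fin]

/-- Coordinates adapted to a form that contains all multiples of `p`. -/
theorem exists_hat_coordinates [Finite V] (hω : IsQuadGen K ω) {p : V} (hp : p ≠ 0)
    (hs : Spans ω Γ) (hf : KForm ω Γ (Submodule.span F {p})) {m : ℕ}
    (hm : Module.finrank F V = m + 1) :
    ∃ L : V ≃ₗ[F] (Fin (m + 1) → F), L p = Fin.cons 1 0 ∧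
      ∀ γ ∈ Γ, ∃ (c : F) (a : Fin m → K), L γ = Fin.cons c fun i => algebraMap K F (a i) := by
  set P := Submodule.span F {p} with hP
  have : Finite (V ⧸ P) := Finite.of_surjective _ P.mkQ_surjective
  have hs' := hs.map_mkQ P
  have hf' := hf.map_mkQ le_rfl
  rw [Submodule.mkQ_map_self] at hf'
  have hfr : Module.finrank K (Γ.map (P.mkQ.restrictScalars K)) = m := by
    have h1 := P.finrank_quotient_add_finrank
    have h2 : Module.finrank F P = 1 := finrank_span_singleton hp
    rw [finrank_form hω hs' hf']
    omega
  let b := Module.finBasisOfFinrankEq K _ hfr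
  let β := formBasis hω hs' hf' b
  -- The first coordinate is any functional normalized on `p`; the others come from a basis of the
  -- form modulo `p`.
  obtain ⟨π, hπ⟩ : ∃ π : Module.Dual F V, π p = 1 := by
    obtain ⟨π, hπ⟩ : ∃ π : Module.Dual F V, π p ≠ 0 := by
      by_contra hcon
      push Not at hcon
      exact hp ((Module.forall_dual_apply_eq_zero_iff F p).1 hcon)
    exact ⟨(π p)⁻¹ • π, by simp [hπ]⟩
  let l : V →ₗ[F] (Fin (m + 1) → F) :=
    { toFun := fun x => Fin.cons (π x) (β.equivFun (P.mkQ x))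
      map_add' := by
        intro x y
        ext i
        refine Fin.cases ?_ (fun j => ?_) i <;> simp
      map_smul' := by
        intro c x
        ext i
        refine Fin.cases ?_ (fun j => ?_) i <;> simp }
  have hl : ∀ x, l x = Fin.cons (π x) (β.equivFun (P.mkQ x)) := fun x => rfl
  have hinj : Function.Injective l := by
    rw [← LinearMap.ker_eq_bot, LinearMap.ker_eq_bot']
    intro x hx
    rw [hl] at hx
    have h0 := congrFun hx 0
    have h1 : β.equivFun (P.mkQ x) = 0 := by
      ext i
      have := congrFun hx i.succ
      simpa using this
    rw [LinearEquiv.map_eq_zero_iff, Submodule.mkQ_apply, Submodule.Quotient.mk_eq_zero, hP,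
      Submodule.mem_span_singleton] at h1
    obtain ⟨c, rfl⟩ := h1
    simp [hπ] at h0
    rw [h0, zero_smul]
  refine ⟨LinearMap.linearEquivOfInjective l hinj (by rw [hm, Module.finrank_fin_fun]), ?_, ?_⟩
  · rw [LinearMap.linearEquivOfInjective_apply, hl, hπ]
    have h1 : P.mkQ p = 0 := by
      rw [Submodule.mkQ_apply, Submodule.Quotient.mk_eq_zero]
      exact Submodule.mem_span_singleton_self p
    rw [h1, map_zero]
  · intro γ hγ
    refine ⟨π γ, b.equivFun ⟨P.mkQ γ, γ, hγ, rfl⟩, ?_⟩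
    rw [LinearMap.linearEquivOfInjective_apply, hl]
    congr 1
    ext i
    exact formBasis_equivFun hω hs' hf' b ⟨P.mkQ γ, γ, hγ, rfl⟩ i

theorem IsHat.projEquivToRestriction [Finite K] [Finite V] (hω : IsQuadGen K ω) (h : IsHat K ω v)
    {S : Set E} (hS : (RepMatroid.vecRep F v).IsSimplificationSet S) {m : ℕ}
    (hm : Module.finrank F V = m + 1) {κ : Type*} {A : Matrix (Fin m) κ K} (hA : IsPGMatrix A) :
    ((RepMatroid.vecRep F v).restrict S).ProjEquivToRestriction
      (RepMatroid.ofMatrix (hatMatrix F A)) := by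
  obtain ⟨p, hp, Γ, -, hs, hf, hall⟩ := h
  obtain ⟨L, hLp, hL⟩ := exists_hat_coordinates hω hp hs hf hm
  refine projEquivToRestriction_of_cols hS _ L fun e he => ?_
  obtain ⟨f, hf0, hfe⟩ := hall e
  obtain ⟨c, a, hca⟩ := hL _ hfe
  rw [map_smul] at hca
  by_cases ha : a = 0
  · have hc : c ≠ 0 := by
      rintro rfl
      have h0 : f • L (v e) = 0 := by
        rw [hca, ha]
        ext i
        refine Fin.cases ?_ (fun j => ?_) i <;> simp
      rw [smul_eq_zero, LinearEquiv.map_eq_zero_iff] at h0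
      exact h0.elim hf0 he
    refine ⟨none, Units.mk0 (c⁻¹ * f) (mul_ne_zero (inv_ne_zero hc) hf0), ?_⟩
    rw [Units.val_mk0, mul_smul, hca, ha]
    ext i
    refine Fin.cases ?_ (fun j => ?_) i <;> simp [hatMatrix, Matrix.col, hc]
  · obtain ⟨j, k, hk⟩ := hA.exists_smul_col ha
    have hk0 : algebraMap K F (k : K) ≠ 0 := by simp
    refine ⟨some ((algebraMap K F (k : K))⁻¹ * c, j),
      Units.mk0 ((algebraMap K F (k : K))⁻¹ * f) (mul_ne_zero (inv_ne_zero hk0) hf0), ?_⟩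
    rw [Units.val_mk0, mul_smul, hca, ← hk]
    ext i
    refine Fin.cases ?_ (fun l => ?_) i
    · simp [hatMatrix, Matrix.col]
    · simp [hatMatrix, Matrix.col]

/-- Coordinates adapted to a form, with three prescribed basis vectors. -/
theorem exists_form_coordinates [Finite V] (hω : IsQuadGen K ω) (hs : Spans ω Γ)
    (hf : KForm ω Γ ⊥) {a b c : V} (ha : a ∈ Γ) (hb : b ∈ Γ) (hc : c ∈ Γ)
    (hli : LinearIndependent K ![a, b, c]) {r : ℕ} (hr : Module.finrank F V = r) :
    ∃ L : V ≃ₗ[F] (Fin r → F), (∀ i, L a i = if i.val = 0 then 1 else 0) ∧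
      (∀ i, L b i = if i.val = 1 then 1 else 0) ∧ (∀ i, L c i = if i.val = 2 then 1 else 0) ∧
      ∀ γ ∈ Γ, ∃ k : Fin r → K, L γ = fun i => algebraMap K F (k i) := by
  let u : Fin 3 → Γ := ![⟨a, ha⟩, ⟨b, hb⟩, ⟨c, hc⟩]
  have hu : LinearIndependent K u := by
    apply LinearIndependent.of_comp Γ.subtype
    convert hli using 1
    ext i
    fin_cases i <;> rfl
  let B := Module.Basis.sumExtend hu
  have hfin : Finite (Fin 3 ⊕ Module.Basis.sumExtendIndex hu) := Module.Finite.finite_basis B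
  have : Finite (Module.Basis.sumExtendIndex hu) :=
    Finite.of_injective (Sum.inr : _ → Fin 3 ⊕ Module.Basis.sumExtendIndex hu) Sum.inr_injective
  -- The prescribed vectors are listed first, so `a`, `b`, `c` receive the coordinates 0, 1, 2.
  let e : Fin 3 ⊕ Module.Basis.sumExtendIndex hu ≃ Fin (3 + Nat.card (Module.Basis.sumExtendIndex hu)) :=
    (Equiv.sumCongr (Equiv.refl _) (Finite.equivFin _)).trans finSumFinEquiv
  have hcard : 3 + Nat.card (Module.Basis.sumExtendIndex hu) = r := by
    rw [← hr, ← finrank_form hω hs hf, Module.finrank_eq_card_basis (B.reindex e), Fintype.card_fin]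
  let b' := (B.reindex e).reindex (finCongr hcard)
  have hL : ∀ (j : Fin 3) (i : Fin r), (formBasis hω hs hf b').equivFun (u j : V) i =
      if i.val = j.val then 1 else 0 := by
    intro j i
    have h1 : b' (finCongr hcard (e (Sum.inl j))) = u j := by
      have h3 : B (Sum.inl j) = u j := by
        simp only [B, Module.Basis.sumExtend, Module.Basis.reindex_apply, Module.Basis.coe_extend]
        rfl
      rw [Module.Basis.reindex_apply, Equiv.symm_apply_apply, Module.Basis.reindex_apply,
        Equiv.symm_apply_apply, h3]
    have h2 : (finCongr hcard (e (Sum.inl j))).val = j.val := rfl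
    rw [← h1, ← formBasis_apply hω hs hf b', Module.Basis.equivFun_self]
    simp only [Fin.ext_iff, h2, eq_comm]
  exact ⟨(formBasis hω hs hf b').equivFun, hL 0, hL 1, hL 2, fun γ hγ =>
    ⟨b'.equivFun ⟨γ, hγ⟩, funext fun i => formBasis_equivFun hω hs hf b' ⟨γ, hγ⟩ i⟩⟩

theorem IsBar.projEquivToRestriction [Finite K] [Finite V] (hω : IsQuadGen K ω) (h : IsBar K ω v)
    {S : Set E} (hS : (RepMatroid.vecRep F v).IsSimplificationSet S) {r : ℕ}
    (hr : Module.finrank F V = r) {κ : Type*} {B : Matrix (Fin r) κ K} (hB : IsPGMatrix B) :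
    ((RepMatroid.vecRep F v).restrict S).ProjEquivToRestriction
      (RepMatroid.ofMatrix (barMatrix ω B)) := by
  obtain ⟨Γ, hs, hf, a, ha, b, hb, c, hc, hli, hall⟩ := h
  obtain ⟨L, hLa, hLb, hLc, hL⟩ := exists_form_coordinates hω hs hf ha hb hc hli hr
  refine projEquivToRestriction_of_cols hS _ L fun e he => ?_
  have hform : InForm F Γ (v e) → ∃ j, ∃ d : Fˣ, (barMatrix ω B).col j = (d : F) • L (v e) := by
    rintro ⟨f, hf0, hfe⟩
    obtain ⟨k, hk⟩ := hL _ hfe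
    rw [map_smul] at hk
    have hk0 : k ≠ 0 := by
      rintro rfl
      have h0 : f • L (v e) = 0 := by rw [hk]; ext i; simp
      rw [smul_eq_zero, LinearEquiv.map_eq_zero_iff] at h0
      exact h0.elim hf0 he
    obtain ⟨j, l, hl⟩ := hB.exists_smul_col hk0
    have hl0 : algebraMap K F (l : K) ≠ 0 := by simp
    refine ⟨Sum.inr j, Units.mk0 ((algebraMap K F (l : K))⁻¹ * f)
      (mul_ne_zero (inv_ne_zero hl0) hf0), ?_⟩
    rw [Units.val_mk0, mul_smul, hk, ← hl]
    ext i
    simp [barMatrix, Matrix.col]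
  rcases hall e with h | h
  · exact hform h
  obtain ⟨s, t, hst⟩ := Submodule.mem_span_pair.1 h
  have hcoord : ∀ i, L (v e) i = if i.val = 0 then s else if i.val = 1 then ω * s else
      if i.val = 2 then t else 0 := by
    intro i
    rw [← hst]
    simp only [map_add, map_smul, Pi.add_apply, Pi.smul_apply, hLa, hLb, hLc, smul_eq_mul]
    split_ifs <;> first | omega | ring
  -- A vector `s(a + ωb) + tc` with `t = 0` is the column (1,ω,0,…), with `s = 0` it is in the form,
  -- and otherwise it is (α,ωα,1,0,…) with `α = s/t`.
  by_cases ht : t = 0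
  · have hs0 : s ≠ 0 := by
      rintro rfl
      rw [ht] at hst
      simp at hst
      exact he hst.symm
    refine ⟨Sum.inl none, Units.mk0 s⁻¹ (inv_ne_zero hs0), ?_⟩
    ext i
    simp only [barMatrix, Matrix.col, Matrix.transpose_apply, Matrix.of_apply, Pi.smul_apply, hcoord,
      Units.val_mk0, smul_eq_mul, ht]
    split_ifs <;> field_simp <;> ring
  by_cases hs0 : s = 0
  · refine hform (inForm_of_eq_smul hc t ?_)
    rw [← hst, hs0, zero_smul, zero_add]
  · refine ⟨Sum.inl (some ⟨t⁻¹ * s, mul_ne_zero (inv_ne_zero ht) hs0⟩),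
      Units.mk0 t⁻¹ (inv_ne_zero ht), ?_⟩
    ext i
    simp only [barMatrix, Matrix.col, Matrix.transpose_apply, Matrix.of_apply, Pi.smul_apply, hcoord,
      Units.val_mk0, smul_eq_mul]
    (split_ifs <;> field_simp); ring

end Matrices

theorem mainTheorem2 {q : ℕ} (hq : IsPrimePow q)
    {K : Type*} [Field K] (hK : Nat.card K = q)
    {F : Type*} [Field F] [Algebra K F] (hF : Nat.card F = q ^ 2)
    (ω : F) (hω : ω ∉ Set.range (algebraMap K F))
    {E : Type*} [Finite E] (M : RepMatroid F E) (r : ℕ) (hr : M.rank = r)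
    (hround : M.IsRound)
    (hPG : M.HasPGMinor K (12 * q ^ 12 + 20))
    (hO : ¬ M.HasObstructionMinor K ω)
    {κ : Type*} (A : Matrix (Fin (r - 1)) κ K) (hA : IsPGMatrix A)
    {κ' : Type*} (B : Matrix (Fin r) κ' K) (hB : IsPGMatrix B)
    (S : Set E) (hS : M.IsSimplificationSet S) :
    (M.restrict S).ProjEquivToRestriction (RepMatroid.ofMatrix (hatMatrix F A)) ∨
    (M.restrict S).ProjEquivToRestriction (RepMatroid.ofMatrix (barMatrix ω B)) := by
  have hq0 := hq.pos
  have hgen := isQuadGen_of_card hq hK hF hω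
  have : Finite K := Nat.finite_of_card_ne_zero (by omega)
  have : Finite F := Nat.finite_of_card_ne_zero (by rw [hF]; positivity)
  obtain ⟨v, hMv, hv⟩ := RepMatroid.exists_vecRep M
  have : Finite (Module.Dual F M) := Module.finite_of_finite F
  have hO' : ¬ HasObs K ω v := fun h => hO (hMv ▸ h.hasObstructionMinor hgen)
  have hrank : Module.finrank F (Module.Dual F M) = r := by
    have h1 : (RepMatroid.vecRep F v).rank = Module.finrank F (Module.Dual F M) := by
      rw [RepMatroid.rank, RepMatroid.rk_vecRep, Set.image_univ, hv, finrank_top]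
    rw [← h1, ← hMv, hr]
  obtain ⟨C, Λ, hcore, hfr⟩ := exists_isCore_of_hasPGMinor hgen hv (by omega) (hMv ▸ hPG)
  -- The abundance parameter is `k = 4q¹⁰`. The induction needs `3k + 14 = 12q¹⁰ + 14`, which is at
  -- most the rank `12q¹² + 20` of the given geometry.
  have hle : q ^ 5 * (3 * q ^ 5 + 1) ≤ 4 * q ^ 10 := by
    have h1 : q ^ 5 ≤ q ^ 10 := Nat.pow_le_pow_right hq0 (by norm_num)
    calc q ^ 5 * (3 * q ^ 5 + 1) = 3 * q ^ 10 + q ^ 5 := by ring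
      _ ≤ 4 * q ^ 10 := by omega
  have hle' : q ^ 10 ≤ q ^ 12 := Nat.pow_le_pow_right hq0 (by norm_num)
  have hquot := (Submodule.span F (v '' C)).finrank_quotient_add_finrank
  have hS' := hS
  rw [hMv] at hS'
  rcases isHat_or_isBar_of_isCore hK hF hq0 hgen hle _ _ v C Λ rfl hv
    (RepMatroid.roundVec_of_isRound hv (hMv ▸ hround)) hcore (by omega) hO' with h | h
  · left
    have := h.projEquivToRestriction hgen hS' (m := r - 1) (by omega) hA
    rwa [← hMv] at this
  · right
    have := h.projEquivToRestriction hgen hS' hrank hB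
    rwa [← hMv] at this
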